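/- Let $T>0$. For $l\ge 0$ let $C_T^l$ be the space of $l$ times continuously differentiable functions on $[0,1]\times\mathbb R$ that are $T$-periodic in the second variable $t$, and $C_T=C_T^0$ with the maximum norm; $C_T^l(\mathbb R)$ denotes the $T$-periodic $C^l$ functions on $\mathbb R$. Consider the time-periodic Robin problem $$\partial_t^2w-a^2\partial_x^2w+a_1\partial_tw+a_2\partial_xw+a_3w=f(x,t),\quad x\in(0,1),$$ $$w(x,t)=w(x,t+T),\qquad \partial_xw(0,t)=r_0(t)w(0,t),\quad \partial_xw(1,t)=r_1(t)w(1,t),$$ where $a\in C_T^2$, $a_1,a_2\in C_T^1$, $a_3\in C_T$, $r_0,r_1\in C_T^1(\mathbb R)$, $a>0$ on $[0,1]\times\mathbb R$ and $C:=\int_0^Ta(0,t)r_0(t)\,dt\neq0$. *Notation.* Put $$b_{11}=\tfrac{a_1}{2}+\tfrac{a_2}{2a}+\tfrac{a\partial_xa-\partial_ta}{2a},\quad b_{12}=\tfrac{a_1}{2}-\tfrac{a_2}{2a}-\tfrac{a\partial_xa-\partial_ta}{2a},$$ $$b_{21}=\tfrac{a_1}{2}+\tfrac{a_2}{2a}+\tfrac{a\partial_xa+\partial_ta}{2a},\quad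 b_{22}=\tfrac{a_1}{2}-\tfrac{a_2}{2a}-\tfrac{a\partial_xa+\partial_ta}{2a}.$$ For $j=1,2$ let $\xi\mapsto\tau_j(\xi,x,t)$, $\xi\in[0,1]$, be the solution of $\partial_\xi\tau_j=(-1)^j/a(\xi,\tau_j)$, $\tau_j(x,x,t)=t$, and put $$c_j(\xi,x,t)=\exp\int_x^\xi(-1)^j\left(\tfrac{b_{jj}}{a}\right)(\eta,\tau_j(\eta,x,t))\,d\eta,\qquad d_j(\xi,x,t)=\frac{(-1)^jc_j(\xi,x,t)}{a(\xi,\tau_j(\xi,x,t))}.$$ For $u=(u_1,u_2)\in C_T\times C_T$ put $$[Iu](t)=\int_0^t\tfrac{u_1(0,s)+u_2(0,s)}{2}\,ds,\quad [Ju](x,t)=\int_0^x\tfrac{u_1(\xi,t)-u_2(\xi,t)}{2a(\xi,t)}\,d\xi,$$ $$Nu=\tfrac1C\int_0^T\Bigl(\tfrac{u_1(0,t)-u_2(0,t)}{2}-a(0,t)r_0(t)[Iu](t)\Bigr)dt,\quad [Gu](t)=[Iu](t)+Nu,\quad [Fu](x,t)=[Gu](t)+[Ju](x,t).$$ *Weak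 solutions.* Let $f\in C_T$. A function $w:[0,1]\times\mathbb R\to\mathbb R$ is a weak solution of the Robin problem if $w(x,t)=[Iu](t)+[Ju](x,t)+Nu$ for some $u\in C_T\times C_T$ such that, for all $x\in[0,1]$, $t\in\mathbb R$, with $\tau_j(\xi)=\tau_j(\xi,x,t)$, $$u_1(x,t)=c_1(0,x,t)\bigl[u_2(0,\tau_1(0))+2a(0,\tau_1(0))r_0(\tau_1(0))[Gu](\tau_1(0))\bigr]-\int_0^xd_1(\xi,x,t)(b_{12}u_2)(\xi,\tau_1(\xi))\,d\xi+\int_0^xd_1(\xi,x,t)(f-a_3Fu)(\xi,\tau_1(\xi))\,d\xi,$$ $$u_2(x,t)=c_2(1,x,t)\bigl[u_1(1,\tau_2(1))-2a(1,\tau_2(1))r_1(\tau_2(1))[Fu](1,\tau_2(1))\bigr]-\int_1^xd_2(\xi,x,t)(b_{21}u_1)(\xi,\tau_2(\xi))\,d\xi+\int_1^xd_2(\xi,x,t)(f-a_3Fu)(\xi,\tau_2(\xi))\,d\xi.$$ **Theorem.** Assume in addition that either $$\int_0^1\left[\left(\tfrac{b_{11}}{a}\right)(\eta,\tau_1(\eta,1,t))+\left(\tfrac{b_{22}}{a}\right)(\eta,\tau_2(\eta,0,\tau_1(0,1,t)))\right]d\eta\neq0\quad\text{for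 all }t\in\mathbb R,$$ or $$\int_0^1\left[\left(\tfrac{b_{22}}{a}\right)(\eta,\tau_2(\eta,0,t))+\left(\tfrac{b_{11}}{a}\right)(\eta,\tau_1(\eta,1,\tau_2(1,0,t)))\right]d\eta\neq0\quad\text{for all }t\in\mathbb R.$$ Then every weak solution (for any $f\in C_T$) belongs to $C_T^1$, and: (i) the weak solutions with $f=0$ form a finite-dimensional vector space $\mathcal K_w$; (ii) the set of all $f\in C_T$ for which a weak solution exists is a closed linear subspace of $C_T$ of codimension $\dim\mathcal K_w$; (iii) either $\dim\mathcal K_w>0$, or for every $f\in C_T$ there is exactly one weak solution (and not both). -/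

import Mathlib

open Set
open scoped BoundedContinuousFunction

noncomputable section

namespace RobinWave

/-- The Banach space of continuous functions on `[0,1] × ℝ` that are `T`-periodic in the second
variable, with the maximum norm (such functions are bounded, so it is a subspace of the bounded
continuous functions). -/
def CT (T : ℝ) :
    @Submodule ℝ ((unitInterval × ℝ) →ᵇ ℝ) _ AddCommGroup.toAddCommMonoid NormedSpace.toModule where
  carrier := {u | ∀ (x : unitInterval) (t : ℝ), u (x, t + T) = u (x, t)}
  add_mem' := fun {u v} hu hv x t => by
    have h1 := hu x t
    have h2 := hv x t
    simp [h1, h2]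
  zero_mem' := fun x t => by simp
  smul_mem' := fun c u hu x t => by
    have h1 := hu x t
    simp [h1]

/-- The value at `(x, t)`, with `x` real, of a function on `[0,1] × ℝ`
(only used for `x ∈ [0,1]`). -/
def ev (v : unitInterval × ℝ → ℝ) (x t : ℝ) : ℝ := v (projIcc 0 1 zero_le_one x, t)

/-- `l` times continuously differentiable on `[0,1] × ℝ` (up to the boundary) and `T`-periodic
in the second variable. -/
def IsCTl (T : ℝ) (l : ℕ) (g : ℝ → ℝ → ℝ) : Prop :=
  ContDiffOn ℝ l (fun q : ℝ × ℝ => g q.1 q.2) (Icc 0 1 ×ˢ univ) ∧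
    ∀ x ∈ Icc (0 : ℝ) 1, ∀ t, g x (t + T) = g x t

/-- The data of the problem: period, coefficients of the equation on `[0,1] × ℝ`
(values at `x ∉ [0,1]` are never used) and of the boundary conditions. -/
structure Data where
  T : ℝ
  a : ℝ → ℝ → ℝ
  a₁ : ℝ → ℝ → ℝ
  a₂ : ℝ → ℝ → ℝ
  a₃ : ℝ → ℝ → ℝ
  r₀ : ℝ → ℝ
  r₁ : ℝ → ℝ

/-- The derivative in the space variable on `[0,1]` (one-sided at the end points). -/
def dx (g : ℝ → ℝ → ℝ) (x t : ℝ) : ℝ := derivWithin (fun y => g y t) (Icc 0 1) x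

/-- The derivative in the time variable. -/
def dt (g : ℝ → ℝ → ℝ) (x t : ℝ) : ℝ := deriv (fun s => g x s) t

/-- `y` is, on `[0,1]`, the solution of `y' = σ / a(ξ, y)`, `y(x) = t`. -/
def IsCharacteristic (a : ℝ → ℝ → ℝ) (σ x t : ℝ) (y : ℝ → ℝ) : Prop :=
  y x = t ∧ ∀ ξ ∈ Icc (0 : ℝ) 1, HasDerivWithinAt y (σ / a ξ (y ξ)) (Icc 0 1) ξ

/-- `ξ ↦ charCurve a σ ξ x t` is the characteristic with sign `σ` through `(x, t)`. -/
def charCurve (a : ℝ → ℝ → ℝ) (σ ξ x t : ℝ) : ℝ :=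
  Classical.epsilon (IsCharacteristic a σ x t) ξ

namespace Data

variable (p : Data)

def τ₁ (ξ x t : ℝ) : ℝ := charCurve p.a (-1) ξ x t

def τ₂ (ξ x t : ℝ) : ℝ := charCurve p.a 1 ξ x t

def b₁₁ (x t : ℝ) : ℝ :=
  p.a₁ x t / 2 + p.a₂ x t / (2 * p.a x t)
    + (p.a x t * dx p.a x t - dt p.a x t) / (2 * p.a x t)

def b₁₂ (x t : ℝ) : ℝ :=
  p.a₁ x t / 2 - p.a₂ x t / (2 * p.a x t)
    - (p.a x t * dx p.a x t - dt p.a x t) / (2 * p.a x t)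

def b₂₁ (x t : ℝ) : ℝ :=
  p.a₁ x t / 2 + p.a₂ x t / (2 * p.a x t)
    + (p.a x t * dx p.a x t + dt p.a x t) / (2 * p.a x t)

def b₂₂ (x t : ℝ) : ℝ :=
  p.a₁ x t / 2 - p.a₂ x t / (2 * p.a x t)
    - (p.a x t * dx p.a x t + dt p.a x t) / (2 * p.a x t)

def c₁ (ξ x t : ℝ) : ℝ :=
  Real.exp (∫ η in x..ξ, -(p.b₁₁ η (p.τ₁ η x t) / p.a η (p.τ₁ η x t)))

def c₂ (ξ x t : ℝ) : ℝ :=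
  Real.exp (∫ η in x..ξ, p.b₂₂ η (p.τ₂ η x t) / p.a η (p.τ₂ η x t))

def d₁ (ξ x t : ℝ) : ℝ := -(p.c₁ ξ x t / p.a ξ (p.τ₁ ξ x t))

def d₂ (ξ x t : ℝ) : ℝ := p.c₂ ξ x t / p.a ξ (p.τ₂ ξ x t)

/-- The constant `C`. -/
def const : ℝ := ∫ t in (0 : ℝ)..p.T, p.a 0 t * p.r₀ t

/-- The space of pairs `(u₁, u₂)` of elements of `C_T`. -/
abbrev Pair : Type := CT p.T × CT p.T

variable {p}

def Iop (u : p.Pair) (t : ℝ) : ℝ := ∫ s in (0 : ℝ)..t, (ev u.1 0 s + ev u.2 0 s) / 2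

def Jop (u : p.Pair) (x t : ℝ) : ℝ :=
  ∫ ξ in (0 : ℝ)..x, (ev u.1 ξ t - ev u.2 ξ t) / (2 * p.a ξ t)

def Nop (u : p.Pair) : ℝ :=
  (1 / p.const) *
    ∫ t in (0 : ℝ)..p.T, ((ev u.1 0 t - ev u.2 0 t) / 2 - p.a 0 t * p.r₀ t * Iop u t)

def Gop (u : p.Pair) (t : ℝ) : ℝ := Iop u t + Nop u

def Fop (u : p.Pair) (x t : ℝ) : ℝ := Gop u t + Jop u x t

variable (p)

/-- Weak solutions `u` of the first-order system: continuous solutions of the integral equations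
obtained by integration along the characteristics. -/
def IsWeakSystemSolution (f : CT p.T) (u : p.Pair) : Prop :=
  ∀ x ∈ Icc (0 : ℝ) 1, ∀ t : ℝ,
    (ev u.1 x t =
      p.c₁ 0 x t * (ev u.2 0 (p.τ₁ 0 x t)
          + 2 * p.a 0 (p.τ₁ 0 x t) * p.r₀ (p.τ₁ 0 x t) * Gop u (p.τ₁ 0 x t))
        - (∫ ξ in (0 : ℝ)..x, p.d₁ ξ x t * p.b₁₂ ξ (p.τ₁ ξ x t) * ev u.2 ξ (p.τ₁ ξ x t))
        + ∫ ξ in (0 : ℝ)..x, p.d₁ ξ x t *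
            (ev f ξ (p.τ₁ ξ x t) - p.a₃ ξ (p.τ₁ ξ x t) * Fop u ξ (p.τ₁ ξ x t))) ∧
    (ev u.2 x t =
      p.c₂ 1 x t * (ev u.1 1 (p.τ₂ 1 x t)
          - 2 * p.a 1 (p.τ₂ 1 x t) * p.r₁ (p.τ₂ 1 x t) * Fop u 1 (p.τ₂ 1 x t))
        - (∫ ξ in (1 : ℝ)..x, p.d₂ ξ x t * p.b₂₁ ξ (p.τ₂ ξ x t) * ev u.1 ξ (p.τ₂ ξ x t))
        + ∫ ξ in (1 : ℝ)..x, p.d₂ ξ x t *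
            (ev f ξ (p.τ₂ ξ x t) - p.a₃ ξ (p.τ₂ ξ x t) * Fop u ξ (p.τ₂ ξ x t)))

/-- Weak solutions `w` of the time-periodic Robin problem with right-hand side `f`: the functions
`w(x, t) = [Iu](t) + [Ju](x, t) + Nu` with `u` a weak solution of the first-order system. -/
def IsWeakSolution (f : CT p.T) (w : unitInterval × ℝ → ℝ) : Prop :=
  ∃ u : p.Pair, p.IsWeakSystemSolution f u ∧
    ∀ (x : unitInterval) (t : ℝ), w (x, t) = Iop u t + Jop u x t + Nop u

/-- The first non-resonance condition. -/
def NonResonant : Prop :=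
  ∀ t : ℝ, (∫ η in (0 : ℝ)..1,
    (p.b₁₁ η (p.τ₁ η 1 t) / p.a η (p.τ₁ η 1 t)
      + p.b₂₂ η (p.τ₂ η 0 (p.τ₁ 0 1 t)) / p.a η (p.τ₂ η 0 (p.τ₁ 0 1 t)))) ≠ 0

/-- The second non-resonance condition. -/
def NonResonant' : Prop :=
  ∀ t : ℝ, (∫ η in (0 : ℝ)..1,
    (p.b₂₂ η (p.τ₂ η 0 t) / p.a η (p.τ₂ η 0 t)
      + p.b₁₁ η (p.τ₁ η 1 (p.τ₂ 1 0 t)) / p.a η (p.τ₁ η 1 (p.τ₂ 1 0 t)))) ≠ 0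

end Data

end RobinWave

end

/-!
The unknown is the periodic function `h = ∂_t w(0, ·) + w(0, 0)`, from which `w(0, ·)` is recovered
as the periodic primitive `prim h`. The boundary condition at `x = 0` expresses `u₁(0, ·)` and
`u₂(0, ·)` through `h`, and since both families of characteristics are transversal to the lines
`x = const`, the first-order system can be solved with `x` in the role of time: it is a Volterra
equation `u = data h + source f + volterra u`, uniquely solvable because the powers of the Volterra
operator have factorially decaying norms (`isUnit_one_sub_volterra`). What remains is the boundary
condition at `x = 1`, an equation `circleOp h + circleSource f = 0` for one periodic function `h`
(`exists_isWeak_iff`). The condition `∫ a r₀ ≠ 0` makes the function `G u` of a weak solution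
periodic (`exists_of_boundary`), and `w(0, ·) = prim h` makes the correspondence between `h` and `w`
injective (`wave_injective`).

The operator `circleOp` is a compact perturbation of `leadingOp`, the difference of the transports
from `x = 0` to `x = 1` along the two families of characteristics. Compactness
(`isCompactOperator_circleOp_sub`) comes from integrals over one family of functions transported
along a transversal one: integration by parts trades the function for its primitive, up to an
arbitrarily small error (`isCompactOperator_oscillating`). The operator `leadingOp` factors through
`1 - L` with `L` a weighted composition operator on the circle; non-resonance says that the positive
weight is never `1`, so that by connectedness it is everywhere less than `1` or everywhere greater
than `1`, and `1 - L` is invertible (`isUnit_leadingOp`). Thus `circleOp` has closed range, and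
kernel and cokernel of the same finite dimension (`fredholm_index_zero`). The functions
`w = (x³ - x²) γ(t)` with smooth periodic `γ` show that `circleSource` has dense range
(`denseRange_circleSource`), so it maps onto the cokernel, and the solvable right-hand sides have
codimension `dim ker circleOp` (`solvable_codim`).

Regularity (`contDiffOn_wave`): the functions `u₁`, `u₂` are only continuous, but the integral of
`u₁ + u₂` over a time interval can be differentiated in `x` by using the trajectories as
coordinates, and its derivative is the increment of `(u₁ - u₂) / a`, because the coefficients
satisfy `b₁₁ - b₂₁ = -∂_t a / a` and `b₁₂ - b₂₂ = ∂_t a / a`. Hence the increments of `w` in time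
are the integrals of `(u₁ + u₂) / 2`, and `w` has the continuous partial derivatives
`∂_t w = (u₁ + u₂) / 2` and `∂_x w = (u₁ - u₂) / (2 a)`.
-/

noncomputable section

set_option linter.unusedSectionVars false

open Filter Topology MeasureTheory

namespace RobinWave

/-! ### Compact perturbations of invertible operators -/

section Fredholm

variable {E : Type*} [NormedAddCommGroup E] [NormedSpace ℝ E]

lemma finiteDimensional_ker_add_compact {A K : E →L[ℝ] E} (hA : IsUnit A)
    (hK : IsCompactOperator K) : FiniteDimensional ℝ (A + K).ker := by
  obtain ⟨U, rfl⟩ := hA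
  set W : E →L[ℝ] E := ((U⁻¹ : (E →L[ℝ] E)ˣ) : E →L[ℝ] E) with hW
  have h2 : IsCompactOperator (-(W * K) : E →L[ℝ] E) := (hK.continuous_comp W.continuous).neg
  have hfix : ∀ x ∈ ((U : E →L[ℝ] E) + K).ker, (-(W * K) : E →L[ℝ] E) x = x := by
    intro x hx
    have hx' : (U : E →L[ℝ] E) x + K x = 0 := hx
    have : W ((U : E →L[ℝ] E) x) = x := congrArg (fun f : E →L[ℝ] E => f x) U.inv_mul
    have h3 : K x = - (U : E →L[ℝ] E) x := by rw [eq_neg_iff_add_eq_zero, add_comm]; exact hx'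
    simp [h3, this]
  have hcl : IsClosed ((((U : E →L[ℝ] E) + K).ker : Submodule ℝ E) : Set E) :=
    ContinuousLinearMap.isClosed_ker _
  have hres := h2.restrict (V := ((U : E →L[ℝ] E) + K).ker)
    (fun x hx => by
      have := hfix x hx
      simp only [ContinuousLinearMap.coe_coe] at *
      rw [this]; exact hx) hcl
  refine FiniteDimensional.of_isCompactOperator_id (𝕜 := ℝ) ?_
  have hid : ⇑(((-(W * K) : E →L[ℝ] E) : E →ₗ[ℝ] E).restrict fun x hx => by
      have := hfix x hx
      simp only [ContinuousLinearMap.coe_coe] at *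
      rw [this]; exact hx) = (id : ((U : E →L[ℝ] E) + K).ker → ((U : E →L[ℝ] E) + K).ker) :=
    funext fun x => Subtype.ext (hfix x.1 x.2)
  exact hid ▸ hres

/-- An operator controlled, up to an arbitrarily small multiple of the norm, by a compact one is
compact. -/
lemma isCompactOperator_of_ehrling {F G : Type*} [NormedAddCommGroup F] [NormedSpace ℝ F]
    [NormedAddCommGroup G] [NormedSpace ℝ G] {P : E →L[ℝ] G} (hP : IsCompactOperator P)
    {Q : E →L[ℝ] F} [CompleteSpace F]
    (h : ∀ ε > 0, ∃ C, ∀ x, ‖Q x‖ ≤ ε * ‖x‖ + C * ‖P x‖) : IsCompactOperator Q := by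
  obtain ⟨S, hS, hPS⟩ := hP.image_closedBall_subset_compact 1
  have htb : TotallyBounded (P '' Metric.closedBall 0 1) := hS.totallyBounded.subset hPS
  refine (isCompactOperator_iff_exists_mem_nhds_image_subset_compact Q).2
    ⟨Metric.closedBall 0 1, Metric.closedBall_mem_nhds _ one_pos,
      closure (Q '' Metric.closedBall 0 1), ?_, subset_closure⟩
  refine TotallyBounded.isCompact_of_isClosed (TotallyBounded.closure ?_) isClosed_closure
  rw [Metric.totallyBounded_iff]
  intro ε hε
  obtain ⟨C, hC⟩ := h (ε / 4) (by positivity)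
  obtain ⟨t, htsub, htfin, ht⟩ := Metric.finite_approx_of_totallyBounded htb
    (ε / (4 * (|C| + 1))) (by positivity)
  have hex : ∀ y ∈ t, ∃ x ∈ Metric.closedBall (0 : E) 1, P x = y := fun y hy => htsub hy
  choose! s hs hPs using hex
  refine ⟨(fun y => Q (s y)) '' t, htfin.image _, ?_⟩
  rintro _ ⟨x, hx, rfl⟩
  obtain ⟨y, hy, hxy⟩ := mem_iUnion₂.1 (ht (mem_image_of_mem P hx))
  refine mem_iUnion₂.2 ⟨_, mem_image_of_mem _ hy, ?_⟩
  rw [Metric.mem_ball, dist_eq_norm, ← hPs y hy, ← map_sub] at hxy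
  rw [Metric.mem_ball, dist_eq_norm, ← map_sub]
  have h1 : ‖x - s y‖ ≤ 2 := by
    have h2 := hs y hy
    rw [mem_closedBall_zero_iff] at hx h2
    exact (norm_sub_le _ _).trans (by linarith)
  have h3 : C * ‖P (x - s y)‖ ≤ (|C| + 1) * (ε / (4 * (|C| + 1))) :=
    mul_le_mul ((le_abs_self C).trans (by linarith)) hxy.le (norm_nonneg _) (by positivity)
  have h4 : (|C| + 1) * (ε / (4 * (|C| + 1))) = ε / 4 := by field_simp
  have h6 : ε / 4 * ‖x - s y‖ ≤ ε / 4 * 2 := mul_le_mul_of_nonneg_left h1 (by positivity)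
  calc ‖Q (x - s y)‖ ≤ ε / 4 * ‖x - s y‖ + C * ‖P (x - s y)‖ := hC _
    _ ≤ ε / 4 * 2 + ε / 4 := add_le_add h6 (h3.trans h4.le)
    _ < ε := by linarith

variable [CompleteSpace E]

lemma isUnit_one_sub_of_injective {K : E →L[ℝ] E} (hK : IsCompactOperator K)
    (hinj : Function.Injective (1 - K : E →L[ℝ] E)) : IsUnit (1 - K) := by
  rcases hK.hasEigenvalue_or_mem_resolventSet (one_ne_zero (α := ℝ)) with h | h
  · obtain ⟨v, hv⟩ := h.exists_hasEigenvector
    have h1 : K v = v := by simpa using hv.apply_eq_smul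
    refine absurd (hinj (a₁ := v) (a₂ := 0) ?_) hv.2
    simp [h1]
  · simpa [spectrum.mem_resolventSet_iff] using h

/-- The Fredholm alternative. -/
lemma isUnit_of_isUnit_add_compact_injective {A K : E →L[ℝ] E} (hA : IsUnit A)
    (hK : IsCompactOperator K) (hinj : Function.Injective (A + K : E →L[ℝ] E)) :
    IsUnit (A + K) := by
  obtain ⟨U, rfl⟩ := hA
  have h1 : (U : E →L[ℝ] E) + K = U * (1 - (-((U⁻¹ : (E →L[ℝ] E)ˣ) : E →L[ℝ] E)) * K) := by
    simp [mul_add, ← mul_assoc]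
  have h2 : IsCompactOperator ((-((U⁻¹ : (E →L[ℝ] E)ˣ) : E →L[ℝ] E)) * K : E →L[ℝ] E) :=
    hK.continuous_comp (-((U⁻¹ : (E →L[ℝ] E)ˣ) : E →L[ℝ] E)).continuous
  rw [h1] at hinj ⊢
  refine U.isUnit.mul (isUnit_one_sub_of_injective h2 ?_)
  exact Function.Injective.of_comp (f := (U : E →L[ℝ] E)) hinj

/-- A surjective compact perturbation of an invertible operator is injective, because its right
inverse with values in a complement of the kernel is invertible. -/
lemma injective_of_surjective_add_compact {A K : E →L[ℝ] E} (hA : IsUnit A)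
    (hK : IsCompactOperator K) (hs : Function.Surjective (A + K : E →L[ℝ] E)) :
    Function.Injective (A + K : E →L[ℝ] E) := by
  have hfd := finiteDimensional_ker_add_compact hA hK
  have hc : (A + K).ker.ClosedComplemented := Submodule.ClosedComplemented.of_finiteDimensional _
  obtain ⟨M, hMcl, hM⟩ := hc.exists_isClosed_isCompl
  have : CompleteSpace M := hMcl.completeSpace_coe
  set S : E →L[ℝ] E := A + K with hS
  have hker : (S ∘L M.subtypeL).ker = ⊥ := by
    rw [LinearMap.ker_eq_bot']
    intro m hm
    have h1 : (m : E) ∈ S.ker := hm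
    exact Subtype.ext (Submodule.disjoint_def.1 hM.disjoint _ h1 m.2)
  have hran : (S ∘L M.subtypeL).range = ⊤ := by
    rw [LinearMap.range_eq_top]
    intro y
    obtain ⟨x, rfl⟩ := hs y
    obtain ⟨n, hn, m, hm, rfl⟩ := Submodule.mem_sup.1 (hM.sup_eq_top ▸ Submodule.mem_top (x := x))
    refine ⟨⟨m, hm⟩, ?_⟩
    have h1 : S n = 0 := hn
    simp [h1]
  let e := ContinuousLinearEquiv.ofBijective (S ∘L M.subtypeL) hker hran
  let R : E →L[ℝ] E := M.subtypeL ∘L (e.symm : E →L[ℝ] M)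
  have hR : ∀ y, S (R y) = y := fun y =>
    ContinuousLinearEquiv.ofBijective_apply_symm_apply (S ∘L M.subtypeL) hker hran y
  -- `R = A⁻¹ - A⁻¹ K R` is an injective compact perturbation of `A⁻¹`, so it is invertible.
  obtain ⟨U, rfl⟩ := hA
  set W : E →L[ℝ] E := ((U⁻¹ : (E →L[ℝ] E)ˣ) : E →L[ℝ] E) with hW
  have hWU : ∀ x, W ((U : E →L[ℝ] E) x) = x :=
    fun x => congrArg (fun f : E →L[ℝ] E => f x) U.inv_mul
  have hRe : R = W + (-(W ∘L K ∘L R)) := by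
    ext y
    have h1 : (U : E →L[ℝ] E) (R y) + K (R y) = y := hR y
    have h2 := congrArg W h1
    rw [map_add, hWU] at h2
    simp [← h2]
  have hcomp : IsCompactOperator (-(W ∘L K ∘L R) : E →L[ℝ] E) :=
    ((hK.comp_clm R).continuous_comp W.continuous).neg
  have hRinj : Function.Injective R := Function.LeftInverse.injective hR
  have hRu : IsUnit R := by
    rw [hRe] at hRinj ⊢
    exact isUnit_of_isUnit_add_compact_injective (Units.isUnit _) hcomp hRinj
  obtain ⟨Ru, hRu⟩ := hRu
  have hRsurj : Function.Surjective R := fun x =>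
    ⟨((Ru⁻¹ : (E →L[ℝ] E)ˣ) : E →L[ℝ] E) x, by
      rw [← hRu]; exact congrArg (fun f : E →L[ℝ] E => f x) Ru.mul_inv⟩
  intro x y hxy
  obtain ⟨x, rfl⟩ := hRsurj x
  obtain ⟨y, rfl⟩ := hRsurj y
  rw [hR, hR] at hxy
  rw [hxy]

/-- A compact perturbation of an invertible operator on a Banach space has closed range and finite
dimensional kernel and cokernel, of the same dimension. -/
theorem fredholm_index_zero {A K : E →L[ℝ] E} (hA : IsUnit A) (hK : IsCompactOperator K) :
    FiniteDimensional ℝ (A + K).ker ∧ IsClosed ((A + K).range : Set E) ∧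
      Nonempty ((A + K).ker ≃ₗ[ℝ] (E ⧸ (A + K).range)) := by
  have hfd := finiteDimensional_ker_add_compact hA hK
  refine ⟨hfd, ?_⟩
  set S : E →L[ℝ] E := A + K with hS
  obtain ⟨π, hπ⟩ : S.ker.ClosedComplemented := Submodule.ClosedComplemented.of_finiteDimensional _
  have hππ : ∀ x, π (x - π x) = 0 := fun x => by rw [map_sub, hπ, sub_self]
  have hSπ : ∀ x, S (π x) = 0 := fun x => (π x).2
  obtain ⟨s, hs⟩ := S.range.mkQ.exists_rightInverse_of_surjective (Submodule.range_mkQ _)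
  have hs' : ∀ q, S.range.mkQ (s q) = q := fun q => congrArg (fun f => f q) hs
  -- Finite rank corrections of `S` by a linear map from the kernel to the cokernel.
  have key : ∀ f : S.ker →ₗ[ℝ] (E ⧸ S.range), ∃ P : E →L[ℝ] E, IsCompactOperator P ∧
      ∀ x, P x = s (f (π x)) := by
    intro f
    let g : S.ker →L[ℝ] E := LinearMap.toContinuousLinearMap (s ∘ₗ f)
    refine ⟨g ∘L π, ?_, fun x => rfl⟩
    have := FiniteDimensional.proper ℝ S.ker
    exact (isCompactOperator_of_locallyCompactSpace_dom π).continuous_comp g.continuous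
  have hmk : ∀ x, S.range.mkQ (S x) = 0 := fun x => by simp
  have hmk0 : ∀ y, S.range.mkQ y = 0 → ∃ z, S z = y := fun y hy => by simpa using hy
  have hinj_of : ∀ (f : S.ker →ₗ[ℝ] (E ⧸ S.range)) (P : E →L[ℝ] E),
      (∀ x, P x = s (f (π x))) → Function.Injective f →
        Function.Injective (S + P : E →L[ℝ] E) := by
    intro f P hP hf
    rw [injective_iff_map_eq_zero]
    intro x hx
    have hx' : S x + s (f (π x)) = 0 := by rw [← hP]; exact hx
    have h1 := congrArg S.range.mkQ hx'
    rw [map_add, hmk, hs', zero_add, map_zero] at h1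
    have h2 : π x = 0 := hf (by rw [h1, map_zero])
    rw [h2, map_zero, map_zero, add_zero] at hx'
    have := hπ ⟨x, hx'⟩
    rw [h2] at this
    exact congrArg Subtype.val this.symm
  have hsurj_of : ∀ (f : S.ker →ₗ[ℝ] (E ⧸ S.range)) (P : E →L[ℝ] E),
      (∀ x, P x = s (f (π x))) → Function.Surjective f →
        Function.Surjective (S + P : E →L[ℝ] E) := by
    intro f P hP hf y
    obtain ⟨n, hn⟩ := hf (S.range.mkQ y)
    obtain ⟨z, hz⟩ := hmk0 (y - s (f n)) (by rw [map_sub, hs', hn, sub_self])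
    refine ⟨z - π z + n, ?_⟩
    have h1 : π (z - π z + n) = n := by rw [map_add, hππ, hπ, zero_add]
    have h2 : S n = 0 := n.2
    change S _ + P _ = y
    rw [hP, h1, map_add, map_sub, hSπ, h2, hz]
    abel
  have hassoc : ∀ P : E →L[ℝ] E, S + P = A + (K + P) := fun P => by rw [hS, add_assoc]
  obtain ⟨f, hf⟩ : ∃ f : S.ker →ₗ[ℝ] (E ⧸ S.range), Function.Injective f := by
    by_contra hno
    obtain ⟨f, hf, hfs⟩ : ∃ f : S.ker →ₗ[ℝ] (E ⧸ S.range),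
        ¬ Function.Injective f ∧ Function.Surjective f := by
      let bN := Module.Basis.ofVectorSpace ℝ S.ker
      let bQ := Module.Basis.ofVectorSpace ℝ (E ⧸ S.range)
      rcases Function.Embedding.total (Module.Basis.ofVectorSpaceIndex ℝ S.ker)
        (Module.Basis.ofVectorSpaceIndex ℝ (E ⧸ S.range)) with ⟨⟨e⟩⟩ | ⟨⟨e⟩⟩
      · refine absurd ⟨bQ.repr.symm.toLinearMap ∘ₗ Finsupp.lmapDomain ℝ ℝ e ∘ₗ
          bN.repr.toLinearMap, ?_⟩ hno
        exact bQ.repr.symm.injective.comp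
          ((Finsupp.mapDomain_injective e.injective).comp bN.repr.injective)
      · have hsurj : Function.Surjective (bQ.repr.symm.toLinearMap ∘ₗ
            Finsupp.lcomapDomain (R := ℝ) (M := ℝ) e e.injective ∘ₗ bN.repr.toLinearMap) := by
          have h1 : Function.Surjective (Finsupp.lcomapDomain (R := ℝ) (M := ℝ) e e.injective) :=
            fun l => ⟨Finsupp.mapDomain e l, Finsupp.comapDomain_mapDomain e e.injective l⟩
          exact bQ.repr.symm.surjective.comp (h1.comp bN.repr.surjective)
        exact ⟨_, fun h => hno ⟨_, h⟩, hsurj⟩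
    obtain ⟨P, hPc, hP⟩ := key f
    have h1 := hsurj_of f P hP hfs
    rw [hassoc] at h1
    have h2 := injective_of_surjective_add_compact hA (hK.add hPc) h1
    rw [← hassoc] at h2
    refine hf ((injective_iff_map_eq_zero f).2 fun n hn => ?_)
    have h3 : (S + P) (n : E) = 0 := by
      change S n + P n = 0
      have : S n = 0 := n.2
      rw [hP, hπ, hn, map_zero, this, add_zero]
    exact Subtype.ext (h2 (h3.trans (map_zero _).symm))
  obtain ⟨P, hPc, hP⟩ := key f
  have h1 := hinj_of f P hP hf
  have hU : IsUnit (S + P) := by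
    rw [hassoc] at h1 ⊢
    exact isUnit_of_isUnit_add_compact_injective hA (hK.add hPc) h1
  obtain ⟨U, hU⟩ := hU
  have hUinv : ∀ y, (S + P) (((U⁻¹ : (E →L[ℝ] E)ˣ) : E →L[ℝ] E) y) = y := fun y => by
    rw [← hU]; exact congrArg (fun f : E →L[ℝ] E => f y) U.mul_inv
  have hinvU : ∀ y, (((U⁻¹ : (E →L[ℝ] E)ˣ) : E →L[ℝ] E) ((S + P) y)) = y := fun y => by
    rw [← hU]; exact congrArg (fun f : E →L[ℝ] E => f y) U.inv_mul
  refine ⟨?_, ⟨LinearEquiv.ofBijective f ⟨hf, ?_⟩⟩⟩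
  · -- the range of `S` is the image of the closed subspace `π = 0` under the invertible `S + P`
    have : (S.range : Set E) = {y | π (((U⁻¹ : (E →L[ℝ] E)ˣ) : E →L[ℝ] E) y) = 0} := by
      ext y
      constructor
      · rintro ⟨x, rfl⟩
        have h2 : (S + P) (x - π x) = S x := by
          change S _ + P _ = _
          rw [hP, hππ, map_zero, map_zero, map_sub, hSπ, sub_zero, add_zero]
        change π _ = 0
        rw [ContinuousLinearMap.coe_coe, ← h2, hinvU, hππ]
      · intro hy
        refine ⟨((U⁻¹ : (E →L[ℝ] E)ˣ) : E →L[ℝ] E) y, ?_⟩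
        have h2 := hUinv y
        change S _ + P _ = _ at h2
        rwa [hP, show π _ = 0 from hy, map_zero, map_zero, add_zero] at h2
    rw [this]
    exact isClosed_eq (by fun_prop) continuous_const
  · intro q
    refine ⟨π (((U⁻¹ : (E →L[ℝ] E)ˣ) : E →L[ℝ] E) (s q)), ?_⟩
    have h2 := hUinv (s q)
    change S _ + P _ = _ at h2
    have h3 := congrArg S.range.mkQ h2
    rwa [map_add, hmk, hP, hs', hs', zero_add] at h3

/-- If some power of `V` is a strict contraction, then `1 - V` is invertible. -/
lemma isUnit_one_sub_of_norm_pow_lt_one {V : E →L[ℝ] E} (n : ℕ) (h : ‖V ^ n‖ < 1) :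
    IsUnit (1 - V) := by
  obtain ⟨U, hU⟩ : IsUnit (1 - V ^ n) := isUnit_one_sub_of_norm_lt_one h
  have hl : (1 - V) * ∑ i ∈ Finset.range n, V ^ i = U := hU ▸ mul_neg_geom_sum V n
  have hr : (∑ i ∈ Finset.range n, V ^ i) * (1 - V) = U := hU ▸ geom_sum_mul_neg V n
  refine isUnit_iff_exists_and_exists.2
    ⟨⟨(∑ i ∈ Finset.range n, V ^ i) * ((U⁻¹ : (E →L[ℝ] E)ˣ) : E →L[ℝ] E), ?_⟩,
      ⟨((U⁻¹ : (E →L[ℝ] E)ˣ) : E →L[ℝ] E) * ∑ i ∈ Finset.range n, V ^ i, ?_⟩⟩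
  · rw [← mul_assoc, hl, U.mul_inv]
  · rw [mul_assoc, hr, U.inv_mul]

end Fredholm

end RobinWave

namespace RobinWave

/-! ### The flow of a periodic scalar vector field -/

/-- A bounded time-dependent vector field `F` on the line, `T`-periodic in the state variable `y`,
with bounded continuous derivative `F'` in `y`. -/
structure PeriodicField (T : ℝ) where
  F : ℝ → ℝ → ℝ
  F' : ℝ → ℝ → ℝ
  cont : Continuous fun q : ℝ × ℝ => F q.1 q.2
  cont' : Continuous fun q : ℝ × ℝ => F' q.1 q.2
  hasDeriv : ∀ x y, HasDerivAt (F x) (F' x y) y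
  per : ∀ x y, F x (y + T) = F x y
  per' : ∀ x y, F' x (y + T) = F' x y
  bound : ∃ M, ∀ x y, |F x y| ≤ M
  bound' : ∃ L, ∀ x y, |F' x y| ≤ L

namespace PeriodicField

variable {T : ℝ} (V : PeriodicField T)

lemma exists_lipschitz : ∃ K : NNReal, ∀ x, LipschitzWith K (V.F x) := by
  obtain ⟨L, hL⟩ := V.bound'
  refine ⟨L.toNNReal, fun x => lipschitzWith_of_nnnorm_deriv_le
    (fun y => (V.hasDeriv x y).differentiableAt) fun y => ?_⟩
  rw [(V.hasDeriv x y).deriv, ← NNReal.coe_le_coe, coe_nnnorm, Real.norm_eq_abs]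
  exact (hL x y).trans (Real.le_coe_toNNReal L)

lemma exists_solution_Icc (x t : ℝ) (n : ℕ) : ∃ y : ℝ → ℝ, y x = t ∧
    ∀ ξ ∈ Icc (x - n) (x + n), HasDerivWithinAt y (V.F ξ (y ξ)) (Icc (x - n) (x + n)) ξ := by
  obtain ⟨K, hK⟩ := V.exists_lipschitz
  obtain ⟨M, hM⟩ := V.bound
  have hx : x ∈ Icc (x - n) (x + n) := by constructor <;> simp
  have hP : IsPicardLindelof V.F (⟨x, hx⟩ : Icc (x - n) (x + n)) t (M.toNNReal * n) 0
      M.toNNReal K := by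
    refine ⟨fun ξ _ => (hK ξ).lipschitzOnWith, fun y _ => ?_, fun ξ _ y _ => ?_, ?_⟩
    · exact (V.cont.comp (continuous_id.prodMk continuous_const)).continuousOn
    · exact (hM ξ y).trans (Real.le_coe_toNNReal M)
    · simp
  exact hP.exists_eq_forall_mem_Icc_hasDerivWithinAt₀

lemma exists_solution (x t : ℝ) : ∃ y : ℝ → ℝ, y x = t ∧
    ∀ ξ, HasDerivAt y (V.F ξ (y ξ)) ξ := by
  obtain ⟨K, hK⟩ := V.exists_lipschitz
  choose y hyx hy using V.exists_solution_Icc x t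
  have hderiv : ∀ (n : ℕ) ξ, ξ ∈ Ioo (x - n) (x + n) → HasDerivAt (y n) (V.F ξ (y n ξ)) ξ :=
    fun n ξ hξ => (hy n ξ (Ioo_subset_Icc_self hξ)).hasDerivAt (Icc_mem_nhds hξ.1 hξ.2)
  have hagree : ∀ m n : ℕ, 0 < m → m ≤ n → EqOn (y m) (y n) (Icc (x - m) (x + m)) := by
    intro m n hm hmn
    have hm' : (0 : ℝ) < m := by exact_mod_cast hm
    have hmn' : (m : ℝ) ≤ n := by exact_mod_cast hmn
    have hsub : Icc (x - m) (x + m) ⊆ Icc (x - n) (x + n) :=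
      Icc_subset_Icc (by linarith) (by linarith)
    refine ODE_solution_unique_of_mem_Icc (v := V.F) (s := fun _ => univ) (K := K) (t₀ := x)
      (fun ξ _ => (hK ξ).lipschitzOnWith) ⟨by linarith, by linarith⟩
      (fun ξ hξ => (hy m ξ hξ).continuousWithinAt) (fun ξ hξ => hderiv m ξ hξ) (fun _ _ => trivial)
      (fun ξ hξ => ((hy n ξ (hsub hξ)).continuousWithinAt).mono hsub) (fun ξ hξ => hderiv n ξ ?_)
      (fun _ _ => trivial) (by rw [hyx, hyx])
    exact ⟨by linarith [hξ.1], by linarith [hξ.2]⟩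
  let N : ℝ → ℕ := fun ξ => ⌈|ξ - x|⌉₊ + 1
  have hN : ∀ ξ, |ξ - x| < N ξ := fun ξ => by
    have := Nat.le_ceil |ξ - x|
    push_cast [N]; linarith
  have hkey : ∀ (n : ℕ) ξ, |ξ - x| < n → y (N ξ) ξ = y n ξ := by
    intro n ξ hξ
    have hn : 0 < n := by
      have : (0 : ℝ) < n := (abs_nonneg _).trans_lt hξ
      exact_mod_cast this
    have mem : ∀ k : ℕ, |ξ - x| < k → ξ ∈ Icc (x - k) (x + k) := fun k hk => by
      rw [abs_lt] at hk; constructor <;> linarith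
    rcases le_total (N ξ) n with h | h
    · exact hagree _ _ (Nat.succ_pos _) h (mem _ (hN ξ))
    · exact (hagree _ _ hn h (mem _ hξ)).symm
  refine ⟨fun ξ => y (N ξ) ξ, hyx _, fun ξ => ?_⟩
  have h1 := hderiv (N ξ) ξ (by have := hN ξ; rw [abs_lt] at this; constructor <;> linarith)
  refine h1.congr_of_eventuallyEq ?_
  have : ∀ᶠ η in 𝓝 ξ, |η - x| < N ξ :=
    ((continuous_id.sub continuous_const).abs.continuousAt).eventually_lt continuousAt_const (hN ξ)
  filter_upwards [this] with η hη
  exact hkey _ _ hη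

/-- `V.flow ξ x t` is the value at `ξ` of the solution of `y' = F(ξ, y)`, `y(x) = t`. -/
def flow (ξ x t : ℝ) : ℝ := Classical.choose (V.exists_solution x t) ξ

@[simp] lemma flow_self (x t : ℝ) : V.flow x x t = t :=
  (Classical.choose_spec (V.exists_solution x t)).1

lemma flow_hasDerivAt (ξ x t : ℝ) :
    HasDerivAt (fun η => V.flow η x t) (V.F ξ (V.flow ξ x t)) ξ :=
  (Classical.choose_spec (V.exists_solution x t)).2 ξ

lemma flow_unique {y : ℝ → ℝ} {x t : ℝ} (hy : ∀ ξ, HasDerivAt y (V.F ξ (y ξ)) ξ) (hx : y x = t)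
    (ξ : ℝ) : y ξ = V.flow ξ x t := by
  obtain ⟨K, hK⟩ := V.exists_lipschitz
  have := ODE_solution_unique_univ (v := V.F) (s := fun _ => univ) (K := K) (t₀ := x)
    (f := y) (g := fun η => V.flow η x t)
    (fun ξ => (hK ξ).lipschitzOnWith) (fun ξ => ⟨hy ξ, trivial⟩)
    (fun ξ => ⟨V.flow_hasDerivAt ξ x t, trivial⟩) (by simp [hx])
  exact congrFun this ξ

@[simp] lemma flow_flow (ξ η x t : ℝ) : V.flow ξ η (V.flow η x t) = V.flow ξ x t :=
  (V.flow_unique (fun ξ => V.flow_hasDerivAt ξ x t) rfl ξ).symm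

lemma flow_add_period (ξ x t : ℝ) : V.flow ξ x (t + T) = V.flow ξ x t + T := by
  symm
  refine V.flow_unique (y := fun ξ => V.flow ξ x t + T) (fun ξ => ?_) (by simp) ξ
  rw [V.per]
  exact (V.flow_hasDerivAt ξ x t).add_const T

lemma continuous_flow_left (x t : ℝ) : Continuous fun ξ => V.flow ξ x t :=
  continuous_iff_continuousAt.2 fun ξ => (V.flow_hasDerivAt ξ x t).continuousAt

/-- The mean slope of the field between the trajectories through `(x, s)` and `(x, t)`. -/
def slope (x s t η : ℝ) : ℝ :=
  ∫ θ in (0 : ℝ)..1, V.F' η (V.flow η x t + θ * (V.flow η x s - V.flow η x t))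

lemma field_sub (η y z : ℝ) :
    V.F η z - V.F η y = (z - y) * ∫ θ in (0 : ℝ)..1, V.F' η (y + θ * (z - y)) := by
  have h1 : ∀ θ ∈ uIcc (0 : ℝ) 1, HasDerivAt (fun θ => V.F η (y + θ * (z - y)))
      (V.F' η (y + θ * (z - y)) * (z - y)) θ := fun θ _ => by
    refine (V.hasDeriv η _).comp θ ?_
    simpa using ((hasDerivAt_id θ).mul_const (z - y)).const_add y
  have h2 : Continuous fun θ => V.F' η (y + θ * (z - y)) * (z - y) :=
    (V.cont'.comp (by fun_prop : Continuous fun θ => (η, y + θ * (z - y)))).mul continuous_const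
  have h3 := intervalIntegral.integral_eq_sub_of_hasDerivAt h1 (h2.intervalIntegrable 0 1)
  rw [intervalIntegral.integral_mul_const] at h3
  simp only [one_mul, zero_mul, add_zero, add_sub_cancel] at h3
  rw [← h3, mul_comm]

lemma continuous_slope (x s t : ℝ) : Continuous (V.slope x s t) := by
  have h1 := V.continuous_flow_left x t
  have h2 := V.continuous_flow_left x s
  refine intervalIntegral.continuous_parametric_intervalIntegral_of_continuous' (μ := volume)
    (f := fun η θ => V.F' η (V.flow η x t + θ * (V.flow η x s - V.flow η x t))) ?_ 0 1
  exact V.cont'.comp (by fun_prop : Continuous fun q : ℝ × ℝ =>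
    (q.1, V.flow q.1 x t + q.2 * (V.flow q.1 x s - V.flow q.1 x t)))

/-- The difference of two trajectories solves a scalar linear equation. -/
lemma flow_sub_flow (ξ x s t : ℝ) :
    V.flow ξ x s - V.flow ξ x t = (s - t) * Real.exp (∫ η in x..ξ, V.slope x s t η) := by
  have hc := V.continuous_slope x s t
  have hd : ∀ ξ, HasDerivAt (fun ξ => (V.flow ξ x s - V.flow ξ x t) *
      Real.exp (-∫ η in x..ξ, V.slope x s t η)) 0 ξ := by
    intro ξ
    have h1 : HasDerivAt (fun ξ => ∫ η in x..ξ, V.slope x s t η) (V.slope x s t ξ) ξ :=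
      intervalIntegral.integral_hasDerivAt_right (hc.intervalIntegrable _ _)
        hc.stronglyMeasurable.stronglyMeasurableAtFilter hc.continuousAt
    have h2 := (((V.flow_hasDerivAt ξ x s).sub (V.flow_hasDerivAt ξ x t))).mul h1.neg.exp
    refine h2.congr_deriv ?_
    have h3 := V.field_sub ξ (V.flow ξ x t) (V.flow ξ x s)
    simp only [Pi.sub_apply, Pi.neg_apply]
    rw [h3]
    simp only [slope]
    ring
  have hconst := is_const_of_deriv_eq_zero (fun ξ => (hd ξ).differentiableAt)
    (fun ξ => (hd ξ).deriv) ξ x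
  simp only [flow_self, intervalIntegral.integral_same, neg_zero, Real.exp_zero, mul_one] at hconst
  rw [← hconst, mul_assoc, ← Real.exp_add, neg_add_cancel, Real.exp_zero, mul_one]

lemma exists_flow_lipschitz : ∃ L, ∀ ξ x s t,
    |V.flow ξ x s - V.flow ξ x t| ≤ |s - t| * Real.exp (L * |ξ - x|) := by
  obtain ⟨L, hL⟩ := V.bound'
  refine ⟨L, fun ξ x s t => ?_⟩
  rw [V.flow_sub_flow, abs_mul, abs_of_pos (Real.exp_pos _)]
  refine mul_le_mul_of_nonneg_left (Real.exp_le_exp.2 ((le_abs_self _).trans ?_)) (abs_nonneg _)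
  refine intervalIntegral.norm_integral_le_of_norm_le_const (E := ℝ) (f := V.slope x s t)
    (fun η _ => ?_)
  have h := intervalIntegral.norm_integral_le_of_norm_le_const (a := (0 : ℝ)) (b := 1) (C := L)
    (f := fun θ => V.F' η (V.flow η x t + θ * (V.flow η x s - V.flow η x t)))
    (fun θ _ => hL _ _)
  simpa [slope] using h

lemma continuous_flow : Continuous fun q : ℝ × ℝ × ℝ => V.flow q.1 q.2.1 q.2.2 := by
  obtain ⟨L, hL⟩ := V.exists_flow_lipschitz
  rw [continuous_iff_continuousAt]
  rintro ⟨ξ₀, x₀, t₀⟩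
  have hg : Continuous fun q : ℝ × ℝ × ℝ => V.flow q.1 x₀ t₀ :=
    (V.continuous_flow_left x₀ t₀).comp continuous_fst
  have hb : Continuous fun q : ℝ × ℝ × ℝ =>
      |q.2.2 - V.flow q.2.1 x₀ t₀| * Real.exp (L * |q.1 - q.2.1|) := by
    have := (V.continuous_flow_left x₀ t₀).comp
      (continuous_fst.comp continuous_snd : Continuous fun q : ℝ × ℝ × ℝ => q.2.1)
    simp only [Function.comp_def] at this
    fun_prop
  have hz : Tendsto (fun q : ℝ × ℝ × ℝ => V.flow q.1 q.2.1 q.2.2 - V.flow q.1 x₀ t₀)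
      (𝓝 (ξ₀, x₀, t₀)) (𝓝 0) := by
    refine squeeze_zero_norm (fun q => ?_) (by simpa using hb.tendsto (ξ₀, x₀, t₀))
    have := hL q.1 q.2.1 q.2.2 (V.flow q.2.1 x₀ t₀)
    rwa [flow_flow] at this
  have := hz.add (hg.tendsto (ξ₀, x₀, t₀))
  simpa [ContinuousAt] using this

lemma continuous_flow_comp {α : Type*} [TopologicalSpace α] {f g h : α → ℝ} (hf : Continuous f)
    (hg : Continuous g) (hh : Continuous h) : Continuous fun q => V.flow (f q) (g q) (h q) :=
  V.continuous_flow.comp (hf.prodMk (hg.prodMk hh))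

end PeriodicField

lemma continuous_integral_param {α : Type*} [TopologicalSpace α]
    {f : α → ℝ → ℝ} {a b : α → ℝ} (hf : Continuous fun q : α × ℝ => f q.1 q.2)
    (ha : Continuous a) (hb : Continuous b) : Continuous fun q => ∫ η in a q..b q, f q η := by
  have h : ∀ q, (∫ η in a q..b q, f q η) = (∫ η in (0 : ℝ)..b q, f q η) - ∫ η in (0 : ℝ)..a q, f q η :=
    fun q => by
      have hq : Continuous (f q) := hf.comp (by fun_prop : Continuous fun η => (q, η))
      rw [intervalIntegral.integral_interval_sub_left] <;> exact hq.intervalIntegrable _ _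
  simp only [h]
  exact (intervalIntegral.continuous_parametric_intervalIntegral_of_continuous hf hb).sub
    (intervalIntegral.continuous_parametric_intervalIntegral_of_continuous hf ha)

/-- A continuous integrand, depending on the upper limit of integration as well. -/
lemma hasDerivAt_integral_diag {K : ℝ → ℝ → ℝ} (hK : Continuous fun q : ℝ × ℝ => K q.1 q.2)
    (x : ℝ) : HasDerivAt (fun z => ∫ η in x..z, K z η) (K x x) x := by
  have h : ∀ z, (∫ η in x..z, K z η) = (z - x) * ∫ θ in (0 : ℝ)..1, K z (x + θ * (z - x)) := by
    intro z
    have := intervalIntegral.smul_integral_comp_add_mul (a := 0) (b := 1) (fun η => K z η) (z - x) x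
    simp only [mul_zero, add_zero, mul_one, add_sub_cancel, smul_eq_mul] at this
    rw [← this]
    simp only [mul_comm]
  have hc : Continuous fun z => ∫ θ in (0 : ℝ)..1, K z (x + θ * (z - x)) :=
    continuous_integral_param
      (hK.comp (by fun_prop : Continuous fun q : ℝ × ℝ => (q.1, x + q.2 * (q.1 - x))))
      continuous_const continuous_const
  rw [hasDerivAt_iff_tendsto_slope]
  refine (((hc.tendsto x).mono_left nhdsWithin_le_nhds).congr' ?_).trans_eq ?_
  · filter_upwards [self_mem_nhdsWithin] with z hz
    have hz' : z - x ≠ 0 := sub_ne_zero.2 hz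
    rw [slope_def_field, h z, h x, sub_self, zero_mul, sub_zero, mul_div_cancel_left₀ _ hz']
  · simp

namespace PeriodicField

variable {T : ℝ} (V : PeriodicField T)

lemma flow_hasDerivAt_init_aux (ξ x t : ℝ) :
    HasDerivAt (fun s => V.flow ξ x s) (Real.exp (∫ η in x..ξ, V.F' η (V.flow η x t))) t := by
  have hc : Continuous fun s => Real.exp (∫ η in x..ξ, V.slope x s t η) := by
    refine Real.continuous_exp.comp (continuous_integral_param ?_ continuous_const continuous_const)
    refine continuous_integral_param (α := ℝ × ℝ)
      (f := fun q θ => V.F' q.2 (V.flow q.2 x t + θ * (V.flow q.2 x q.1 - V.flow q.2 x t))) ?_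
      continuous_const continuous_const
    have h1 := V.continuous_flow_comp (α := (ℝ × ℝ) × ℝ) (f := fun q => q.1.2) (g := fun _ => x)
      (h := fun _ => t) (by fun_prop) (by fun_prop) (by fun_prop)
    have h2 := V.continuous_flow_comp (α := (ℝ × ℝ) × ℝ) (f := fun q => q.1.2) (g := fun _ => x)
      (h := fun q => q.1.1) (by fun_prop) (by fun_prop) (by fun_prop)
    exact V.cont'.comp ((by fun_prop : Continuous fun q : (ℝ × ℝ) × ℝ => (q.1.2,
      V.flow q.1.2 x t + q.2 * (V.flow q.1.2 x q.1.1 - V.flow q.1.2 x t))))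
  rw [hasDerivAt_iff_tendsto_slope]
  refine (((hc.tendsto t).mono_left nhdsWithin_le_nhds).congr' ?_).trans_eq ?_
  · filter_upwards [self_mem_nhdsWithin] with s hs
    have hs' : s - t ≠ 0 := sub_ne_zero.2 hs
    rw [slope_def_field, V.flow_sub_flow]
    field_simp
  · simp [slope]

/-- The exponential of the integral of `β` along a trajectory. -/
def cocycle (β : ℝ → ℝ → ℝ) (ξ x t : ℝ) : ℝ := Real.exp (∫ η in x..ξ, β η (V.flow η x t))

/-- The derivative of the flow with respect to the initial value. -/
def dflow (ξ x t : ℝ) : ℝ := V.cocycle V.F' ξ x t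

lemma flow_hasDerivAt_init (ξ x t : ℝ) : HasDerivAt (fun s => V.flow ξ x s) (V.dflow ξ x t) t :=
  V.flow_hasDerivAt_init_aux ξ x t

section Cocycle

variable {β : ℝ → ℝ → ℝ} (hβ : Continuous fun q : ℝ × ℝ => β q.1 q.2)

lemma cocycle_pos (β : ℝ → ℝ → ℝ) (ξ x t : ℝ) : 0 < V.cocycle β ξ x t := Real.exp_pos _

@[simp] lemma cocycle_self (β : ℝ → ℝ → ℝ) (x t : ℝ) : V.cocycle β x x t = 1 := by simp [cocycle]

include hβ

lemma continuous_along (x t : ℝ) : Continuous fun η => β η (V.flow η x t) :=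
  hβ.comp (continuous_id.prodMk (V.continuous_flow_left x t))

lemma cocycle_mul (ξ η x t : ℝ) :
    V.cocycle β ξ η (V.flow η x t) * V.cocycle β η x t = V.cocycle β ξ x t := by
  have h := V.continuous_along hβ x t
  simp only [cocycle, flow_flow]
  rw [← Real.exp_add, add_comm,
    intervalIntegral.integral_add_adjacent_intervals (h.intervalIntegrable _ _)
      (h.intervalIntegrable _ _)]

lemma cocycle_hasDerivAt (ξ x t : ℝ) : HasDerivAt (fun η => V.cocycle β η x t)
    (V.cocycle β ξ x t * β ξ (V.flow ξ x t)) ξ := by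
  have h := V.continuous_along hβ x t
  exact (intervalIntegral.integral_hasDerivAt_right (h.intervalIntegrable _ _)
    h.stronglyMeasurable.stronglyMeasurableAtFilter h.continuousAt).exp

lemma continuous_cocycle : Continuous fun q : ℝ × ℝ × ℝ => V.cocycle β q.1 q.2.1 q.2.2 := by
  refine Real.continuous_exp.comp (continuous_integral_param (α := ℝ × ℝ × ℝ) ?_ (by fun_prop)
    (by fun_prop))
  have h1 := V.continuous_flow_comp (α := (ℝ × ℝ × ℝ) × ℝ) (f := fun q => q.2)
    (g := fun q => q.1.2.1) (h := fun q => q.1.2.2) (by fun_prop) (by fun_prop) (by fun_prop)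
  exact hβ.comp (by fun_prop : Continuous fun q : (ℝ × ℝ × ℝ) × ℝ =>
    (q.2, V.flow q.2 q.1.2.1 q.1.2.2))

lemma continuous_cocycle_comp {α : Type*} [TopologicalSpace α] {f g h : α → ℝ} (hf : Continuous f)
    (hg : Continuous g) (hh : Continuous h) :
    Continuous fun q => V.cocycle β (f q) (g q) (h q) :=
  (V.continuous_cocycle hβ).comp (hf.prodMk (hg.prodMk hh))

omit hβ in
lemma cocycle_add_period (hp : ∀ x t, β x (t + T) = β x t) (ξ x t : ℝ) :
    V.cocycle β ξ x (t + T) = V.cocycle β ξ x t := by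
  simp only [cocycle, flow_add_period, hp]

end Cocycle

lemma dflow_pos (ξ x t : ℝ) : 0 < V.dflow ξ x t := V.cocycle_pos _ _ _ _

lemma continuous_dflow_comp {α : Type*} [TopologicalSpace α] {f g h : α → ℝ} (hf : Continuous f)
    (hg : Continuous g) (hh : Continuous h) : Continuous fun q => V.dflow (f q) (g q) (h q) :=
  V.continuous_cocycle_comp V.cont' hf hg hh

/-- The derivative of the flow with respect to the initial position, along an arbitrary curve of
initial values. -/
lemma flow_hasDerivAt_base {s : ℝ → ℝ} (hs : Continuous s) {s' x : ℝ} (hd : HasDerivAt s s' x)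
    (ξ : ℝ) : HasDerivAt (fun z => V.flow ξ z (s z)) (V.dflow ξ x (s x) * (s' - V.F x (s x))) x := by
  have h1 : ∀ z, V.flow x z (s z) = s z - ∫ η in x..z, V.F η (V.flow η z (s z)) := by
    intro z
    have hc : Continuous fun η => V.F η (V.flow η z (s z)) := V.continuous_along V.cont z (s z)
    rw [intervalIntegral.integral_eq_sub_of_hasDerivAt
      (fun η _ => V.flow_hasDerivAt η z (s z)) (hc.intervalIntegrable _ _)]
    simp
  have h2 : HasDerivAt (fun z => V.flow x z (s z)) (s' - V.F x (s x)) x := by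
    have hK : Continuous fun q : ℝ × ℝ => V.F q.2 (V.flow q.2 q.1 (s q.1)) := by
      have := V.continuous_flow_comp (α := ℝ × ℝ) continuous_snd continuous_fst
        (hs.comp continuous_fst)
      exact V.cont.comp (continuous_snd.prodMk this)
    have h3 := hd.sub (hasDerivAt_integral_diag (K := fun z η => V.F η (V.flow η z (s z))) hK x)
    simp only [flow_self] at h3
    exact h3.congr_of_eventuallyEq (Eventually.of_forall h1)
  have h4 : ∀ z, V.flow ξ z (s z) = V.flow ξ x (V.flow x z (s z)) := fun z => by simp
  simp only [h4]
  have h5 := V.flow_hasDerivAt_init ξ x (V.flow x x (s x))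
  have h6 := HasDerivAt.comp (h₂ := fun s => V.flow ξ x s) (h := fun z => V.flow x z (s z)) x h5 h2
  simpa [Function.comp_def] using h6

end PeriodicField

end RobinWave

namespace RobinWave

/-! ### Periodic continuous functions and operators between them -/

/-- Continuous functions of two real variables that are `T`-periodic in the second one. -/
structure IsPer (T : ℝ) (g : ℝ → ℝ → ℝ) : Prop where
  cont : Continuous fun q : ℝ × ℝ => g q.1 q.2
  per : ∀ x t, g x (t + T) = g x t

/-- Continuous functions of three real variables that are `T`-periodic in the last one. -/
structure IsPer₃ (T : ℝ) (k : ℝ → ℝ → ℝ → ℝ) : Prop where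
  cont : Continuous fun q : ℝ × ℝ × ℝ => k q.1 q.2.1 q.2.2
  per : ∀ ξ x t, k ξ x (t + T) = k ξ x t

variable {T : ℝ}

lemma IsPer.comp {g : ℝ → ℝ → ℝ} (hg : IsPer T g) {α : Type*} [TopologicalSpace α] {f h : α → ℝ}
    (hf : Continuous f) (hh : Continuous h) : Continuous fun q => g (f q) (h q) :=
  hg.cont.comp (hf.prodMk hh)

lemma IsPer₃.comp {k : ℝ → ℝ → ℝ → ℝ} (hk : IsPer₃ T k) {α : Type*} [TopologicalSpace α]
    {f g h : α → ℝ} (hf : Continuous f) (hg : Continuous g) (hh : Continuous h) :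
    Continuous fun q => k (f q) (g q) (h q) :=
  hk.cont.comp (hf.prodMk (hg.prodMk hh))

lemma IsPer₃.exists_bound [hT : Fact (0 < T)] {k : ℝ → ℝ → ℝ → ℝ} (hk : IsPer₃ T k) :
    ∃ M, 0 < M ∧ ∀ ξ ∈ Icc (0 : ℝ) 1, ∀ x ∈ Icc (0 : ℝ) 1, ∀ t, |k ξ x t| ≤ M := by
  obtain ⟨M, hM⟩ := (isCompact_Icc.prod (isCompact_Icc.prod isCompact_Icc) :
    IsCompact (Icc (0 : ℝ) 1 ×ˢ Icc (0 : ℝ) 1 ×ˢ Icc 0 T)).exists_bound_of_continuousOn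
      hk.cont.continuousOn
  refine ⟨|M| + 1, by positivity, fun ξ hξ x hx t => ?_⟩
  obtain ⟨s, hs, hst⟩ := (show Function.Periodic (k ξ x) T from hk.per ξ x).exists_mem_Ico₀
    hT.out t
  rw [hst]
  exact (hM (ξ, x, s) ⟨hξ, hx, Ico_subset_Icc_self hs⟩).trans
    ((le_abs_self M).trans (by linarith))

lemma IsPer.exists_bound [Fact (0 < T)] {g : ℝ → ℝ → ℝ} (hg : IsPer T g) :
    ∃ M, 0 < M ∧ ∀ x ∈ Icc (0 : ℝ) 1, ∀ t, |g x t| ≤ M := by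
  have h : IsPer₃ T (fun _ x t => g x t) :=
    ⟨hg.comp (by fun_prop) (by fun_prop), fun _ x t => hg.per x t⟩
  obtain ⟨M, hM, h'⟩ := h.exists_bound
  exact ⟨M, hM, fun x hx t => h' 0 (by simp) x hx t⟩

/-! #### Functions on the strip -/

/-- The restriction to the strip of a continuous periodic function, as an element of `CT T`. -/
def mkCT [Fact (0 < T)] {g : ℝ → ℝ → ℝ} (hg : IsPer T g) : CT T :=
  ⟨BoundedContinuousFunction.ofNormedAddCommGroup (fun q : unitInterval × ℝ => g q.1 q.2)
    (hg.comp (by fun_prop) (by fun_prop)) hg.exists_bound.choose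
    fun q => hg.exists_bound.choose_spec.2 q.1 q.1.2 q.2, fun _ t => hg.per _ t⟩

lemma ev_mkCT [Fact (0 < T)] {g : ℝ → ℝ → ℝ} (hg : IsPer T g) {x : ℝ} (hx : x ∈ Icc (0 : ℝ) 1)
    (t : ℝ) : ev (mkCT hg) x t = g x t := by
  simp only [ev, mkCT, BoundedContinuousFunction.coe_ofNormedAddCommGroup]
  rw [projIcc_of_mem _ hx]

lemma isPer_ev (u : CT T) : IsPer T (ev u) :=
  ⟨u.1.continuous.comp ((continuous_projIcc.comp continuous_fst).prodMk continuous_snd),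
    fun _ t => u.2 _ t⟩

lemma abs_ev_le (u : CT T) (x t : ℝ) : |ev u x t| ≤ ‖u‖ := u.1.norm_coe_le_norm _

lemma CT.norm_le {u : CT T} {C : ℝ} (hC : 0 ≤ C) (h : ∀ x ∈ Icc (0 : ℝ) 1, ∀ t, |ev u x t| ≤ C) :
    ‖u‖ ≤ C := by
  refine (BoundedContinuousFunction.norm_le hC).2 fun q => ?_
  have := h q.1 q.1.2 q.2
  rw [ev, projIcc_val] at this
  exact this

lemma CT.ext_ev {u v : CT T} (h : ∀ x ∈ Icc (0 : ℝ) 1, ∀ t, ev u x t = ev v x t) : u = v := by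
  refine Subtype.ext (BoundedContinuousFunction.ext fun q => ?_)
  have := h q.1 q.1.2 q.2
  simpa only [ev, projIcc_val] using this

@[simp] lemma ev_add (u v : CT T) (x t : ℝ) : ev (u + v : CT T) x t = ev u x t + ev v x t := rfl
@[simp] lemma ev_sub (u v : CT T) (x t : ℝ) : ev (u - v : CT T) x t = ev u x t - ev v x t := rfl
@[simp] lemma ev_smul (c : ℝ) (u : CT T) (x t : ℝ) : ev (c • u : CT T) x t = c * ev u x t := rfl

instance : CompleteSpace (CT T) := by
  refine IsClosed.completeSpace_coe (s := (CT T : Set ((unitInterval × ℝ) →ᵇ ℝ))) (hs := ?_)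
  have : (CT T : Set ((unitInterval × ℝ) →ᵇ ℝ)) =
      ⋂ (x : unitInterval) (t : ℝ), {u | u (x, t + T) = u (x, t)} := by
    ext u; simp [CT]
  rw [this]
  refine isClosed_iInter fun x => isClosed_iInter fun t => isClosed_eq ?_ ?_ <;>
    exact continuous_eval_const _

/-- A bounded operator into `CT T`, given by its values on the strip. -/
def ctCLM [Fact (0 < T)] {E : Type*} [NormedAddCommGroup E] [NormedSpace ℝ E] (Op : E → ℝ → ℝ → ℝ)
    (hper : ∀ h, IsPer T (Op h)) (hadd : ∀ h₁ h₂ x t, Op (h₁ + h₂) x t = Op h₁ x t + Op h₂ x t)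
    (hsmul : ∀ (c : ℝ) h x t, Op (c • h) x t = c * Op h x t)
    (hb : ∃ C, 0 < C ∧ ∀ h, ∀ x ∈ Icc (0 : ℝ) 1, ∀ t, |Op h x t| ≤ C * ‖h‖) : E →L[ℝ] CT T :=
  LinearMap.mkContinuousOfExistsBound
    { toFun := fun h => mkCT (hper h)
      map_add' := fun h₁ h₂ => CT.ext_ev fun x hx t => by
        simp only [ev_add, ev_mkCT _ hx, hadd]
      map_smul' := fun c h => CT.ext_ev fun x hx t => by
        simp only [ev_smul, ev_mkCT _ hx, hsmul, RingHom.id_apply] }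
    (by
      obtain ⟨C, hC, h⟩ := hb
      exact ⟨C, fun y => CT.norm_le (by positivity) fun x hx t => by
        simpa [ev_mkCT _ hx] using h y x hx t⟩)

/-! #### Functions on the circle -/

/-- The Banach space of continuous `T`-periodic functions of one variable. -/
abbrev PC (T : ℝ) : Type := C(AddCircle T, ℝ)

/-- A continuous periodic function as an element of `PC T`. -/
def mkPC {g : ℝ → ℝ} (hc : Continuous g) (hp : ∀ t, g (t + T) = g t) : PC T :=
  ⟨Function.Periodic.lift (c := T) hp, continuous_coinduced_dom.2 hc⟩

@[simp] lemma mkPC_apply {g : ℝ → ℝ} (hc : Continuous g) (hp : ∀ t, g (t + T) = g t) (t : ℝ) :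
    mkPC hc hp (t : AddCircle T) = g t := rfl

lemma PC.ext {g h : PC T} (H : ∀ t : ℝ, g (t : AddCircle T) = h (t : AddCircle T)) : g = h := by
  refine ContinuousMap.ext fun q => ?_
  induction q using QuotientAddGroup.induction_on with
  | H t => exact H t

lemma PC.cont (h : PC T) : Continuous fun t : ℝ => h (t : AddCircle T) :=
  h.continuous.comp (AddCircle.continuous_mk' T)

lemma PC.per (h : PC T) (t : ℝ) : h ((t + T : ℝ) : AddCircle T) = h (t : AddCircle T) := by
  rw [AddCircle.coe_add_period]

lemma PC.abs_le [Fact (0 < T)] (h : PC T) (q : AddCircle T) : |h q| ≤ ‖h‖ := h.norm_coe_le_norm q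

lemma PC.norm_le [Fact (0 < T)] {h : PC T} {C : ℝ} (hC : 0 ≤ C)
    (H : ∀ t : ℝ, |h (t : AddCircle T)| ≤ C) : ‖h‖ ≤ C := by
  refine (ContinuousMap.norm_le _ hC).2 fun q => ?_
  induction q using QuotientAddGroup.induction_on with
  | H t => exact H t

/-- A bounded operator into `PC T`, given by its values. -/
def pcCLM [Fact (0 < T)] {E : Type*} [NormedAddCommGroup E] [NormedSpace ℝ E] (Op : E → ℝ → ℝ)
    (hc : ∀ h, Continuous (Op h)) (hp : ∀ h t, Op h (t + T) = Op h t)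
    (hadd : ∀ h₁ h₂ t, Op (h₁ + h₂) t = Op h₁ t + Op h₂ t)
    (hsmul : ∀ (c : ℝ) h t, Op (c • h) t = c * Op h t)
    (hb : ∃ C, 0 < C ∧ ∀ h, ∀ t, |Op h t| ≤ C * ‖h‖) : E →L[ℝ] PC T :=
  LinearMap.mkContinuousOfExistsBound
    { toFun := fun h => mkPC (hc h) (hp h)
      map_add' := fun h₁ h₂ => PC.ext fun t => by simp [hadd]
      map_smul' := fun c h => PC.ext fun t => by simp [hsmul] }
    (by
      obtain ⟨C, hC, h⟩ := hb
      exact ⟨C, fun y => PC.norm_le (by positivity) fun t => by simpa using h y t⟩)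

section Operators

variable [hT : Fact (0 < T)]

/-- The operator `u ↦ ∫_0^x k(ξ, x, t) u(ξ, y(ξ)) dξ`, with `y` the trajectory through `(x, t)`. -/
def charInt (V : PeriodicField T) {k : ℝ → ℝ → ℝ → ℝ} (hk : IsPer₃ T k) : CT T →L[ℝ] CT T :=
  have hcont : ∀ u : CT T, Continuous fun q : (ℝ × ℝ) × ℝ =>
      k q.2 q.1.1 q.1.2 * ev u q.2 (V.flow q.2 q.1.1 q.1.2) := fun u =>
    (hk.comp (by fun_prop) (by fun_prop) (by fun_prop)).mul
      ((isPer_ev u).comp (by fun_prop) (V.continuous_flow_comp (by fun_prop) (by fun_prop)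
        (by fun_prop)))
  have hint : ∀ (u : CT T) (x t : ℝ), IntervalIntegrable
      (fun ξ => k ξ x t * ev u ξ (V.flow ξ x t)) volume 0 x := fun u x t =>
    ((hcont u).comp (by fun_prop : Continuous fun ξ : ℝ => ((x, t), ξ))).intervalIntegrable _ _
  ctCLM (fun u x t => ∫ ξ in (0 : ℝ)..x, k ξ x t * ev u ξ (V.flow ξ x t))
    (fun u => ⟨continuous_integral_param (α := ℝ × ℝ)
        (f := fun q ξ => k ξ q.1 q.2 * ev u ξ (V.flow ξ q.1 q.2)) (hcont u)
        continuous_const continuous_fst,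
      fun x t => by simp only [hk.per, V.flow_add_period, (isPer_ev u).per]⟩)
    (fun u v x t => by
      rw [← intervalIntegral.integral_add (hint u x t) (hint v x t)]
      simp only [ev_add, mul_add])
    (fun c u x t => by
      rw [← intervalIntegral.integral_const_mul]
      simp only [ev_smul]
      congr 1; ext; ring)
    (by
      obtain ⟨M, hM, hb⟩ := hk.exists_bound
      refine ⟨M, hM, fun u x hx t => ?_⟩
      refine (intervalIntegral.norm_integral_le_of_norm_le_const (E := ℝ) (C := M * ‖u‖)
        fun ξ hξ => ?_).trans ?_
      · rw [uIoc_of_le hx.1] at hξ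
        rw [norm_mul]
        exact mul_le_mul (hb ξ ⟨hξ.1.le, hξ.2.trans hx.2⟩ x hx t) (abs_ev_le _ _ _) (norm_nonneg _)
          hM.le
      · rw [sub_zero, abs_of_nonneg hx.1]
        exact mul_le_of_le_one_right (by positivity) hx.2)

lemma ev_charInt (V : PeriodicField T) {k : ℝ → ℝ → ℝ → ℝ} (hk : IsPer₃ T k) (u : CT T) {x : ℝ}
    (hx : x ∈ Icc (0 : ℝ) 1) (t : ℝ) :
    ev (charInt V hk u) x t = ∫ ξ in (0 : ℝ)..x, k ξ x t * ev u ξ (V.flow ξ x t) :=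
  ev_mkCT _ hx t

/-- Curves `(x, t) ↦ ψ(x, t)` compatible with the period. -/
structure IsShift (T : ℝ) (ψ : ℝ → ℝ → ℝ) : Prop where
  cont : Continuous fun q : ℝ × ℝ => ψ q.1 q.2
  per : ∀ x t, ψ x (t + T) = ψ x t + T

/-- The weighted composition operator `h ↦ w(x, t) h(ψ(x, t))`. -/
def compOp {w ψ : ℝ → ℝ → ℝ} (hw : IsPer T w) (hψ : IsShift T ψ) : PC T →L[ℝ] CT T :=
  ctCLM (fun h x t => w x t * h (ψ x t : AddCircle T))
    (fun h => ⟨hw.cont.mul (h.cont.comp hψ.cont), fun x t => by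
      rw [hw.per, hψ.per, h.per]⟩)
    (fun h₁ h₂ x t => by simp [mul_add])
    (fun c h x t => by simp; ring)
    (by
      obtain ⟨M, hM, hb⟩ := hw.exists_bound
      refine ⟨M, hM, fun h x hx t => ?_⟩
      rw [abs_mul]
      exact mul_le_mul (hb x hx t) (h.abs_le _) (abs_nonneg _) hM.le)

lemma ev_compOp {w ψ : ℝ → ℝ → ℝ} (hw : IsPer T w) (hψ : IsShift T ψ) (h : PC T) {x : ℝ}
    (hx : x ∈ Icc (0 : ℝ) 1) (t : ℝ) :
    ev (compOp hw hψ h) x t = w x t * h (ψ x t : AddCircle T) :=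
  ev_mkCT _ hx t

/-- The trace on the boundary `x = 1`. -/
def trace₁ (T : ℝ) [Fact (0 < T)] : CT T →L[ℝ] PC T :=
  pcCLM (fun u t => ev u 1 t) (fun u => (isPer_ev u).comp continuous_const continuous_id)
    (fun u t => (isPer_ev u).per 1 t) (fun _ _ _ => rfl) (fun _ _ _ => rfl)
    ⟨1, one_pos, fun u t => by simpa using abs_ev_le u 1 t⟩

@[simp] lemma trace₁_apply (u : CT T) (t : ℝ) : trace₁ T u (t : AddCircle T) = ev u 1 t := rfl

/-- The mean value of a periodic function. -/
def mean (h : PC T) : ℝ := T⁻¹ * ∫ s in (0 : ℝ)..T, h (s : AddCircle T)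

lemma PC.intervalIntegrable (h : PC T) (a b : ℝ) :
    IntervalIntegrable (fun s : ℝ => h (s : AddCircle T)) volume a b :=
  h.cont.intervalIntegrable a b

lemma mean_add (h₁ h₂ : PC T) : mean (h₁ + h₂) = mean h₁ + mean h₂ := by
  simp only [mean, ContinuousMap.add_apply]
  rw [intervalIntegral.integral_add (h₁.intervalIntegrable _ _) (h₂.intervalIntegrable _ _), mul_add]

lemma mean_smul (c : ℝ) (h : PC T) : mean (c • h) = c * mean h := by
  simp only [mean, ContinuousMap.smul_apply, smul_eq_mul]
  rw [intervalIntegral.integral_const_mul]; ring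

lemma abs_mean_le (h : PC T) : |mean h| ≤ ‖h‖ := by
  have h1 := intervalIntegral.norm_integral_le_of_norm_le_const (a := 0) (b := T) (C := ‖h‖)
    (f := fun s : ℝ => h (s : AddCircle T)) (fun s _ => h.abs_le _)
  rw [sub_zero, abs_of_pos hT.out, Real.norm_eq_abs] at h1
  rw [mean, abs_mul, abs_of_pos (inv_pos.2 hT.out), inv_mul_le_iff₀ hT.out, mul_comm]
  exact h1

lemma integral_sub_mean (h : PC T) : ∫ s in (0 : ℝ)..T, (h (s : AddCircle T) - mean h) = 0 := by
  rw [intervalIntegral.integral_sub (h.intervalIntegrable _ _) (by simp),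
    intervalIntegral.integral_const, mean, sub_zero, smul_eq_mul, ← mul_assoc,
    mul_inv_cancel₀ hT.out.ne', one_mul, sub_self]

lemma integral_sub_mean_le (h : PC T) (a b : ℝ) :
    |∫ s in a..b, (h (s : AddCircle T) - mean h)| ≤ 2 * ‖h‖ * |b - a| := by
  refine intervalIntegral.norm_integral_le_of_norm_le_const (E := ℝ) fun s _ => ?_
  refine (norm_sub_le _ _).trans ?_
  have h1 := h.abs_le (s : AddCircle T)
  have h2 := abs_mean_le h
  rw [Real.norm_eq_abs, Real.norm_eq_abs]; linarith

lemma sub_mean_intervalIntegrable (h : PC T) (a b : ℝ) :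
    IntervalIntegrable (fun s : ℝ => h (s : AddCircle T) - mean h) volume a b :=
  (h.cont.sub continuous_const).intervalIntegrable a b

/-- The periodic primitive `h ↦ ∫_0^t (h - mean h) + mean h`. -/
def primFun (h : PC T) (t : ℝ) : ℝ := (∫ s in (0 : ℝ)..t, (h (s : AddCircle T) - mean h)) + mean h

lemma primFun_sub (h : PC T) (s t : ℝ) :
    primFun h t - primFun h s = ∫ r in s..t, (h (r : AddCircle T) - mean h) := by
  rw [primFun, primFun, add_sub_add_right_eq_sub, intervalIntegral.integral_interval_sub_left] <;>
    exact sub_mean_intervalIntegrable h _ _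

lemma primFun_zero (h : PC T) : primFun h 0 = mean h := by simp [primFun]

lemma primFun_per (h : PC T) (t : ℝ) : primFun h (t + T) = primFun h t := by
  have h1 : Function.Periodic (fun s : ℝ => h (s : AddCircle T) - mean h) T := fun s => by
    simp only [h.per]
  rw [← sub_eq_zero, primFun_sub, h1.intervalIntegral_add_eq t 0, zero_add, integral_sub_mean]

lemma primFun_hasDerivAt (h : PC T) (t : ℝ) :
    HasDerivAt (primFun h) (h (t : AddCircle T) - mean h) t := by
  have hc : Continuous fun s : ℝ => h (s : AddCircle T) - mean h := h.cont.sub continuous_const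
  exact (intervalIntegral.integral_hasDerivAt_right (hc.intervalIntegrable _ _)
    hc.stronglyMeasurable.stronglyMeasurableAtFilter hc.continuousAt).add_const _

lemma continuous_primFun (h : PC T) : Continuous (primFun h) :=
  continuous_iff_continuousAt.2 fun t => (primFun_hasDerivAt h t).continuousAt

lemma abs_primFun_sub_le (h : PC T) (s t : ℝ) :
    |primFun h t - primFun h s| ≤ 2 * ‖h‖ * |t - s| := by
  rw [primFun_sub]; exact integral_sub_mean_le h s t

lemma abs_primFun_le (h : PC T) (t : ℝ) : |primFun h t| ≤ (2 * T + 1) * ‖h‖ := by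
  obtain ⟨s, hs, hst⟩ := (show Function.Periodic (primFun h) T from primFun_per h).exists_mem_Ico₀
    hT.out t
  rw [hst]
  have h1 := abs_primFun_sub_le h 0 s
  have h2 := abs_mean_le h
  rw [primFun_zero, sub_zero, abs_of_nonneg hs.1] at h1
  have h3 : 2 * ‖h‖ * s ≤ 2 * ‖h‖ * T := mul_le_mul_of_nonneg_left hs.2.le (by positivity)
  have h4 : |primFun h s| ≤ |primFun h s - mean h| + |mean h| := by
    simpa using abs_add_le (primFun h s - mean h) (mean h)
  linarith

/-- The periodic primitive as an operator: a bijection of the continuous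
periodic functions onto the continuously differentiable ones, with inverse `G ↦ G' + G(0)`. -/
def prim (T : ℝ) [hT : Fact (0 < T)] : PC T →L[ℝ] PC T :=
  pcCLM primFun continuous_primFun primFun_per
    (fun h₁ h₂ t => by
      have h1 : ∀ s : ℝ, (h₁ + h₂) (s : AddCircle T) - mean (h₁ + h₂) =
          (h₁ (s : AddCircle T) - mean h₁) + (h₂ (s : AddCircle T) - mean h₂) := fun s => by
        rw [mean_add, ContinuousMap.add_apply]; ring
      simp only [primFun, h1]
      rw [intervalIntegral.integral_add (sub_mean_intervalIntegrable h₁ _ _)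
        (sub_mean_intervalIntegrable h₂ _ _), mean_add]; ring)
    (fun c h t => by
      have h1 : ∀ s : ℝ, (c • h) (s : AddCircle T) - mean (c • h) =
          c * (h (s : AddCircle T) - mean h) := fun s => by
        rw [mean_smul, ContinuousMap.smul_apply, smul_eq_mul]; ring
      simp only [primFun, h1]
      rw [intervalIntegral.integral_const_mul, mean_smul]; ring)
    ⟨2 * T + 1, by have := hT.out; positivity, abs_primFun_le⟩

@[simp] lemma prim_apply (h : PC T) (t : ℝ) : prim T h (t : AddCircle T) = primFun h t := rfl

lemma isCompactOperator_prim : IsCompactOperator (prim T) := by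
  let e := ContinuousMap.linearIsometryBoundedOfCompact (AddCircle T) ℝ ℝ
  have key : IsCompactOperator (fun h => e (prim T h)) := by
    refine (isCompactOperator_iff_exists_mem_nhds_image_subset_compact _).2
      ⟨Metric.closedBall 0 1, Metric.closedBall_mem_nhds _ one_pos,
        closure ((fun h => e (prim T h)) '' Metric.closedBall 0 1), ?_, subset_closure⟩
    refine BoundedContinuousFunction.arzela_ascoli (Metric.closedBall (0 : ℝ) (2 * T + 1))
      (isCompact_closedBall _ _) _ ?_ ?_
    · rintro _ q ⟨h, hh, rfl⟩
      rw [mem_closedBall_zero_iff] at hh ⊢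
      induction q using QuotientAddGroup.induction_on with
      | H t =>
        refine (abs_primFun_le h t).trans (mul_le_of_le_one_right ?_ hh)
        have := hT.out
        positivity
    · refine Metric.equicontinuous_of_continuity_modulus (fun r => 2 * r) ?_ _ ?_
      · simpa using (by fun_prop : Continuous fun r : ℝ => 2 * r).tendsto 0
      · rintro p q ⟨_, ⟨h, hh, rfl⟩⟩
        rw [mem_closedBall_zero_iff] at hh
        induction p using QuotientAddGroup.induction_on with
        | H s =>
          induction q using QuotientAddGroup.induction_on with
          | H t =>
            rw [dist_eq_norm, dist_eq_norm, ← QuotientAddGroup.mk_sub]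
            have h1 := AddCircle.norm_eq (p := T) (x := s - t)
            set m := round (T⁻¹ * (s - t)) with hm
            change |primFun h s - primFun h t| ≤ 2 * ‖((s - t : ℝ) : AddCircle T)‖
            have h2 : primFun h (s - m * T) = primFun h s :=
              (show Function.Periodic (primFun h) T from primFun_per h).sub_int_mul_eq m
            rw [h1, ← h2]
            refine (abs_primFun_sub_le h t _).trans ?_
            rw [show s - m * T - t = s - t - m * T by ring]
            exact mul_le_mul_of_nonneg_right (by linarith) (abs_nonneg _)
  exact key.continuous_comp (g := e.symm) e.symm.continuous

end Operators

end RobinWave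

namespace RobinWave

variable {T : ℝ}

/-! ### Compactness of integrals along transversal curves -/

section Oscillating

variable [hT : Fact (0 < T)]

lemma IsPer₃.clamp {q : ℝ → ℝ → ℝ → ℝ} (hq : IsPer₃ T q) :
    IsPer₃ T fun ξ x t => q (projIcc (0 : ℝ) 1 zero_le_one ξ) x t :=
  ⟨hq.comp (continuous_subtype_val.comp (continuous_projIcc.comp continuous_fst)) (by fun_prop)
    (by fun_prop), fun ξ x t => hq.per _ x t⟩

lemma IsPer₃.exists_modulus {q : ℝ → ℝ → ℝ → ℝ} (hq : IsPer₃ T q) {ε : ℝ} (hε : 0 < ε) :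
    ∃ δ > 0, ∀ ξ ∈ Icc (0 : ℝ) 1, ∀ η ∈ Icc (0 : ℝ) 1, ∀ x ∈ Icc (0 : ℝ) 1, ∀ t,
      |ξ - η| ≤ δ → |q ξ x t - q η x t| ≤ ε := by
  have hu := (isCompact_Icc.prod (isCompact_Icc.prod isCompact_Icc) :
    IsCompact (Icc (0 : ℝ) 1 ×ˢ Icc (0 : ℝ) 1 ×ˢ Icc 0 T)).uniformContinuousOn_of_continuous
      hq.cont.continuousOn
  obtain ⟨δ, hδ, h⟩ := Metric.uniformContinuousOn_iff.1 hu ε hε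
  refine ⟨δ / 2, by positivity, fun ξ hξ η hη x hx t hd => ?_⟩
  obtain ⟨s, hs, hst⟩ := (show Function.Periodic (fun t => q ξ x t - q η x t) T from
    fun t => by simp only [hq.per]).exists_mem_Ico₀ hT.out t
  have hs' := Ico_subset_Icc_self hs
  rw [hst]
  refine (h (ξ, x, s) ⟨hξ, hx, hs'⟩ (η, x, s) ⟨hη, hx, hs'⟩ ?_).le
  rw [Prod.dist_eq, dist_self, max_eq_left dist_nonneg, Real.dist_eq]
  exact hd.trans_lt (by linarith)

/-- Integration by parts trades `h` for its primitive, up to an arbitrarily small multiple of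
`‖h‖` that allows the weight to be replaced by a differentiable one. -/
lemma isCompactOperator_oscillating {k ψ ρ : ℝ → ℝ → ℝ → ℝ} (hk : IsPer₃ T k) (hρ : IsPer₃ T ρ)
    (hρ0 : ∀ ξ x t, ρ ξ x t ≠ 0)
    (hψ : ∀ ξ x t, HasDerivAt (fun η => ψ η x t) (ρ ξ x t) ξ) {Q : PC T →L[ℝ] CT T}
    (hQ : ∀ h, ∀ x ∈ Icc (0 : ℝ) 1, ∀ t,
      ev (Q h) x t = ∫ ξ in (0 : ℝ)..x, k ξ x t * h (ψ ξ x t : AddCircle T)) :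
    IsCompactOperator Q := by
  refine isCompactOperator_of_ehrling (isCompactOperator_prim (T := T)) fun ε hε => ?_
  have hq0 : IsPer₃ T fun ξ x t => k ξ x t / ρ ξ x t :=
    ⟨hk.cont.div hρ.cont fun q => hρ0 _ _ _, fun ξ x t => by rw [hk.per, hρ.per]⟩
  set q : ℝ → ℝ → ℝ → ℝ := fun ξ x t => k (projIcc (0 : ℝ) 1 zero_le_one ξ) x t /
    ρ (projIcc (0 : ℝ) 1 zero_le_one ξ) x t with hqdef
  have hq : IsPer₃ T q := hq0.clamp
  obtain ⟨M, hM, hMb⟩ := hq0.exists_bound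
  obtain ⟨R, hR, hRb⟩ := hρ.exists_bound
  obtain ⟨δ, hδ, hδb⟩ := hq0.exists_modulus (ε := ε / R) (by positivity)
  have hqM : ∀ ξ, ∀ x ∈ Icc (0 : ℝ) 1, ∀ t, |q ξ x t| ≤ M := fun ξ x hx t =>
    hMb _ (projIcc (0 : ℝ) 1 zero_le_one ξ).2 x hx t
  refine ⟨2 * M + 2 * M / δ + M * R, fun h => ?_⟩
  have hPh := norm_nonneg (prim T h)
  refine CT.norm_le (by positivity) fun x hx t => ?_
  rw [hQ h x hx t]
  have hψc : Continuous fun ξ => ψ ξ x t :=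
    continuous_iff_continuousAt.2 fun ξ => (hψ ξ x t).continuousAt
  have hρc : Continuous fun ξ => ρ ξ x t := hρ.comp (by fun_prop) (by fun_prop) (by fun_prop)
  have hqc : Continuous fun ξ => q ξ x t := hq.comp (by fun_prop) (by fun_prop) (by fun_prop)
  have hhc : Continuous fun ξ => h (ψ ξ x t : AddCircle T) := h.cont.comp hψc
  -- the averaged weight
  set m : ℝ → ℝ := fun ξ => δ⁻¹ * ∫ η in ξ..(ξ + δ), q η x t with hm
  have hmd : ∀ ξ, HasDerivAt m (δ⁻¹ * (q (ξ + δ) x t - q ξ x t)) ξ := by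
    intro ξ
    have hp : ∀ ξ, HasDerivAt (fun ξ => ∫ η in (0 : ℝ)..ξ, q η x t) (q ξ x t) ξ := fun ξ =>
      intervalIntegral.integral_hasDerivAt_right (hqc.intervalIntegrable _ _)
        hqc.stronglyMeasurable.stronglyMeasurableAtFilter hqc.continuousAt
    have h1 := (((hp (ξ + δ)).comp_add_const ξ δ).sub (hp ξ)).const_mul δ⁻¹
    refine h1.congr_of_eventuallyEq (Eventually.of_forall fun z => ?_)
    simp only [hm, Pi.sub_apply]
    rw [intervalIntegral.integral_interval_sub_left] <;> exact hqc.intervalIntegrable _ _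
  have hmc : Continuous m := continuous_iff_continuousAt.2 fun ξ => (hmd ξ).continuousAt
  have hmM : ∀ ξ, |m ξ| ≤ M := fun ξ => by
    have h1 := intervalIntegral.norm_integral_le_of_norm_le_const (a := ξ) (b := ξ + δ) (C := M)
      (f := fun η => q η x t) (fun η _ => hqM η x hx t)
    rw [add_sub_cancel_left, abs_of_pos hδ, Real.norm_eq_abs] at h1
    rw [hm, abs_mul, abs_of_pos (inv_pos.2 hδ), inv_mul_le_iff₀ hδ, mul_comm]
    exact h1
  have hmq : ∀ ξ, |q ξ x t - m ξ| ≤ ε / R := fun ξ => by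
    have h1 := intervalIntegral.norm_integral_le_of_norm_le_const (a := ξ) (b := ξ + δ)
      (C := ε / R) (f := fun η => q ξ x t - q η x t) (fun η hη => by
        rw [uIoc_of_le (by linarith)] at hη
        refine hδb _ (Subtype.coe_prop _) _ (Subtype.coe_prop _) x hx t ?_
        refine (abs_projIcc_sub_projIcc zero_le_one).trans ?_
        rw [abs_sub_comm, abs_of_pos (by linarith [hη.1])]
        linarith [hη.2])
    rw [intervalIntegral.integral_sub (by simp) (hqc.intervalIntegrable _ _),
      intervalIntegral.integral_const, add_sub_cancel_left, abs_of_pos hδ, Real.norm_eq_abs,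
      smul_eq_mul] at h1
    have h2 : q ξ x t - m ξ = δ⁻¹ * (δ * q ξ x t - ∫ η in ξ..(ξ + δ), q η x t) := by
      rw [hm]; field_simp
    rw [h2, abs_mul, abs_of_pos (inv_pos.2 hδ), inv_mul_le_iff₀ hδ, mul_comm δ (ε / R)]
    exact h1
  -- the primitive along the curve
  set A : ℝ → ℝ := fun ξ => primFun h (ψ ξ x t) with hA
  have hAd : ∀ ξ, HasDerivAt A ((h (ψ ξ x t : AddCircle T) - mean h) * ρ ξ x t) ξ := fun ξ =>
    HasDerivAt.comp (h₂ := primFun h) (h := fun η => ψ η x t) ξ (primFun_hasDerivAt h _) (hψ ξ x t)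
  have hAb : ∀ ξ, |A ξ| ≤ ‖prim T h‖ := fun ξ => (prim T h).abs_le (ψ ξ x t : AddCircle T)
  have hAc : Continuous A := continuous_iff_continuousAt.2 fun ξ => (hAd ξ).continuousAt
  have hparts := intervalIntegral.integral_mul_deriv_eq_deriv_mul (a := 0) (b := x)
    (fun ξ _ => hmd ξ) (fun ξ _ => hAd ξ)
    ((by fun_prop : Continuous fun ξ => δ⁻¹ * (q (ξ + δ) x t - q ξ x t)).intervalIntegrable _ _)
    ((by fun_prop : Continuous fun ξ =>
      (h (ψ ξ x t : AddCircle T) - mean h) * ρ ξ x t).intervalIntegrable _ _)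
  have hsplit : (∫ ξ in (0 : ℝ)..x, k ξ x t * h (ψ ξ x t : AddCircle T)) =
      (∫ ξ in (0 : ℝ)..x, (q ξ x t - m ξ) * (ρ ξ x t * h (ψ ξ x t : AddCircle T))) +
      (∫ ξ in (0 : ℝ)..x, m ξ * ((h (ψ ξ x t : AddCircle T) - mean h) * ρ ξ x t)) +
      mean h * ∫ ξ in (0 : ℝ)..x, m ξ * ρ ξ x t := by
    rw [← intervalIntegral.integral_const_mul, ← intervalIntegral.integral_add,
      ← intervalIntegral.integral_add]
    · refine intervalIntegral.integral_congr fun ξ hξ => ?_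
      rw [uIcc_of_le hx.1] at hξ
      have h1 : q ξ x t = k ξ x t / ρ ξ x t := by
        simp only [hqdef, projIcc_of_mem zero_le_one (⟨hξ.1, hξ.2.trans hx.2⟩ : ξ ∈ Icc (0 : ℝ) 1)]
      have h2 := hρ0 ξ x t
      simp only [h1]
      field_simp
      ring
    all_goals exact Continuous.intervalIntegrable (by fun_prop) _ _
  have hlen : ∀ (f : ℝ → ℝ) (C : ℝ), 0 ≤ C → (∀ ξ ∈ Icc (0 : ℝ) 1, |f ξ| ≤ C) →
      |∫ ξ in (0 : ℝ)..x, f ξ| ≤ C := fun f C hC hf => by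
    have h1 := intervalIntegral.norm_integral_le_of_norm_le_const (a := 0) (b := x) (C := C)
      (f := f) (fun ξ hξ => by
        rw [uIoc_of_le hx.1] at hξ
        exact hf ξ ⟨hξ.1.le, hξ.2.trans hx.2⟩)
    rw [sub_zero, abs_of_nonneg hx.1] at h1
    exact h1.trans (mul_le_of_le_one_right hC hx.2)
  have hI1 : |∫ ξ in (0 : ℝ)..x, (q ξ x t - m ξ) * (ρ ξ x t * h (ψ ξ x t : AddCircle T))| ≤
      ε * ‖h‖ := by
    refine hlen _ _ (by positivity) fun ξ hξ => ?_
    rw [abs_mul, abs_mul]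
    have := mul_le_mul (hmq ξ) (mul_le_mul (hRb ξ hξ x hx t) (h.abs_le (ψ ξ x t : AddCircle T))
      (abs_nonneg _) hR.le) (by positivity) (by positivity)
    refine this.trans_eq ?_
    field_simp
  have hI2 : |∫ ξ in (0 : ℝ)..x, δ⁻¹ * (q (ξ + δ) x t - q ξ x t) * A ξ| ≤
      2 * M / δ * ‖prim T h‖ := by
    refine hlen _ _ (by positivity) fun ξ hξ => ?_
    rw [abs_mul, abs_mul, abs_of_pos (inv_pos.2 hδ)]
    have h1 : |q (ξ + δ) x t - q ξ x t| ≤ 2 * M :=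
      (abs_sub _ _).trans (by linarith [hqM (ξ + δ) x hx t, hqM ξ x hx t])
    have := mul_le_mul (mul_le_mul_of_nonneg_left h1 (inv_pos.2 hδ).le) (hAb ξ) (abs_nonneg _)
      (by positivity)
    refine this.trans_eq ?_
    ring
  have hI3 : |∫ ξ in (0 : ℝ)..x, m ξ * ρ ξ x t| ≤ M * R := by
    refine hlen _ _ (by positivity) fun ξ hξ => ?_
    rw [abs_mul]
    exact mul_le_mul (hmM ξ) (hRb ξ hξ x hx t) (abs_nonneg _) hM.le
  have hmean : |mean h| ≤ ‖prim T h‖ := by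
    rw [← primFun_zero]; exact (prim T h).abs_le ((0 : ℝ) : AddCircle T)
  have hb : ∀ ξ, |m ξ * A ξ| ≤ M * ‖prim T h‖ := fun ξ => by
    rw [abs_mul]; exact mul_le_mul (hmM ξ) (hAb ξ) (abs_nonneg _) hM.le
  rw [hsplit, hparts]
  have h3 : |mean h * ∫ ξ in (0 : ℝ)..x, m ξ * ρ ξ x t| ≤ M * R * ‖prim T h‖ := by
    rw [abs_mul, mul_comm]
    exact mul_le_mul hI3 hmean (abs_nonneg _) (by positivity)
  have h4 := hb x
  have h5 := hb 0
  rw [abs_le] at *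
  constructor <;> linarith [hI1.1, hI1.2, hI2.1, hI2.2]

end Oscillating

end RobinWave

namespace RobinWave

variable {T : ℝ}

/-! ### Weighted composition operators on the circle -/

/-- A weighted composition operator with a positive weight that never equals `1` has, by
connectedness and compactness, a weight or an inverse weight bounded by a constant less than `1`;
hence `1` is not in its spectrum. -/
lemma isUnit_one_sub_of_weight_ne_one [Fact (0 < T)] {L L' : PC T →L[ℝ] PC T}
    (hLL' : L * L' = 1) (hL'L : L' * L = 1)
    (hL : ∀ t : ℝ, ∃ s : ℝ, ∀ h, L h (t : AddCircle T) = L 1 (t : AddCircle T) * h (s : AddCircle T))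
    (hL' : ∀ t : ℝ, ∃ s : ℝ, ∀ h,
      L' h (t : AddCircle T) = L' 1 (t : AddCircle T) * h (s : AddCircle T))
    (hpos : ∀ t : ℝ, 0 < L 1 (t : AddCircle T)) (hne : ∀ t : ℝ, L 1 (t : AddCircle T) ≠ 1) :
    IsUnit (1 - L) := by
  have key : ∀ P : PC T →L[ℝ] PC T, (∀ t : ℝ, ∃ s : ℝ, ∀ h,
      P h (t : AddCircle T) = P 1 (t : AddCircle T) * h (s : AddCircle T)) →
      (∀ t : ℝ, |P 1 (t : AddCircle T)| < 1) → IsUnit (1 - P) := by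
    intro P hP hlt
    have h1 : ‖P 1‖ < 1 := by
      rw [ContinuousMap.norm_lt_iff _ one_pos]
      intro q
      induction q using QuotientAddGroup.induction_on with
      | H t => exact hlt t
    have h2 : ‖P‖ ≤ ‖P 1‖ := by
      refine P.opNorm_le_bound (norm_nonneg _) fun h => PC.norm_le (by positivity) fun t => ?_
      obtain ⟨s, hs⟩ := hP t
      rw [hs, abs_mul]
      exact mul_le_mul (PC.abs_le _ _) (PC.abs_le _ _) (abs_nonneg _) (norm_nonneg _)
    exact isUnit_one_sub_of_norm_lt_one (x := P) (h2.trans_lt h1)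
  by_cases hlt : ∀ t : ℝ, L 1 (t : AddCircle T) < 1
  · exact key L hL fun t => by rw [abs_of_pos (hpos t)]; exact hlt t
  · have hgt : ∀ t : ℝ, 1 < L 1 (t : AddCircle T) := by
      by_contra hcon
      push Not at hlt hcon
      obtain ⟨t₁, h₁⟩ := hlt
      obtain ⟨t₂, h₂⟩ := hcon
      obtain ⟨t, ht⟩ := mem_range_of_exists_le_of_exists_ge (L 1).cont ⟨t₂, h₂⟩ ⟨t₁, h₁⟩
      exact hne t ht
    have hu : IsUnit (1 - L') := by
      refine key L' hL' fun t => ?_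
      obtain ⟨s, hs⟩ := hL' t
      have h1 : L' (L 1) (t : AddCircle T) = 1 := by
        have := congrArg (fun P : PC T →L[ℝ] PC T => P 1 (t : AddCircle T)) hL'L
        simpa using this
      rw [hs] at h1
      have h2 := hgt s
      have h3 : L' 1 (t : AddCircle T) = (L 1 (s : AddCircle T))⁻¹ :=
        eq_inv_of_mul_eq_one_left h1
      rw [h3, abs_of_pos (by positivity)]
      exact inv_lt_one_of_one_lt₀ h2
    have h1 : 1 - L = -((1 - L') * L) := by rw [sub_mul, hL'L, one_mul, neg_sub]
    rw [h1]
    exact (hu.mul (isUnit_iff_exists.2 ⟨L', hLL', hL'L⟩)).neg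

/-! ### Integral equations along trajectories -/

namespace PeriodicField

variable (V : PeriodicField T)

/-- `u` solves `∂_ξ[u(ξ, y(ξ))] + β u = s` along every trajectory `y` of the field in the strip
`0 ≤ ξ ≤ 1`, in the integrated form that starts from the line `ξ = x₀`. -/
def IsMild (β s : ℝ → ℝ → ℝ) (u : ℝ → ℝ → ℝ) (x₀ : ℝ) : Prop :=
  ∀ x ∈ Icc (0 : ℝ) 1, ∀ t, u x t = V.cocycle β x₀ x t * u x₀ (V.flow x₀ x t) +
    ∫ ξ in x₀..x, V.cocycle β ξ x t * s ξ (V.flow ξ x t)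

variable {V} {β s u : ℝ → ℝ → ℝ} (hβ : Continuous fun q : ℝ × ℝ => β q.1 q.2)
  (hs : Continuous fun q : ℝ × ℝ => s q.1 q.2)

include hβ hs

lemma continuous_source (x t : ℝ) :
    Continuous fun ξ => V.cocycle β ξ x t * s ξ (V.flow ξ x t) :=
  (V.continuous_cocycle_comp hβ continuous_id continuous_const continuous_const).mul
    (V.continuous_along hs x t)

lemma IsMild.change_base {x₀ x₁ : ℝ} (h : V.IsMild β s u x₀) (hx₁ : x₁ ∈ Icc (0 : ℝ) 1) :
    V.IsMild β s u x₁ := by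
  intro x hx t
  have hc : ∀ a b, IntervalIntegrable (fun ξ => V.cocycle β ξ x t * s ξ (V.flow ξ x t)) volume a b :=
    fun a b => (continuous_source hβ hs x t).intervalIntegrable a b
  rw [h x hx t, h x₁ hx₁ (V.flow x₁ x t), mul_add, ← intervalIntegral.integral_const_mul]
  have h1 : ∀ ξ, V.cocycle β x₁ x t * (V.cocycle β ξ x₁ (V.flow x₁ x t) *
      s ξ (V.flow ξ x t)) = V.cocycle β ξ x t * s ξ (V.flow ξ x t) := fun ξ => by
    rw [← V.cocycle_mul hβ ξ x₁ x t]; ring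
  simp only [flow_flow, h1]
  rw [← V.cocycle_mul hβ x₀ x₁ x t, add_assoc,
    intervalIntegral.integral_add_adjacent_intervals (hc _ _) (hc _ _)]
  ring

/-- Mild solutions are differentiable along trajectories. -/
lemma IsMild.hasDerivAt (h : V.IsMild β s u 0) (t : ℝ) {ξ : ℝ} (hξ : ξ ∈ Ioo (0 : ℝ) 1) :
    HasDerivAt (fun η => u η (V.flow η 0 t))
      (s ξ (V.flow ξ 0 t) - β ξ (V.flow ξ 0 t) * u ξ (V.flow ξ 0 t)) ξ := by
  have hc := continuous_source (V := V) hβ hs 0 t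
  have h1 : ∀ η ∈ Icc (0 : ℝ) 1, u η (V.flow η 0 t) = (V.cocycle β η 0 t)⁻¹ *
      (u 0 t + ∫ z in (0 : ℝ)..η, V.cocycle β z 0 t * s z (V.flow z 0 t)) := by
    intro η hη
    rw [h η hη (V.flow η 0 t)]
    have h2 : ∀ z, V.cocycle β z η (V.flow η 0 t) =
        (V.cocycle β η 0 t)⁻¹ * V.cocycle β z 0 t := fun z => by
      rw [← V.cocycle_mul hβ z η 0 t]
      have := (V.cocycle_pos β η 0 t).ne'
      field_simp
    simp only [h2, flow_flow, flow_self, cocycle_self, mul_one, mul_assoc]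
    rw [intervalIntegral.integral_const_mul, mul_add]
  have h2 : HasDerivAt (fun η => (V.cocycle β η 0 t)⁻¹ *
      (u 0 t + ∫ z in (0 : ℝ)..η, V.cocycle β z 0 t * s z (V.flow z 0 t)))
      (s ξ (V.flow ξ 0 t) - β ξ (V.flow ξ 0 t) * u ξ (V.flow ξ 0 t)) ξ := by
    have hp := (V.cocycle_pos β ξ 0 t).ne'
    have h3 := (V.cocycle_hasDerivAt hβ ξ 0 t).inv hp
    have h4 := (intervalIntegral.integral_hasDerivAt_right (hc.intervalIntegrable 0 ξ)
      hc.stronglyMeasurable.stronglyMeasurableAtFilter hc.continuousAt).const_add (u 0 t)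
    refine (h3.mul h4).congr_deriv ?_
    rw [h1 ξ (Ioo_subset_Icc_self hξ)]
    simp only [Pi.inv_apply]
    field_simp
    ring
  refine h2.congr_of_eventuallyEq ?_
  filter_upwards [Icc_mem_nhds hξ.1 hξ.2] with η hη using h1 η hη

end PeriodicField

/-! ### The coefficients and the operators of the first-order system -/

/-- The coefficients of the equation, extended to all `x` by their boundary values.
`aX` and `aT` are the derivatives of `a`. -/
structure WaveCoeff (T : ℝ) where
  a : ℝ → ℝ → ℝ
  aX : ℝ → ℝ → ℝ
  aT : ℝ → ℝ → ℝ
  a₁ : ℝ → ℝ → ℝ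
  a₂ : ℝ → ℝ → ℝ
  a₃ : ℝ → ℝ → ℝ
  r₀ : ℝ → ℝ
  r₁ : ℝ → ℝ
  ha : IsPer T a
  haX : IsPer T aX
  haT : IsPer T aT
  ha₁ : IsPer T a₁
  ha₂ : IsPer T a₂
  ha₃ : IsPer T a₃
  hr₀ : Continuous r₀
  hr₁ : Continuous r₁
  hr₀T : ∀ t, r₀ (t + T) = r₀ t
  hr₁T : ∀ t, r₁ (t + T) = r₁ t
  pos : ∀ x t, 0 < a x t
  a_clamp : ∀ x t, a (projIcc (0 : ℝ) 1 zero_le_one x) t = a x t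
  aT_clamp : ∀ x t, aT (projIcc (0 : ℝ) 1 zero_le_one x) t = aT x t
  hasDeriv : ∀ x t, HasDerivAt (a x) (aT x t) t
  hasDerivX : ∀ x ∈ Ioo (0 : ℝ) 1, ∀ t, HasDerivAt (fun y => a y t) (aX x t) x

lemma IsPer.mul {g h : ℝ → ℝ → ℝ} (hg : IsPer T g) (hh : IsPer T h) :
    IsPer T fun x t => g x t * h x t :=
  ⟨hg.cont.mul hh.cont, fun x t => by rw [hg.per, hh.per]⟩

lemma IsPer.div {g h : ℝ → ℝ → ℝ} (hg : IsPer T g) (hh : IsPer T h) (h0 : ∀ x t, h x t ≠ 0) :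
    IsPer T fun x t => g x t / h x t :=
  ⟨hg.cont.div hh.cont fun _ => h0 _ _, fun x t => by rw [hg.per, hh.per]⟩

lemma IsPer.neg {g : ℝ → ℝ → ℝ} (hg : IsPer T g) : IsPer T fun x t => -g x t :=
  ⟨hg.cont.neg, fun x t => by rw [hg.per]⟩

lemma IsPer.const (T c : ℝ) : IsPer T fun _ _ => c := ⟨continuous_const, fun _ _ => rfl⟩

lemma PeriodicField.isPer (V : PeriodicField T) : IsPer T V.F := ⟨V.cont, V.per⟩

lemma IsPer.add {g h : ℝ → ℝ → ℝ} (hg : IsPer T g) (hh : IsPer T h) :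
    IsPer T fun x t => g x t + h x t :=
  ⟨hg.cont.add hh.cont, fun x t => by rw [hg.per, hh.per]⟩

lemma IsPer.sub {g h : ℝ → ℝ → ℝ} (hg : IsPer T g) (hh : IsPer T h) :
    IsPer T fun x t => g x t - h x t :=
  ⟨hg.cont.sub hh.cont, fun x t => by rw [hg.per, hh.per]⟩

variable [hT : Fact (0 < T)]

namespace WaveCoeff

variable (q : WaveCoeff T)

lemma a_ne (x t : ℝ) : q.a x t ≠ 0 := (q.pos x t).ne'

/-- The coefficient of `u₁` in the equation for `u₁`. -/
def b₁₁ (x t : ℝ) : ℝ := q.a₁ x t / 2 + q.a₂ x t / (2 * q.a x t)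
  + (q.a x t * q.aX x t - q.aT x t) / (2 * q.a x t)

/-- The coefficient of `u₂` in the equation for `u₁`. -/
def b₁₂ (x t : ℝ) : ℝ := q.a₁ x t / 2 - q.a₂ x t / (2 * q.a x t)
  - (q.a x t * q.aX x t - q.aT x t) / (2 * q.a x t)

/-- The coefficient of `u₁` in the equation for `u₂`. -/
def b₂₁ (x t : ℝ) : ℝ := q.a₁ x t / 2 + q.a₂ x t / (2 * q.a x t)
  + (q.a x t * q.aX x t + q.aT x t) / (2 * q.a x t)

/-- The coefficient of `u₂` in the equation for `u₂`. -/
def b₂₂ (x t : ℝ) : ℝ := q.a₁ x t / 2 - q.a₂ x t / (2 * q.a x t)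
  - (q.a x t * q.aX x t + q.aT x t) / (2 * q.a x t)

lemma two_a_ne (x t : ℝ) : 2 * q.a x t ≠ 0 := mul_ne_zero two_ne_zero (q.a_ne x t)

lemma h_two_a : IsPer T fun x t => 2 * q.a x t := (IsPer.const T 2).mul q.ha

lemma h_half_a₁ : IsPer T fun x t => q.a₁ x t / 2 :=
  q.ha₁.div (IsPer.const T 2) fun _ _ => two_ne_zero

lemma hb₁₁ : IsPer T q.b₁₁ :=
  (q.h_half_a₁.add (q.ha₂.div q.h_two_a q.two_a_ne)).add
    (((q.ha.mul q.haX).sub q.haT).div q.h_two_a q.two_a_ne)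

lemma hb₁₂ : IsPer T q.b₁₂ :=
  (q.h_half_a₁.sub (q.ha₂.div q.h_two_a q.two_a_ne)).sub
    (((q.ha.mul q.haX).sub q.haT).div q.h_two_a q.two_a_ne)

lemma hb₂₁ : IsPer T q.b₂₁ :=
  (q.h_half_a₁.add (q.ha₂.div q.h_two_a q.two_a_ne)).add
    (((q.ha.mul q.haX).add q.haT).div q.h_two_a q.two_a_ne)

lemma hb₂₂ : IsPer T q.b₂₂ :=
  (q.h_half_a₁.sub (q.ha₂.div q.h_two_a q.two_a_ne)).sub
    (((q.ha.mul q.haX).add q.haT).div q.h_two_a q.two_a_ne)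

/-- The vector field `σ / a`. -/
def field (σ : ℝ) : PeriodicField T where
  F x y := σ / q.a x y
  F' x y := -(σ * q.aT x y) / q.a x y ^ 2
  cont := continuous_const.div q.ha.cont fun _ => q.a_ne _ _
  cont' := ((continuous_const.mul q.haT.cont).neg).div (q.ha.cont.pow 2)
    fun _ => pow_ne_zero _ (q.a_ne _ _)
  hasDeriv x y := by
    have h := ((hasDerivAt_const y σ).div (q.hasDeriv x y) (q.a_ne x y))
    exact h.congr_deriv (by ring)
  per x y := by rw [q.ha.per]
  per' x y := by rw [q.ha.per, q.haT.per]
  bound := by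
    obtain ⟨M, -, hM⟩ := ((IsPer.const T σ).div q.ha q.a_ne).exists_bound
    exact ⟨M, fun x y => by
      rw [← q.a_clamp]; exact hM _ (projIcc (0 : ℝ) 1 zero_le_one x).2 y⟩
  bound' := by
    obtain ⟨M, -, hM⟩ := ((((IsPer.const T σ).mul q.haT).neg).div (q.ha.mul q.ha)
      fun x t => mul_ne_zero (q.a_ne x t) (q.a_ne x t)).exists_bound
    exact ⟨M, fun x y => by
      rw [← q.a_clamp, ← q.aT_clamp, pow_two]
      exact hM _ (projIcc (0 : ℝ) 1 zero_le_one x).2 y⟩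

lemma field_zero_flow (ξ x t : ℝ) : (q.field 0).flow ξ x t = t := by
  refine ((q.field 0).flow_unique (y := fun _ => t) (fun ξ => ?_) rfl ξ).symm
  simpa [field] using hasDerivAt_const ξ t

end WaveCoeff

/-- The Duhamel operator `u ↦ ∫_0^x c(ξ, x, t) m u dξ` along the trajectory through `(x, t)`. -/
def duhamel (V : PeriodicField T) {β m : ℝ → ℝ → ℝ} (hβ : IsPer T β) (hm : IsPer T m) :
    CT T →L[ℝ] CT T :=
  charInt V (k := fun ξ x t => V.cocycle β ξ x t * m ξ (V.flow ξ x t))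
    ⟨(V.continuous_cocycle hβ.cont).mul (hm.cont.comp (continuous_fst.prodMk V.continuous_flow)),
      fun ξ x t => by rw [V.cocycle_add_period hβ.per, V.flow_add_period, hm.per]⟩

lemma ev_duhamel (V : PeriodicField T) {β m : ℝ → ℝ → ℝ} (hβ : IsPer T β) (hm : IsPer T m)
    (u : CT T) {x : ℝ} (hx : x ∈ Icc (0 : ℝ) 1) (t : ℝ) : ev (duhamel V hβ hm u) x t =
      ∫ ξ in (0 : ℝ)..x, V.cocycle β ξ x t * m ξ (V.flow ξ x t) * ev u ξ (V.flow ξ x t) :=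
  ev_charInt _ _ _ hx t

/-- The transport of boundary values from `x = 0` along the trajectories. -/
def transport (V : PeriodicField T) {β : ℝ → ℝ → ℝ} (hβ : IsPer T β) : PC T →L[ℝ] CT T :=
  compOp (w := fun x t => V.cocycle β 0 x t) (ψ := fun x t => V.flow 0 x t)
    ⟨V.continuous_cocycle_comp hβ.cont continuous_const continuous_fst continuous_snd,
      fun x t => V.cocycle_add_period hβ.per 0 x t⟩
    ⟨V.continuous_flow_comp continuous_const continuous_fst continuous_snd,
      fun x t => V.flow_add_period 0 x t⟩

lemma ev_transport (V : PeriodicField T) {β : ℝ → ℝ → ℝ} (hβ : IsPer T β) (h : PC T) {x : ℝ}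
    (hx : x ∈ Icc (0 : ℝ) 1) (t : ℝ) : ev (transport V hβ h) x t =
      V.cocycle β 0 x t * h (V.flow 0 x t : AddCircle T) :=
  ev_compOp _ _ _ hx t

/-- Boundary values as functions on the strip that do not depend on `x`. -/
def extend (T : ℝ) [Fact (0 < T)] : PC T →L[ℝ] CT T :=
  compOp (w := fun _ _ => 1) (ψ := fun _ t => t) (IsPer.const T 1) ⟨continuous_snd, fun _ _ => rfl⟩

lemma ev_extend (h : PC T) {x : ℝ} (hx : x ∈ Icc (0 : ℝ) 1) (t : ℝ) :
    ev (extend T h) x t = h (t : AddCircle T) := by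
  rw [extend, ev_compOp _ _ _ hx, one_mul]

namespace WaveCoeff

variable (q : WaveCoeff T)

/-- The field of the first characteristics. -/
abbrev V₁ : PeriodicField T := q.field (-1)

/-- The field of the second characteristics. -/
abbrev V₂ : PeriodicField T := q.field 1

/-- The damping of `u₁` along the first characteristics, per unit of `x`. -/
def β₁ (x t : ℝ) : ℝ := -(q.b₁₁ x t / q.a x t)

/-- The damping of `u₂` along the second characteristics, per unit of `x`. -/
def β₂ (x t : ℝ) : ℝ := q.b₂₂ x t / q.a x t

lemma hβ₁ : IsPer T q.β₁ := (q.hb₁₁.div q.ha q.a_ne).neg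

lemma hβ₂ : IsPer T q.β₂ := q.hb₂₂.div q.ha q.a_ne

/-- The operator `v ↦ ∫_0^x v / (2a) dξ`. -/
def J : CT T →L[ℝ] CT T :=
  charInt (q.field 0) (k := fun ξ _ t => 1 / (2 * q.a ξ t))
    ⟨continuous_const.div (continuous_const.mul (q.ha.comp (by fun_prop) (by fun_prop)))
      fun _ => mul_ne_zero two_ne_zero (q.a_ne _ _), fun ξ x t => by rw [q.ha.per]⟩

lemma ev_J (v : CT T) {x : ℝ} (hx : x ∈ Icc (0 : ℝ) 1) (t : ℝ) :
    ev (q.J v) x t = ∫ ξ in (0 : ℝ)..x, 1 / (2 * q.a ξ t) * ev v ξ t := by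
  rw [J, ev_charInt _ _ _ hx]
  simp only [field_zero_flow]

/-- The Volterra part of the first-order system. -/
def volterra : CT T × CT T →L[ℝ] CT T × CT T :=
  (((duhamel q.V₁ q.hβ₁ (q.V₁.isPer.mul q.hb₁₂).neg) ∘L ContinuousLinearMap.snd ℝ _ _ +
    (duhamel q.V₁ q.hβ₁ (q.V₁.isPer.mul q.ha₃).neg) ∘L q.J ∘L
      (ContinuousLinearMap.fst ℝ _ _ - ContinuousLinearMap.snd ℝ _ _))).prod
  (((duhamel q.V₂ q.hβ₂ (q.V₂.isPer.mul q.hb₂₁).neg) ∘L ContinuousLinearMap.fst ℝ _ _ +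
    (duhamel q.V₂ q.hβ₂ (q.V₂.isPer.mul q.ha₃).neg) ∘L q.J ∘L
      (ContinuousLinearMap.fst ℝ _ _ - ContinuousLinearMap.snd ℝ _ _)))

lemma volterra_apply (u : CT T × CT T) : q.volterra u =
    (duhamel q.V₁ q.hβ₁ (q.V₁.isPer.mul q.hb₁₂).neg u.2 +
      duhamel q.V₁ q.hβ₁ (q.V₁.isPer.mul q.ha₃).neg (q.J (u.1 - u.2)),
    duhamel q.V₂ q.hβ₂ (q.V₂.isPer.mul q.hb₂₁).neg u.1 +
      duhamel q.V₂ q.hβ₂ (q.V₂.isPer.mul q.ha₃).neg (q.J (u.1 - u.2))) := rfl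

end WaveCoeff

/-- The Volterra property of integrals along trajectories. -/
lemma abs_ev_charInt_le (V : PeriodicField T) {k : ℝ → ℝ → ℝ → ℝ} (hk : IsPer₃ T k) :
    ∃ M, 0 < M ∧ ∀ (u : CT T) (B : ℝ) (n : ℕ), 0 ≤ B →
      (∀ x ∈ Icc (0 : ℝ) 1, ∀ t, |ev u x t| ≤ B * x ^ n) →
      ∀ x ∈ Icc (0 : ℝ) 1, ∀ t, |ev (charInt V hk u) x t| ≤ M * B * (x ^ (n + 1) / (n + 1)) := by
  obtain ⟨M, hM, hb⟩ := hk.exists_bound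
  refine ⟨M, hM, fun u B n hB hu x hx t => ?_⟩
  rw [ev_charInt _ _ _ hx]
  have h1 : ∀ ξ ∈ Ioc 0 x, ‖k ξ x t * ev u ξ (V.flow ξ x t)‖ ≤ M * B * ξ ^ n := fun ξ hξ => by
    have hξ' : ξ ∈ Icc (0 : ℝ) 1 := ⟨hξ.1.le, hξ.2.trans hx.2⟩
    rw [norm_mul, mul_assoc]
    exact mul_le_mul (hb ξ hξ' x hx t) (hu ξ hξ' _) (norm_nonneg _) hM.le
  have h2 := intervalIntegral.norm_integral_le_of_norm_le (μ := volume) hx.1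
    (ae_of_all _ h1) ((by fun_prop : Continuous fun ξ : ℝ => M * B * ξ ^ n).intervalIntegrable 0 x)
  rw [intervalIntegral.integral_const_mul, integral_pow, zero_pow (Nat.succ_ne_zero n),
    sub_zero] at h2
  exact h2

end RobinWave

namespace RobinWave

variable {T : ℝ} [hT : Fact (0 < T)]

/-! ### Reduction to an equation on the circle -/

namespace WaveCoeff

variable (q : WaveCoeff T)

/-- The Volterra operator improves a bound by `B xⁿ` to a bound by `N B xⁿ⁺¹ / (n + 1)`. -/
lemma exists_volterra_bound : ∃ N, 0 < N ∧ ∀ (u : CT T × CT T) (B : ℝ) (n : ℕ), 0 ≤ B →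
    (∀ x ∈ Icc (0 : ℝ) 1, ∀ t, |ev u.1 x t| ≤ B * x ^ n ∧ |ev u.2 x t| ≤ B * x ^ n) →
    ∀ x ∈ Icc (0 : ℝ) 1, ∀ t, |ev (q.volterra u).1 x t| ≤ (N * B / (n + 1)) * x ^ (n + 1) ∧
      |ev (q.volterra u).2 x t| ≤ (N * B / (n + 1)) * x ^ (n + 1) := by
  have hgen : ∀ (V : PeriodicField T) (β m₁ m₂ : ℝ → ℝ → ℝ) (hβ : IsPer T β) (hm₁ : IsPer T m₁)
      (hm₂ : IsPer T m₂), ∃ N, 0 < N ∧ ∀ (u : CT T × CT T) (w : CT T) (B : ℝ) (n : ℕ), 0 ≤ B →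
      (∀ x ∈ Icc (0 : ℝ) 1, ∀ t, |ev u.1 x t| ≤ B * x ^ n ∧ |ev u.2 x t| ≤ B * x ^ n) →
      (∀ x ∈ Icc (0 : ℝ) 1, ∀ t, |ev w x t| ≤ B * x ^ n) →
      ∀ x ∈ Icc (0 : ℝ) 1, ∀ t,
        |ev (duhamel V hβ hm₁ w + duhamel V hβ hm₂ (q.J (u.1 - u.2)) : CT T) x t| ≤
          (N * B / (n + 1)) * x ^ (n + 1) := by
    intro V β m₁ m₂ hβ hm₁ hm₂
    obtain ⟨M₁, hM₁, h₁⟩ := abs_ev_charInt_le V (k := fun ξ x t => V.cocycle β ξ x t *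
      m₁ ξ (V.flow ξ x t)) ⟨(V.continuous_cocycle hβ.cont).mul (hm₁.cont.comp
        (continuous_fst.prodMk V.continuous_flow)), fun ξ x t => by
          rw [V.cocycle_add_period hβ.per, V.flow_add_period, hm₁.per]⟩
    obtain ⟨M₂, hM₂, h₂⟩ := abs_ev_charInt_le V (k := fun ξ x t => V.cocycle β ξ x t *
      m₂ ξ (V.flow ξ x t)) ⟨(V.continuous_cocycle hβ.cont).mul (hm₂.cont.comp
        (continuous_fst.prodMk V.continuous_flow)), fun ξ x t => by
          rw [V.cocycle_add_period hβ.per, V.flow_add_period, hm₂.per]⟩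
    obtain ⟨M₃, hM₃, h₃⟩ := abs_ev_charInt_le (q.field 0) (k := fun ξ _ t => 1 / (2 * q.a ξ t))
      ⟨continuous_const.div (continuous_const.mul (q.ha.comp (by fun_prop) (by fun_prop)))
        fun _ => mul_ne_zero two_ne_zero (q.a_ne _ _), fun ξ x t => by rw [q.ha.per]⟩
    refine ⟨M₁ + M₂ * (M₃ * 2), by positivity, fun u w B n hB hu hw x hx t => ?_⟩
    have hJ : ∀ x ∈ Icc (0 : ℝ) 1, ∀ t, |ev (q.J (u.1 - u.2)) x t| ≤ (M₃ * (2 * B)) * x ^ n := by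
      intro x hx t
      have hd : ∀ x ∈ Icc (0 : ℝ) 1, ∀ t, |ev (u.1 - u.2 : CT T) x t| ≤ (2 * B) * x ^ n :=
        fun x hx t => by
          have := hu x hx t
          rw [ev_sub]
          exact (abs_sub _ _).trans (by linarith [this.1, this.2])
      refine (h₃ _ (2 * B) n (by positivity) hd x hx t).trans
        (mul_le_mul_of_nonneg_left ?_ (by positivity))
      have hx0 := hx.1
      rw [div_le_iff₀ (by positivity), pow_succ]
      refine mul_le_mul_of_nonneg_left (hx.2.trans ?_) (by positivity)
      have : (0 : ℝ) ≤ n := Nat.cast_nonneg n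
      linarith
    rw [ev_add]
    have e₁ := h₁ w B n hB hw x hx t
    have e₂ := h₂ _ (M₃ * (2 * B)) n (by positivity) hJ x hx t
    refine (abs_add_le _ _).trans ((add_le_add e₁ e₂).trans_eq ?_)
    ring
  obtain ⟨N₁, hN₁, h₁⟩ := hgen q.V₁ _ _ _ q.hβ₁ (q.V₁.isPer.mul q.hb₁₂).neg
    (q.V₁.isPer.mul q.ha₃).neg
  obtain ⟨N₂, hN₂, h₂⟩ := hgen q.V₂ _ _ _ q.hβ₂ (q.V₂.isPer.mul q.hb₂₁).neg
    (q.V₂.isPer.mul q.ha₃).neg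
  refine ⟨N₁ + N₂, by positivity, fun u B n hB hu x hx t => ?_⟩
  have hx0 := hx.1
  have e₁ := h₁ u u.2 B n hB hu (fun x hx t => (hu x hx t).2) x hx t
  have e₂ := h₂ u u.1 B n hB hu (fun x hx t => (hu x hx t).1) x hx t
  rw [volterra_apply]
  refine ⟨e₁.trans ?_, e₂.trans ?_⟩ <;> gcongr <;> linarith

lemma isUnit_one_sub_volterra : IsUnit (1 - q.volterra) := by
  obtain ⟨N, hN, h⟩ := q.exists_volterra_bound
  have hpow : ∀ (n : ℕ) (u : CT T × CT T), ∀ x ∈ Icc (0 : ℝ) 1, ∀ t,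
      |ev ((q.volterra ^ n) u).1 x t| ≤ (N ^ n / n.factorial * ‖u‖) * x ^ n ∧
        |ev ((q.volterra ^ n) u).2 x t| ≤ (N ^ n / n.factorial * ‖u‖) * x ^ n := by
    intro n
    induction n with
    | zero =>
      intro u x hx t
      simp only [pow_zero, Nat.factorial_zero, Nat.cast_one, div_one, one_mul, mul_one]
      exact ⟨(abs_ev_le _ _ _).trans (norm_fst_le u), (abs_ev_le _ _ _).trans (norm_snd_le u)⟩
    | succ n ih =>
      intro u x hx t
      have h1 := h ((q.volterra ^ n) u) _ n (by positivity) (ih u) x hx t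
      rw [pow_succ', Nat.factorial_succ]
      refine ⟨h1.1.trans_eq ?_, h1.2.trans_eq ?_⟩ <;>
      · push_cast
        have : (n.factorial : ℝ) ≠ 0 := by positivity
        have : (n : ℝ) + 1 ≠ 0 := by positivity
        field_simp
        ring
  obtain ⟨n, hn⟩ := ((FloorSemiring.tendsto_pow_div_factorial_atTop N).eventually
    (gt_mem_nhds one_pos)).exists
  refine isUnit_one_sub_of_norm_pow_lt_one n (lt_of_le_of_lt ?_ hn)
  refine ContinuousLinearMap.opNorm_le_bound _ (by positivity) fun u => ?_
  have hx1 : ∀ x ∈ Icc (0 : ℝ) 1, x ^ n ≤ 1 := fun x hx => pow_le_one₀ hx.1 hx.2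
  refine max_le ?_ ?_ <;> refine CT.norm_le (by positivity) fun x hx t => ?_
  · exact (hpow n u x hx t).1.trans (mul_le_of_le_one_right (by positivity) (hx1 x hx))
  · exact (hpow n u x hx t).2.trans (mul_le_of_le_one_right (by positivity) (hx1 x hx))

/-- The inverse of `1 - volterra`. -/
def resolvent : CT T × CT T →L[ℝ] CT T × CT T :=
  ((q.isUnit_one_sub_volterra.unit⁻¹ : (CT T × CT T →L[ℝ] CT T × CT T)ˣ) :
    CT T × CT T →L[ℝ] CT T × CT T)

lemma resolvent_mul : q.resolvent * (1 - q.volterra) = 1 :=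
  q.isUnit_one_sub_volterra.val_inv_mul

lemma mul_resolvent : (1 - q.volterra) * q.resolvent = 1 :=
  q.isUnit_one_sub_volterra.mul_val_inv

lemma eq_resolvent_iff (u v : CT T × CT T) : u = v + q.volterra u ↔ u = q.resolvent v := by
  constructor
  · intro h
    have h1 : (1 - q.volterra) u = v := by
      rw [_root_.sub_apply, one_apply_eq_self, sub_eq_iff_eq_add]
      exact h
    rw [← h1]
    exact (congrArg (fun f : CT T × CT T →L[ℝ] CT T × CT T => f u) q.resolvent_mul).symm
  · intro h
    have h1 := congrArg (fun f : CT T × CT T →L[ℝ] CT T × CT T => f v) q.mul_resolvent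
    simp only [mul_apply_eq_comp, ← h, _root_.sub_apply,
      one_apply_eq_self] at h1
    rwa [sub_eq_iff_eq_add] at h1

lemma resolvent_apply (v : CT T × CT T) :
    q.resolvent v = v + q.resolvent (q.volterra v) := by
  have h1 := congrArg (fun f : CT T × CT T →L[ℝ] CT T × CT T => f v) q.resolvent_mul
  simp only [mul_apply_eq_comp, _root_.sub_apply,
      one_apply_eq_self, map_sub] at h1
  rwa [sub_eq_iff_eq_add] at h1

end WaveCoeff

/-- The mean value as a constant function. -/
def meanOp (T : ℝ) [hT : Fact (0 < T)] : PC T →L[ℝ] PC T :=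
  pcCLM (fun h _ => mean h) (fun _ => continuous_const) (fun _ _ => rfl)
    (fun h₁ h₂ _ => mean_add h₁ h₂) (fun c h _ => mean_smul c h)
    ⟨1, one_pos, fun h _ => by simpa using abs_mean_le h⟩

@[simp] lemma meanOp_apply (h : PC T) (t : ℝ) : meanOp T h (t : AddCircle T) = mean h := rfl

lemma abs_mean_le_prim (h : PC T) : |mean h| ≤ ‖prim T h‖ := by
  rw [← primFun_zero]; exact (prim T h).abs_le ((0 : ℝ) : AddCircle T)

lemma isCompactOperator_meanOp : IsCompactOperator (meanOp T) := by
  refine isCompactOperator_of_ehrling (isCompactOperator_prim (T := T)) fun ε hε =>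
    ⟨1, fun h => PC.norm_le (by positivity) fun t => ?_⟩
  have := abs_mean_le_prim h
  have := mul_nonneg hε.le (norm_nonneg h)
  rw [meanOp_apply]
  linarith

namespace WaveCoeff

variable (q : WaveCoeff T)

/-- The coefficient `a r₀` on the boundary `x = 0`. -/
def ar₀ : PC T := mkPC (g := fun t => q.a 0 t * q.r₀ t)
  ((q.ha.comp continuous_const continuous_id).mul q.hr₀) fun t => by rw [q.ha.per, q.hr₀T]

/-- The coefficient `a r₁` on the boundary `x = 1`. -/
def ar₁ : PC T := mkPC (g := fun t => q.a 1 t * q.r₁ t)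
  ((q.ha.comp continuous_const continuous_id).mul q.hr₁) fun t => by rw [q.ha.per, q.hr₁T]

/-- The compact part of the boundary values `u₁(0, ·)`, as a function of the unknown `h`. -/
def lower₁ : PC T →L[ℝ] PC T := -meanOp T + ContinuousLinearMap.mul ℝ (PC T) q.ar₀ ∘L prim T

/-- The compact part of the boundary values `u₂(0, ·)`, as a function of the unknown `h`. -/
def lower₂ : PC T →L[ℝ] PC T := -meanOp T - ContinuousLinearMap.mul ℝ (PC T) q.ar₀ ∘L prim T

lemma lower₁_apply (h : PC T) (t : ℝ) : q.lower₁ h (t : AddCircle T) =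
    -mean h + q.a 0 t * q.r₀ t * primFun h t := rfl

lemma lower₂_apply (h : PC T) (t : ℝ) : q.lower₂ h (t : AddCircle T) =
    -mean h - q.a 0 t * q.r₀ t * primFun h t := rfl

/-- The contribution of the unknown `h` to the first-order system: the boundary values
`G' ± a r₀ G` at `x = 0` of `u₁` and `u₂`, where `G = prim h`, and the term `a₃ G`. -/
def data : PC T →L[ℝ] CT T × CT T :=
  (transport q.V₁ q.hβ₁ ∘L (1 + q.lower₁) +
    duhamel q.V₁ q.hβ₁ (q.V₁.isPer.mul q.ha₃).neg ∘L extend T ∘L prim T).prod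
  (transport q.V₂ q.hβ₂ ∘L (1 + q.lower₂) +
    duhamel q.V₂ q.hβ₂ (q.V₂.isPer.mul q.ha₃).neg ∘L extend T ∘L prim T)

/-- The contribution of the right-hand side `f`. -/
def source : CT T →L[ℝ] CT T × CT T :=
  (duhamel q.V₁ q.hβ₁ q.V₁.isPer).prod (duhamel q.V₂ q.hβ₂ q.V₂.isPer)

/-- The part of the residual of the boundary condition at `x = 1` that depends on `u`. -/
def residual : CT T × CT T →L[ℝ] PC T :=
  trace₁ T ∘L (ContinuousLinearMap.fst ℝ _ _ - ContinuousLinearMap.snd ℝ _ _) -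
    (2 : ℝ) • (ContinuousLinearMap.mul ℝ (PC T) q.ar₁ ∘L trace₁ T ∘L q.J ∘L
      (ContinuousLinearMap.fst ℝ _ _ - ContinuousLinearMap.snd ℝ _ _))

lemma residual_apply (u : CT T × CT T) (t : ℝ) : q.residual u (t : AddCircle T) =
    ev u.1 1 t - ev u.2 1 t - 2 * (q.a 1 t * q.r₁ t * ev (q.J (u.1 - u.2)) 1 t) := rfl

/-- The operator on the circle whose kernel and range describe the weak solutions. -/
def circleOp : PC T →L[ℝ] PC T :=
  q.residual ∘L q.resolvent ∘L q.data -
    (2 : ℝ) • (ContinuousLinearMap.mul ℝ (PC T) q.ar₁ ∘L prim T)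

/-- The right-hand side of the equation on the circle, up to sign. -/
def circleSource : CT T →L[ℝ] PC T := q.residual ∘L q.resolvent ∘L q.source

/-- The leading part of `circleOp`: the difference of the transports from `x = 0` to `x = 1` along
the two families of characteristics. -/
def leadingOp : PC T →L[ℝ] PC T :=
  trace₁ T ∘L transport q.V₁ q.hβ₁ - trace₁ T ∘L transport q.V₂ q.hβ₂

/-! #### The operator on the circle is a compact perturbation of its leading part -/

/-- Integrals along one family of curves of functions that are constant, up to a weight, along a
transversal family. -/
lemma isCompactOperator_charInt_transport {σ σ' : ℝ} (hσ : σ ≠ σ') {k : ℝ → ℝ → ℝ → ℝ}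
    (hk : IsPer₃ T k) {β : ℝ → ℝ → ℝ} (hβ : IsPer T β) :
    IsCompactOperator (charInt (q.field σ) hk ∘L transport (q.field σ') hβ) := by
  set V := q.field σ with hV
  set V' := q.field σ' with hV'
  have hτ : Continuous fun z : ℝ × ℝ × ℝ => V.flow z.1 z.2.1 z.2.2 := V.continuous_flow
  refine isCompactOperator_oscillating
    (k := fun ξ x t => k ξ x t * V'.cocycle β 0 ξ (V.flow ξ x t))
    (ψ := fun ξ x t => V'.flow 0 ξ (V.flow ξ x t))
    (ρ := fun ξ x t => V'.dflow 0 ξ (V.flow ξ x t) *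
      (V.F ξ (V.flow ξ x t) - V'.F ξ (V.flow ξ x t))) ⟨?_, ?_⟩ ⟨?_, ?_⟩ ?_ ?_ ?_
  · exact hk.cont.mul (V'.continuous_cocycle_comp hβ.cont continuous_const continuous_fst hτ)
  · intro ξ x t
    rw [hk.per, V.flow_add_period, V'.cocycle_add_period hβ.per]
  · refine (V'.continuous_dflow_comp continuous_const continuous_fst hτ).mul (Continuous.sub ?_ ?_)
    · exact V.cont.comp (continuous_fst.prodMk hτ)
    · exact V'.cont.comp (continuous_fst.prodMk hτ)
  · intro ξ x t
    rw [V.flow_add_period, PeriodicField.dflow, V'.cocycle_add_period V'.per', V.per, V'.per]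
    rfl
  · intro ξ x t
    refine mul_ne_zero (V'.dflow_pos _ _ _).ne' ?_
    have : V.F ξ (V.flow ξ x t) - V'.F ξ (V.flow ξ x t) =
        (σ - σ') / q.a ξ (V.flow ξ x t) := by
      simp only [hV, hV', field]; ring
    rw [this]
    exact div_ne_zero (sub_ne_zero.2 hσ) (q.a_ne _ _)
  · intro ξ x t
    exact V'.flow_hasDerivAt_base (V.continuous_flow_left x t) (V.flow_hasDerivAt ξ x t) 0
  · intro h x hx t
    rw [ContinuousLinearMap.comp_apply, ev_charInt _ _ _ hx]
    refine intervalIntegral.integral_congr fun ξ hξ => ?_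
    rw [uIcc_of_le hx.1] at hξ
    simp only [ev_transport V' hβ h (⟨hξ.1, hξ.2.trans hx.2⟩ : ξ ∈ Icc (0 : ℝ) 1)]
    ring

lemma isCompactOperator_J_transport {σ' : ℝ} (hσ : σ' ≠ 0) {β : ℝ → ℝ → ℝ} (hβ : IsPer T β) :
    IsCompactOperator (q.J ∘L transport (q.field σ') hβ) :=
  q.isCompactOperator_charInt_transport hσ.symm _ hβ

lemma isCompactOperator_lower₁ : IsCompactOperator q.lower₁ :=
  isCompactOperator_meanOp.neg.add
    (isCompactOperator_prim.continuous_comp (ContinuousLinearMap.mul ℝ (PC T) q.ar₀).continuous)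

lemma isCompactOperator_lower₂ : IsCompactOperator q.lower₂ :=
  isCompactOperator_meanOp.neg.sub
    (isCompactOperator_prim.continuous_comp (ContinuousLinearMap.mul ℝ (PC T) q.ar₀).continuous)

lemma isCompactOperator_prod {E F G : Type*} [NormedAddCommGroup E] [NormedSpace ℝ E]
    [NormedAddCommGroup F] [NormedSpace ℝ F] [NormedAddCommGroup G] [NormedSpace ℝ G]
    {f : E →L[ℝ] F} {g : E →L[ℝ] G} (hf : IsCompactOperator f) (hg : IsCompactOperator g) :
    IsCompactOperator (f.prod g) := by
  have h1 := (hf.continuous_comp (ContinuousLinearMap.inl ℝ F G).continuous).add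
    (hg.continuous_comp (ContinuousLinearMap.inr ℝ F G).continuous)
  have h2 : ⇑(f.prod g) =
      ⇑(ContinuousLinearMap.inl ℝ F G) ∘ f + ⇑(ContinuousLinearMap.inr ℝ F G) ∘ g := by
    funext x; simp
  exact h2 ▸ h1

lemma isCompactOperator_circleOp_sub : IsCompactOperator (q.circleOp - q.leadingOp) := by
  set H : PC T →L[ℝ] CT T × CT T := (transport q.V₁ q.hβ₁).prod (transport q.V₂ q.hβ₂) with hH
  set L : PC T →L[ℝ] CT T × CT T :=
    (transport q.V₁ q.hβ₁ ∘L q.lower₁ +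
      duhamel q.V₁ q.hβ₁ (q.V₁.isPer.mul q.ha₃).neg ∘L extend T ∘L prim T).prod
    (transport q.V₂ q.hβ₂ ∘L q.lower₂ +
      duhamel q.V₂ q.hβ₂ (q.V₂.isPer.mul q.ha₃).neg ∘L extend T ∘L prim T) with hL
  have hLc : IsCompactOperator L :=
    isCompactOperator_prod
      ((q.isCompactOperator_lower₁.continuous_comp (transport q.V₁ q.hβ₁).continuous).add
        (isCompactOperator_prim.continuous_comp
          (duhamel q.V₁ q.hβ₁ (q.V₁.isPer.mul q.ha₃).neg ∘L extend T).continuous))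
      ((q.isCompactOperator_lower₂.continuous_comp (transport q.V₂ q.hβ₂).continuous).add
        (isCompactOperator_prim.continuous_comp
          (duhamel q.V₂ q.hβ₂ (q.V₂.isPer.mul q.ha₃).neg ∘L extend T).continuous))
  set JH : PC T →L[ℝ] CT T := q.J ∘L transport q.V₁ q.hβ₁ - q.J ∘L transport q.V₂ q.hβ₂ with hJH
  have hJHc : IsCompactOperator JH :=
    (q.isCompactOperator_J_transport (by norm_num) q.hβ₁).sub
      (q.isCompactOperator_J_transport (by norm_num) q.hβ₂)
  have hVH : IsCompactOperator (q.volterra ∘L H) := by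
    have h1 : q.volterra ∘L H =
        (duhamel q.V₁ q.hβ₁ (q.V₁.isPer.mul q.hb₁₂).neg ∘L transport q.V₂ q.hβ₂ +
          duhamel q.V₁ q.hβ₁ (q.V₁.isPer.mul q.ha₃).neg ∘L JH).prod
        (duhamel q.V₂ q.hβ₂ (q.V₂.isPer.mul q.hb₂₁).neg ∘L transport q.V₁ q.hβ₁ +
          duhamel q.V₂ q.hβ₂ (q.V₂.isPer.mul q.ha₃).neg ∘L JH) := by
      refine ContinuousLinearMap.ext fun h => ?_
      rw [ContinuousLinearMap.comp_apply, volterra_apply]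
      simp [hH, hJH]
    rw [h1]
    exact isCompactOperator_prod
      ((q.isCompactOperator_charInt_transport (by norm_num) _ q.hβ₂).add
        (hJHc.continuous_comp (duhamel q.V₁ q.hβ₁ (q.V₁.isPer.mul q.ha₃).neg).continuous))
      ((q.isCompactOperator_charInt_transport (by norm_num) _ q.hβ₁).add
        (hJHc.continuous_comp (duhamel q.V₂ q.hβ₂ (q.V₂.isPer.mul q.ha₃).neg).continuous))
  have hdata : ∀ h, q.data h = H h + L h := fun h => by
    simp only [data, hH, hL, ContinuousLinearMap.prod_apply, _root_.add_apply,
      ContinuousLinearMap.comp_apply, map_add, one_apply_eq_self, Prod.mk_add_mk,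
      add_assoc]
  have hres : ∀ h, q.residual (H h) =
      q.leadingOp h - (2 : ℝ) • (q.ar₁ * trace₁ T (JH h)) := fun h => by
    simp [residual, leadingOp, hH, hJH, mul_sub]
  have heq : q.circleOp - q.leadingOp =
      (-((2 : ℝ) • (ContinuousLinearMap.mul ℝ (PC T) q.ar₁ ∘L trace₁ T)) ∘L JH +
      (q.residual ∘L q.resolvent) ∘L (q.volterra ∘L H) + (q.residual ∘L q.resolvent) ∘L L) -
      ((2 : ℝ) • ContinuousLinearMap.mul ℝ (PC T) q.ar₁) ∘L prim T := by
    refine ContinuousLinearMap.ext fun h => ?_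
    have h1 : q.residual (q.resolvent (q.data h)) = q.leadingOp h -
        (2 : ℝ) • (q.ar₁ * trace₁ T (JH h)) + q.residual (q.resolvent (q.volterra (H h))) +
        q.residual (q.resolvent (L h)) := by
      rw [hdata, map_add, map_add, q.resolvent_apply (H h), map_add, hres]
    simp only [circleOp, _root_.sub_apply, ContinuousLinearMap.comp_apply, h1,
      _root_.add_apply, _root_.neg_apply, _root_.smul_apply,
      ContinuousLinearMap.mul_apply']
    abel
  rw [heq]
  exact (((hJHc.continuous_comp
    (-((2 : ℝ) • (ContinuousLinearMap.mul ℝ (PC T) q.ar₁ ∘L trace₁ T))).continuous).add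
    (hVH.continuous_comp (q.residual ∘L q.resolvent).continuous)).add
    (hLc.continuous_comp (q.residual ∘L q.resolvent).continuous)).sub
    (isCompactOperator_prim.continuous_comp
      ((2 : ℝ) • ContinuousLinearMap.mul ℝ (PC T) q.ar₁).continuous)

end WaveCoeff

/-! ### Invertibility of the leading part -/

/-- Transport of periodic functions of `t` from the line `ξ` to the line `x` along trajectories. -/
def shiftOp (V : PeriodicField T) {β : ℝ → ℝ → ℝ} (hβ : IsPer T β) (ξ x : ℝ) : PC T →L[ℝ] PC T :=
  have hw : IsPer T fun _ t => V.cocycle β ξ x t :=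
    ⟨V.continuous_cocycle_comp hβ.cont continuous_const continuous_const continuous_snd,
      fun _ t => V.cocycle_add_period hβ.per ξ x t⟩
  pcCLM (fun h t => V.cocycle β ξ x t * h (V.flow ξ x t : AddCircle T))
    (fun h => (hw.comp (continuous_const (y := (0 : ℝ))) continuous_id).mul
      (h.cont.comp (V.continuous_flow_comp continuous_const continuous_const continuous_id)))
    (fun h t => by rw [V.cocycle_add_period hβ.per, V.flow_add_period, h.per])
    (fun h₁ h₂ t => by simp [mul_add])
    (fun c h t => by simp; ring)
    (by
      obtain ⟨M, hM, hb⟩ := hw.exists_bound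
      refine ⟨M, hM, fun h t => ?_⟩
      rw [abs_mul]
      exact mul_le_mul (hb 0 (by simp) t) (h.abs_le _) (abs_nonneg _) hM.le)

lemma shiftOp_apply (V : PeriodicField T) {β : ℝ → ℝ → ℝ} (hβ : IsPer T β) (ξ x : ℝ) (h : PC T)
    (t : ℝ) : shiftOp V hβ ξ x h (t : AddCircle T) =
      V.cocycle β ξ x t * h (V.flow ξ x t : AddCircle T) := rfl

lemma shiftOp_mul_shiftOp (V : PeriodicField T) {β : ℝ → ℝ → ℝ} (hβ : IsPer T β) (ξ x : ℝ) :
    shiftOp V hβ ξ x * shiftOp V hβ x ξ = 1 := by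
  refine ContinuousLinearMap.ext fun h => PC.ext fun t => ?_
  rw [mul_apply_eq_comp, shiftOp_apply, shiftOp_apply, one_apply_eq_self, ← mul_assoc,
    mul_comm (V.cocycle β ξ x t), V.cocycle_mul hβ.cont, V.flow_flow, V.flow_self, V.cocycle_self,
    one_mul]

lemma isUnit_one_sub_shiftOp_mul (V W : PeriodicField T) {β γ : ℝ → ℝ → ℝ} (hβ : IsPer T β)
    (hγ : IsPer T γ) (ξ x : ℝ)
    (hne : ∀ t, V.cocycle β ξ x t * W.cocycle γ x ξ (V.flow ξ x t) ≠ 1) :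
    IsUnit (1 - shiftOp V hβ ξ x * shiftOp W hγ x ξ) := by
  have h1 : ∀ t : ℝ, (shiftOp V hβ ξ x * shiftOp W hγ x ξ) 1 (t : AddCircle T) =
      V.cocycle β ξ x t * W.cocycle γ x ξ (V.flow ξ x t) := fun t => by
    simp [mul_apply_eq_comp, shiftOp_apply]
  refine isUnit_one_sub_of_weight_ne_one (L' := shiftOp W hγ ξ x * shiftOp V hβ x ξ) ?_ ?_ ?_ ?_
    (fun t => ?_) (fun t => ?_)
  · rw [mul_assoc, ← mul_assoc (shiftOp W hγ x ξ), shiftOp_mul_shiftOp, one_mul,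
      shiftOp_mul_shiftOp]
  · rw [mul_assoc, ← mul_assoc (shiftOp V hβ x ξ), shiftOp_mul_shiftOp, one_mul,
      shiftOp_mul_shiftOp]
  · exact fun t => ⟨W.flow x ξ (V.flow ξ x t), fun h => by
      simp only [mul_apply_eq_comp, shiftOp_apply, ContinuousMap.one_apply]; ring⟩
  · exact fun t => ⟨V.flow x ξ (W.flow ξ x t), fun h => by
      simp only [mul_apply_eq_comp, shiftOp_apply, ContinuousMap.one_apply]; ring⟩
  · rw [h1]; exact mul_pos (V.cocycle_pos _ _ _ _) (W.cocycle_pos _ _ _ _)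
  · rw [h1]; exact hne t

namespace WaveCoeff

variable (q : WaveCoeff T)

lemma leadingOp_eq : q.leadingOp = shiftOp q.V₁ q.hβ₁ 0 1 - shiftOp q.V₂ q.hβ₂ 0 1 := by
  refine ContinuousLinearMap.ext fun h => PC.ext fun t => ?_
  have h1 : (1 : ℝ) ∈ Icc (0 : ℝ) 1 := by simp
  change ev (transport q.V₁ q.hβ₁ h) 1 t - ev (transport q.V₂ q.hβ₂ h) 1 t = _
  rw [ev_transport _ _ _ h1, ev_transport _ _ _ h1]
  rfl

/-- Without resonance along the broken characteristics the leading part is invertible. -/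
lemma isUnit_leadingOp
    (h : (∀ t, q.V₁.cocycle q.β₁ 0 1 t * q.V₂.cocycle q.β₂ 1 0 (q.V₁.flow 0 1 t) ≠ 1) ∨
      ∀ t, q.V₂.cocycle q.β₂ 1 0 t * q.V₁.cocycle q.β₁ 0 1 (q.V₂.flow 1 0 t) ≠ 1) :
    IsUnit q.leadingOp := by
  have hB : IsUnit (shiftOp q.V₂ q.hβ₂ 0 1) :=
    isUnit_iff_exists.2 ⟨_, shiftOp_mul_shiftOp _ _ _ _, shiftOp_mul_shiftOp _ _ _ _⟩
  rw [leadingOp_eq]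
  rcases h with h | h
  · have h1 := ((isUnit_one_sub_shiftOp_mul q.V₁ q.V₂ q.hβ₁ q.hβ₂ 0 1 h).mul hB).neg
    rwa [sub_mul, mul_assoc, shiftOp_mul_shiftOp, mul_one, one_mul, neg_sub] at h1
  · have h1 := (hB.mul (isUnit_one_sub_shiftOp_mul q.V₂ q.V₁ q.hβ₂ q.hβ₁ 1 0 h)).neg
    rwa [mul_sub, ← mul_assoc, shiftOp_mul_shiftOp, mul_one, one_mul, neg_sub] at h1

end WaveCoeff

/-! ### The first-order system as a pair of equations along characteristics -/

lemma continuous_duhamel_integrand (V : PeriodicField T) {β m : ℝ → ℝ → ℝ} (hβ : IsPer T β)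
    (hm : IsPer T m) (u : CT T) (x t : ℝ) :
    Continuous fun ξ => V.cocycle β ξ x t * m ξ (V.flow ξ x t) * ev u ξ (V.flow ξ x t) :=
  ((V.continuous_cocycle_comp hβ.cont continuous_id continuous_const continuous_const).mul
    (V.continuous_along hm.cont x t)).mul (V.continuous_along (isPer_ev u).cont x t)

/-- A continuous function that is differentiable along the trajectories solves the equation in
integrated form. -/
lemma PeriodicField.isMild_of_hasDerivAt (V : PeriodicField T) {β s u : ℝ → ℝ → ℝ}
    (hβ : Continuous fun q : ℝ × ℝ => β q.1 q.2) (hs : Continuous fun q : ℝ × ℝ => s q.1 q.2)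
    (hu : Continuous fun q : ℝ × ℝ => u q.1 q.2)
    (h : ∀ x t, ∀ ξ ∈ Ioo (0 : ℝ) 1, HasDerivAt (fun η => u η (V.flow η x t))
      (s ξ (V.flow ξ x t) - β ξ (V.flow ξ x t) * u ξ (V.flow ξ x t)) ξ) : V.IsMild β s u 0 := by
  intro x hx t
  have hc : Continuous fun ξ => V.cocycle β ξ x t :=
    V.continuous_cocycle_comp hβ continuous_id continuous_const continuous_const
  have h1 := intervalIntegral.integral_eq_sub_of_hasDerivAt_of_le
    (f := fun ξ => V.cocycle β ξ x t * u ξ (V.flow ξ x t))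
    (f' := fun ξ => V.cocycle β ξ x t * s ξ (V.flow ξ x t)) hx.1
    (hc.mul (V.continuous_along hu x t)).continuousOn
    (fun ξ hξ => ((V.cocycle_hasDerivAt hβ ξ x t).mul
      (h x t ξ ⟨hξ.1, hξ.2.trans_le hx.2⟩)).congr_deriv (by ring))
    ((hc.mul (V.continuous_along hs x t)).intervalIntegrable _ _)
  rw [h1]
  simp

namespace WaveCoeff

variable (q : WaveCoeff T)

/-- The function `w = G + J(u₁ - u₂)` in the strip, where `G` is the periodic primitive of `h`. -/
def wave (h : PC T) (u : CT T × CT T) (x t : ℝ) : ℝ := primFun h t + ev (q.J (u.1 - u.2)) x t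

/-- The right-hand side of the equation for `u₁` along the first characteristics. -/
def src₁ (h : PC T) (f : CT T) (u : CT T × CT T) (x t : ℝ) : ℝ :=
  q.V₁.F x t * (ev f x t - q.b₁₂ x t * ev u.2 x t - q.a₃ x t * q.wave h u x t)

/-- The right-hand side of the equation for `u₂` along the second characteristics. -/
def src₂ (h : PC T) (f : CT T) (u : CT T × CT T) (x t : ℝ) : ℝ :=
  q.V₂.F x t * (ev f x t - q.b₂₁ x t * ev u.1 x t - q.a₃ x t * q.wave h u x t)

lemma isPer_wave (h : PC T) (u : CT T × CT T) : IsPer T (q.wave h u) :=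
  IsPer.add ⟨(continuous_primFun h).comp continuous_snd, fun _ t => primFun_per h t⟩ (isPer_ev _)

lemma isPer_src₁ (h : PC T) (f : CT T) (u : CT T × CT T) : IsPer T (q.src₁ h f u) :=
  q.V₁.isPer.mul (((isPer_ev f).sub (q.hb₁₂.mul (isPer_ev _))).sub (q.ha₃.mul (q.isPer_wave h u)))

lemma isPer_src₂ (h : PC T) (f : CT T) (u : CT T × CT T) : IsPer T (q.src₂ h f u) :=
  q.V₂.isPer.mul (((isPer_ev f).sub (q.hb₂₁.mul (isPer_ev _))).sub (q.ha₃.mul (q.isPer_wave h u)))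

lemma integral_src (V : PeriodicField T) {β b : ℝ → ℝ → ℝ} (hβ : IsPer T β) (hb : IsPer T b)
    (h : PC T) (f v : CT T) (u : CT T × CT T) {x : ℝ} (hx : x ∈ Icc (0 : ℝ) 1) (t : ℝ) :
    ∫ ξ in (0 : ℝ)..x, V.cocycle β ξ x t * (V.F ξ (V.flow ξ x t) *
      (ev f ξ (V.flow ξ x t) - b ξ (V.flow ξ x t) * ev v ξ (V.flow ξ x t) -
        q.a₃ ξ (V.flow ξ x t) * q.wave h u ξ (V.flow ξ x t))) =
    ev (duhamel V hβ (V.isPer.mul q.ha₃).neg (extend T (prim T h))) x t +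
      ev (duhamel V hβ V.isPer f) x t + (ev (duhamel V hβ (V.isPer.mul hb).neg v) x t +
      ev (duhamel V hβ (V.isPer.mul q.ha₃).neg (q.J (u.1 - u.2))) x t) := by
  have hi : ∀ (m : ℝ → ℝ → ℝ) (hm : IsPer T m) (u : CT T), IntervalIntegrable (fun ξ =>
      V.cocycle β ξ x t * m ξ (V.flow ξ x t) * ev u ξ (V.flow ξ x t)) volume 0 x := fun m hm u =>
    (continuous_duhamel_integrand V hβ hm u x t).intervalIntegrable _ _
  have i₁ := hi _ (V.isPer.mul q.ha₃).neg (extend T (prim T h))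
  have i₂ := hi _ V.isPer f
  have i₃ := hi _ (V.isPer.mul hb).neg v
  have i₄ := hi _ (V.isPer.mul q.ha₃).neg (q.J (u.1 - u.2))
  rw [ev_duhamel _ _ _ _ hx, ev_duhamel _ _ _ _ hx, ev_duhamel _ _ _ _ hx, ev_duhamel _ _ _ _ hx,
    ← intervalIntegral.integral_add i₁ i₂, ← intervalIntegral.integral_add i₃ i₄,
    ← intervalIntegral.integral_add (i₁.add i₂) (i₃.add i₄)]
  refine intervalIntegral.integral_congr fun ξ hξ => ?_
  rw [uIcc_of_le hx.1] at hξ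
  simp only [ev_extend (T := T) _ (⟨hξ.1, hξ.2.trans hx.2⟩ : ξ ∈ Icc (0 : ℝ) 1), prim_apply, wave]
  ring

/-- The system `u = data h + source f + volterra u` consists of the boundary conditions at `x = 0`
and of the equations along the characteristics. -/
lemma system_iff (h : PC T) (f : CT T) (u : CT T × CT T) :
    u = q.data h + q.source f + q.volterra u ↔
      ((∀ t : ℝ, ev u.1 0 t = h (t : AddCircle T) + q.lower₁ h (t : AddCircle T)) ∧
        q.V₁.IsMild q.β₁ (q.src₁ h f u) (ev u.1) 0) ∧
      (∀ t : ℝ, ev u.2 0 t = h (t : AddCircle T) + q.lower₂ h (t : AddCircle T)) ∧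
        q.V₂.IsMild q.β₂ (q.src₂ h f u) (ev u.2) 0 := by
  have key : ∀ (V : PeriodicField T) (β s : ℝ → ℝ → ℝ) (hβ : IsPer T β) (v w : CT T) (φ : PC T),
      (∀ x ∈ Icc (0 : ℝ) 1, ∀ t, ev w x t =
        ∫ ξ in (0 : ℝ)..x, V.cocycle β ξ x t * s ξ (V.flow ξ x t)) →
      (v = transport V hβ φ + w ↔
        (∀ t : ℝ, ev v 0 t = φ (t : AddCircle T)) ∧ V.IsMild β s (ev v) 0) := by
    intro V β s hβ v w φ hw
    have h0 : (0 : ℝ) ∈ Icc (0 : ℝ) 1 := by simp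
    constructor
    · intro hv
      have hv0 : ∀ t : ℝ, ev v 0 t = φ (t : AddCircle T) := fun t => by
        rw [hv, ev_add, ev_transport _ _ _ h0, hw 0 h0]
        simp
      refine ⟨hv0, fun x hx t => ?_⟩
      rw [hv0, ← ev_transport V hβ φ hx, ← hw x hx, ← ev_add, ← hv]
    · rintro ⟨hv0, hm⟩
      refine CT.ext_ev fun x hx t => ?_
      rw [hm x hx t, ev_add, ev_transport _ _ _ hx, hv0, hw x hx]
  have k₁ := key q.V₁ q.β₁ (q.src₁ h f u) q.hβ₁ u.1
    (duhamel q.V₁ q.hβ₁ (q.V₁.isPer.mul q.ha₃).neg (extend T (prim T h)) +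
      duhamel q.V₁ q.hβ₁ q.V₁.isPer f + (duhamel q.V₁ q.hβ₁ (q.V₁.isPer.mul q.hb₁₂).neg u.2 +
      duhamel q.V₁ q.hβ₁ (q.V₁.isPer.mul q.ha₃).neg (q.J (u.1 - u.2)))) (h + q.lower₁ h)
    (fun x hx t => (q.integral_src q.V₁ q.hβ₁ q.hb₁₂ h f u.2 u hx t).symm)
  have k₂ := key q.V₂ q.β₂ (q.src₂ h f u) q.hβ₂ u.2
    (duhamel q.V₂ q.hβ₂ (q.V₂.isPer.mul q.ha₃).neg (extend T (prim T h)) +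
      duhamel q.V₂ q.hβ₂ q.V₂.isPer f + (duhamel q.V₂ q.hβ₂ (q.V₂.isPer.mul q.hb₂₁).neg u.1 +
      duhamel q.V₂ q.hβ₂ (q.V₂.isPer.mul q.ha₃).neg (q.J (u.1 - u.2)))) (h + q.lower₂ h)
    (fun x hx t => (q.integral_src q.V₂ q.hβ₂ q.hb₂₁ h f u.1 u hx t).symm)
  simp only [ContinuousMap.add_apply] at k₁ k₂
  rw [← k₁, ← k₂, Prod.ext_iff]
  simp only [data, source, volterra_apply, Prod.fst_add, Prod.snd_add,
    ContinuousLinearMap.prod_apply, _root_.add_apply, ContinuousLinearMap.comp_apply,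
    one_apply_eq_self, map_add, add_assoc]

end WaveCoeff

/-! ### Density of the range -/

/-- Strict differentiability from continuous partial derivatives. -/
lemma hasStrictFDerivAt_of_partials {g gX gT : ℝ → ℝ → ℝ} {x : ℝ} (t : ℝ)
    (hX : ∀ᶠ z in 𝓝 x, ∀ t, HasDerivAt (fun y => g y t) (gX z t) z)
    (hT' : ∀ᶠ z in 𝓝 x, ∀ t, HasDerivAt (g z) (gT z t) t)
    (cX : Continuous fun q : ℝ × ℝ => gX q.1 q.2) (cT : Continuous fun q : ℝ × ℝ => gT q.1 q.2) :
    HasStrictFDerivAt (fun q : ℝ × ℝ => g q.1 q.2)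
      ((ContinuousLinearMap.toSpanSingleton ℝ (gX x t)).coprod
        (ContinuousLinearMap.toSpanSingleton ℝ (gT x t))) (x, t) := by
  have h1 : ∀ᶠ v : ℝ × ℝ in 𝓝 (x, t), HasFDerivAt (fun z => g z v.2)
      (ContinuousLinearMap.toSpanSingleton ℝ (gX v.1 v.2)) v.1 :=
    (continuous_fst.tendsto (x, t)).eventually hX |>.mono fun v hv => hv v.2
  have h2 : ∀ᶠ v : ℝ × ℝ in 𝓝 (x, t), HasFDerivAt (fun z => g v.1 z)
      (ContinuousLinearMap.toSpanSingleton ℝ (gT v.1 v.2)) v.2 :=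
    (continuous_fst.tendsto (x, t)).eventually hT' |>.mono fun v hv => hv v.2
  have cl : Continuous fun c : ℝ => (ContinuousLinearMap.toSpanSingleton ℝ c : ℝ →L[ℝ] ℝ) :=
    (ContinuousLinearMap.toSpanSingletonCLE (𝕜 := ℝ) (E := ℝ)).continuous
  exact hasStrictFDerivAt_uncurry_coprod (𝕜 := ℝ) (u := (x, t)) (f := g)
    (f₁ := fun x t => ContinuousLinearMap.toSpanSingleton ℝ (gX x t))
    (f₂ := fun x t => ContinuousLinearMap.toSpanSingleton ℝ (gT x t)) h1 h2
    (cl.comp cX).continuousAt (cl.comp cT).continuousAt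

/-- The chain rule along a curve, from continuous partial derivatives. -/
lemma hasDerivAt_along_curve {g gX gT : ℝ → ℝ → ℝ} {y : ℝ → ℝ} {y' ξ : ℝ}
    (hX : ∀ᶠ x in 𝓝 ξ, ∀ t, HasDerivAt (fun z => g z t) (gX x t) x)
    (hT' : ∀ᶠ x in 𝓝 ξ, ∀ t, HasDerivAt (g x) (gT x t) t)
    (cX : Continuous fun q : ℝ × ℝ => gX q.1 q.2) (cT : Continuous fun q : ℝ × ℝ => gT q.1 q.2)
    (hy : HasDerivAt y y' ξ) :
    HasDerivAt (fun η => g η (y η)) (gX ξ (y ξ) + gT ξ (y ξ) * y') ξ := by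
  have h4 := (hasStrictFDerivAt_of_partials (y ξ) hX hT' cX cT).hasFDerivAt.comp_hasDerivAt ξ
    (f := fun η => (η, y η)) ((hasDerivAt_id ξ).prodMk hy)
  refine h4.congr_deriv ?_
  simp [mul_comm]

namespace WaveCoeff

variable (q : WaveCoeff T)

lemma hasDerivAt_a_along {ξ : ℝ} (hξ : ξ ∈ Ioo (0 : ℝ) 1) {y : ℝ → ℝ} {y' : ℝ}
    (hy : HasDerivAt y y' ξ) :
    HasDerivAt (fun η => q.a η (y η)) (q.aX ξ (y ξ) + q.aT ξ (y ξ) * y') ξ :=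
  hasDerivAt_along_curve (mem_of_superset (Ioo_mem_nhds hξ.1 hξ.2) fun x hx => q.hasDerivX x hx)
    (Eventually.of_forall q.hasDeriv) q.haX.cont q.haT.cont hy

/-- The smooth function `w(x, t) = (x³ - x²) γ(t)` vanishes to second order at `x = 0`; at `x = 1`
it vanishes and its derivative is `γ`. Hence it solves the problem with `h = 0` and the right-hand
side given by the differential equation, and the residual of the boundary condition at `x = 1` is
`2 a γ`. -/
lemma two_mul_a_mem_range_circleSource {γ γ' γ'' : ℝ → ℝ} (h1 : ∀ t, HasDerivAt γ (γ' t) t)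
    (h2 : ∀ t, HasDerivAt γ' (γ'' t) t) (hc : Continuous γ'') (p0 : ∀ t, γ (t + T) = γ t)
    (p1 : ∀ t, γ' (t + T) = γ' t) (p2 : ∀ t, γ'' (t + T) = γ'' t) (φ : PC T)
    (hφ : ∀ t : ℝ, φ (t : AddCircle T) = 2 * q.a 1 t * γ t) :
    ∃ f, q.circleSource f = φ := by
  have c0 : Continuous γ := continuous_iff_continuousAt.2 fun t => (h1 t).continuousAt
  have c1 : Continuous γ' := continuous_iff_continuousAt.2 fun t => (h2 t).continuousAt
  have g0 : IsPer T fun _ t => γ t := ⟨c0.comp continuous_snd, fun _ => p0⟩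
  have g1 : IsPer T fun _ t => γ' t := ⟨c1.comp continuous_snd, fun _ => p1⟩
  have g2 : IsPer T fun _ t => γ'' t := ⟨hc.comp continuous_snd, fun _ => p2⟩
  have k0 : IsPer T fun x _ => x ^ 3 - x ^ 2 := ⟨by fun_prop, fun _ _ => rfl⟩
  have k1 : IsPer T fun x _ => 3 * x ^ 2 - 2 * x := ⟨by fun_prop, fun _ _ => rfl⟩
  have k2 : IsPer T fun x _ => 6 * x - 2 := ⟨by fun_prop, fun _ _ => rfl⟩
  have hu₁ := (k0.mul g1).add ((q.ha.mul k1).mul g0)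
  have hu₂ := (k0.mul g1).sub ((q.ha.mul k1).mul g0)
  have hf := (((k0.mul g2).sub (((q.ha.mul q.ha).mul k2).mul g0)).add
    ((q.ha₁.mul k0).mul g1)).add (((q.ha₂.mul k1).mul g0).add ((q.ha₃.mul k0).mul g0))
  set u : CT T × CT T := (mkCT hu₁, mkCT hu₂) with hu
  have h0 : (0 : ℝ) ∈ Icc (0 : ℝ) 1 := by simp
  have h1' : (1 : ℝ) ∈ Icc (0 : ℝ) 1 := by simp
  have hJ : ∀ x ∈ Icc (0 : ℝ) 1, ∀ t, ev (q.J (u.1 - u.2)) x t = (x ^ 3 - x ^ 2) * γ t := by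
    intro x hx t
    rw [q.ev_J _ hx, intervalIntegral.integral_eq_sub_of_hasDerivAt_of_le
      (f := fun x => (x ^ 3 - x ^ 2) * γ t) hx.1 (by fun_prop)]
    · ring
    · intro ξ hξ
      have hξ' : ξ ∈ Icc (0 : ℝ) 1 := ⟨hξ.1.le, hξ.2.le.trans hx.2⟩
      refine ((((hasDerivAt_id ξ).pow 3).sub ((hasDerivAt_id ξ).pow 2)).mul_const
        (γ t)).congr_deriv ?_
      rw [ev_sub, hu, ev_mkCT _ hξ', ev_mkCT _ hξ']
      have := q.a_ne ξ t
      simp only [id]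
      field_simp
      ring
    · refine (Continuous.mul ?_ ((isPer_ev _).comp continuous_id continuous_const)).intervalIntegrable _ _
      exact continuous_const.div (continuous_const.mul (q.ha.comp continuous_id continuous_const))
        fun _ => mul_ne_zero two_ne_zero (q.a_ne _ _)
  have hw : ∀ x ∈ Icc (0 : ℝ) 1, ∀ t, q.wave 0 u x t = (x ^ 3 - x ^ 2) * γ t := fun x hx t => by
    have : primFun (0 : PC T) t = 0 := by rw [← prim_apply, map_zero]; rfl
    rw [wave, hJ x hx, this, zero_add]
  have hκ : ∀ ξ : ℝ, HasDerivAt (fun x : ℝ => x ^ 3 - x ^ 2) (3 * ξ ^ 2 - 2 * ξ) ξ := fun ξ =>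
    (((hasDerivAt_id ξ).pow 3).sub ((hasDerivAt_id ξ).pow 2)).congr_deriv (by simp)
  have hκ' : ∀ ξ : ℝ, HasDerivAt (fun x : ℝ => 3 * x ^ 2 - 2 * x) (6 * ξ - 2) ξ := fun ξ =>
    ((((hasDerivAt_id ξ).pow 2).const_mul 3).sub ((hasDerivAt_id ξ).const_mul 2)).congr_deriv
      (by simp; ring)
  have hsys : u = q.data 0 + q.source (mkCT hf) + q.volterra u := by
    refine (q.system_iff 0 (mkCT hf) u).2 ⟨⟨fun t => ?_, ?_⟩, fun t => ?_, ?_⟩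
    · rw [hu, ev_mkCT _ h0, map_zero]; simp
    · refine q.V₁.isMild_of_hasDerivAt q.hβ₁.cont (q.isPer_src₁ _ _ _).cont (isPer_ev _).cont
        fun x t ξ hξ => ?_
      have hξ' := Ioo_subset_Icc_self hξ
      have hy := q.V₁.flow_hasDerivAt ξ x t
      have hd := ((hκ ξ).mul ((h2 _).comp ξ hy)).add
        (((q.hasDerivAt_a_along hξ hy).mul (hκ' ξ)).mul ((h1 _).comp ξ hy))
      refine (hd.congr_of_eventuallyEq ?_).congr_deriv ?_
      · filter_upwards [Icc_mem_nhds hξ.1 hξ.2] with η hη using ev_mkCT hu₁ hη _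
      · rw [src₁, hw ξ hξ', ev_mkCT _ hξ', hu, ev_mkCT _ hξ', ev_mkCT _ hξ', β₁, b₁₁, b₁₂]
        have := q.a_ne ξ (q.V₁.flow ξ x t)
        have hF : q.V₁.F ξ (q.V₁.flow ξ x t) = -1 / q.a ξ (q.V₁.flow ξ x t) := rfl
        rw [hF]
        simp only [Function.comp, Pi.mul_apply]
        field_simp
        ring
    · rw [hu, ev_mkCT _ h0, map_zero]; simp
    · refine q.V₂.isMild_of_hasDerivAt q.hβ₂.cont (q.isPer_src₂ _ _ _).cont (isPer_ev _).cont
        fun x t ξ hξ => ?_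
      have hξ' := Ioo_subset_Icc_self hξ
      have hy := q.V₂.flow_hasDerivAt ξ x t
      have hd := ((hκ ξ).mul ((h2 _).comp ξ hy)).sub
        (((q.hasDerivAt_a_along hξ hy).mul (hκ' ξ)).mul ((h1 _).comp ξ hy))
      refine (hd.congr_of_eventuallyEq ?_).congr_deriv ?_
      · filter_upwards [Icc_mem_nhds hξ.1 hξ.2] with η hη using ev_mkCT hu₂ hη _
      · rw [src₂, hw ξ hξ', ev_mkCT _ hξ', hu, ev_mkCT _ hξ', ev_mkCT _ hξ', β₂, b₂₁, b₂₂]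
        have := q.a_ne ξ (q.V₂.flow ξ x t)
        have hF : q.V₂.F ξ (q.V₂.flow ξ x t) = 1 / q.a ξ (q.V₂.flow ξ x t) := rfl
        rw [hF]
        simp only [Function.comp, Pi.mul_apply]
        field_simp
        ring
  rw [map_zero, zero_add, eq_resolvent_iff] at hsys
  refine ⟨mkCT hf, PC.ext fun t => ?_⟩
  rw [circleSource, ContinuousLinearMap.comp_apply, ContinuousLinearMap.comp_apply, ← hsys,
    residual_apply, hJ 1 h1', hu, ev_mkCT _ h1', ev_mkCT _ h1', hφ]
  ring

end WaveCoeff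

/-- The smooth periodic functions. -/
def smoothSubalgebra (T : ℝ) : Subalgebra ℝ (PC T) where
  carrier := {h | ContDiff ℝ 2 fun t : ℝ => h (t : AddCircle T)}
  mul_mem' h₁ h₂ := ContDiff.mul (𝕜 := ℝ) (n := 2) (mem_ofPred.1 h₁) (mem_ofPred.1 h₂)
  add_mem' h₁ h₂ := ContDiff.add (𝕜 := ℝ) (n := 2) (mem_ofPred.1 h₁) (mem_ofPred.1 h₂)
  algebraMap_mem' c := (contDiff_const (𝕜 := ℝ) (n := 2) (c := c) : ContDiff ℝ 2 fun _ : ℝ => c)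

lemma smoothSubalgebra_topologicalClosure : (smoothSubalgebra T).topologicalClosure = ⊤ := by
  refine ContinuousMap.subalgebra_topologicalClosure_eq_top_of_separatesPoints _ fun x y hxy => ?_
  have hne : (AddCircle.toCircle x : ℂ) ≠ AddCircle.toCircle y := fun h =>
    hxy (AddCircle.injective_toCircle hT.out.ne' (Subtype.ext h))
  have hs : ContDiff ℝ 2 fun t : ℝ => ((AddCircle.toCircle (t : AddCircle T) : Circle) : ℂ) := by
    simp only [AddCircle.toCircle_apply_mk, Circle.coe_exp]
    exact Complex.contDiff_exp.comp
      ((Complex.ofRealCLM.contDiff.comp (contDiff_const.mul contDiff_id)).mul contDiff_const)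
  by_contra hcon
  push Not at hcon
  refine hne (Complex.ext ?_ ?_)
  · exact hcon _ ⟨⟨fun z => (AddCircle.toCircle z : ℂ).re, by fun_prop⟩,
      Complex.reCLM.contDiff.comp hs, rfl⟩
  · exact hcon _ ⟨⟨fun z => (AddCircle.toCircle z : ℂ).im, by fun_prop⟩,
      Complex.imCLM.contDiff.comp hs, rfl⟩

omit hT in
lemma deriv_add_period {g : ℝ → ℝ} (hg : ∀ t, g (t + T) = g t) (t : ℝ) :
    deriv g (t + T) = deriv g t := by
  rw [← deriv_comp_add_const, funext hg]

namespace WaveCoeff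

variable (q : WaveCoeff T)

lemma denseRange_circleSource : DenseRange q.circleSource := by
  have hA0 : ∀ z, mkPC (T := T) (g := fun t => 2 * q.a 1 t)
      (q.h_two_a.comp continuous_const continuous_id) (fun t => q.h_two_a.per 1 t) z ≠ 0 := by
    intro z
    induction z using QuotientAddGroup.induction_on with
    | H t => exact q.two_a_ne 1 t
  set A : PC T := mkPC (g := fun t => 2 * q.a 1 t)
    (q.h_two_a.comp continuous_const continuous_id) fun t => q.h_two_a.per 1 t with hA
  have hsurj : Function.Surjective fun h : PC T => A * h := fun h =>
    ⟨⟨fun z => (A z)⁻¹ * h z, (A.continuous.inv₀ hA0).mul h.continuous⟩,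
      ContinuousMap.ext fun z => by
        simp only [ContinuousMap.mul_apply, ContinuousMap.coe_mk]
        rw [mul_inv_cancel_left₀ (hA0 z)]⟩
  have hdense : Dense (smoothSubalgebra T : Set (PC T)) := by
    rw [dense_iff_closure_eq, ← Subalgebra.topologicalClosure_coe,
      smoothSubalgebra_topologicalClosure]
    rfl
  have h1 := hsurj.denseRange.dense_image (continuous_const.mul continuous_id) hdense
  refine h1.mono ?_
  rintro _ ⟨h, hh, rfl⟩
  change ContDiff ℝ 2 fun t : ℝ => h (t : AddCircle T) at hh
  have hd : Differentiable ℝ fun t : ℝ => h (t : AddCircle T) := hh.differentiable (by norm_num)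
  have hh' : ContDiff ℝ 1 (deriv fun t : ℝ => h (t : AddCircle T)) :=
    (contDiff_succ_iff_deriv (n := 1).1 hh).2.2
  have hd' := hh'.differentiable (by norm_num)
  have p1 := deriv_add_period (g := fun t : ℝ => h (t : AddCircle T)) h.per
  exact q.two_mul_a_mem_range_circleSource (fun t => (hd t).hasDerivAt)
    (fun t => (hd' t).hasDerivAt) (hh'.continuous_deriv (by norm_num)) h.per p1
    (deriv_add_period p1) _ fun t => rfl

end WaveCoeff

/-! ### Regularity -/

lemma hasDerivAt_integral_of_continuous {K K' : ℝ → ℝ → ℝ}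
    (hK : Continuous fun q : ℝ × ℝ => K q.1 q.2) (hK' : Continuous fun q : ℝ × ℝ => K' q.1 q.2)
    {x : ℝ} (hd : ∀ᶠ z in 𝓝 x, ∀ η, HasDerivAt (fun y => K y η) (K' z η) z) (a b : ℝ) :
    HasDerivAt (fun z => ∫ η in a..b, K z η) (∫ η in a..b, K' x η) x := by
  obtain ⟨δ, hδ, hball⟩ := Metric.eventually_nhds_iff_ball.1 hd
  obtain ⟨M, hM⟩ := ((isCompact_closedBall x δ).prod (isCompact_uIcc (a := a)
    (b := b))).exists_bound_of_continuousOn hK'.continuousOn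
  have hs : ∀ z, Continuous (K z) := fun z => hK.comp (by fun_prop : Continuous fun η => (z, η))
  exact (intervalIntegral.hasDerivAt_integral_of_dominated_loc_of_deriv_le (bound := fun _ => M)
    (F := K) (F' := K') (Metric.ball_mem_nhds x hδ)
    (Eventually.of_forall fun z => (hs z).aestronglyMeasurable)
    ((hs x).intervalIntegrable _ _)
    (hK'.comp (by fun_prop : Continuous fun η => (x, η))).aestronglyMeasurable
    (ae_of_all _ fun η hη z hz => hM (z, η) ⟨Metric.ball_subset_closedBall hz,
      uIoc_subset_uIcc hη⟩)
    (by simp) (ae_of_all _ fun η _ z hz => hball z hz η)).2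

/-- Differentiation of an integral with moving end points. -/
lemma hasDerivAt_integral_moving {K K' : ℝ → ℝ → ℝ}
    (hK : Continuous fun q : ℝ × ℝ => K q.1 q.2) (hK' : Continuous fun q : ℝ × ℝ => K' q.1 q.2)
    {x : ℝ} (hd : ∀ᶠ z in 𝓝 x, ∀ η, HasDerivAt (fun y => K y η) (K' z η) z)
    {l r : ℝ → ℝ} {l' r' : ℝ} (hl : HasDerivAt l l' x) (hr : HasDerivAt r r' x) :
    HasDerivAt (fun z => ∫ η in l z..r z, K z η)
      ((∫ η in l x..r x, K' x η) + (K x (r x) * r' - K x (l x) * l')) x := by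
  have hs : ∀ z, Continuous (K z) := fun z => hK.comp (by fun_prop : Continuous fun η => (z, η))
  have hs' : ∀ z, Continuous (K' z) := fun z => hK'.comp (by fun_prop : Continuous fun η => (z, η))
  have hcurve : ∀ {y : ℝ → ℝ} {y' : ℝ}, HasDerivAt y y' x →
      HasDerivAt (fun z => ∫ η in (0 : ℝ)..y z, K z η)
        ((∫ η in (0 : ℝ)..y x, K' x η) + K x (y x) * y') x := fun {y y'} hy => by
    refine hasDerivAt_along_curve (g := fun z s => ∫ η in (0 : ℝ)..s, K z η)
      (gX := fun z s => ∫ η in (0 : ℝ)..s, K' z η) (gT := K) ?_ ?_ ?_ hK hy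
    · filter_upwards [hd.eventually_nhds] with z hz s
        using hasDerivAt_integral_of_continuous hK hK' hz 0 s
    · refine Eventually.of_forall fun z s => ?_
      exact intervalIntegral.integral_hasDerivAt_right ((hs z).intervalIntegrable _ _)
        (hs z).stronglyMeasurable.stronglyMeasurableAtFilter (hs z).continuousAt
    · exact continuous_integral_param (α := ℝ × ℝ) (f := fun q η => K' q.1 η)
        (hK'.comp (by fun_prop : Continuous fun q : (ℝ × ℝ) × ℝ => (q.1.1, q.2)))
        continuous_const continuous_snd
  have h1 := (hcurve hr).sub (hcurve hl)
  refine (h1.congr_of_eventuallyEq (Eventually.of_forall fun z => ?_)).congr_deriv ?_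
  · exact (intervalIntegral.integral_interval_sub_left ((hs z).intervalIntegrable _ _)
      ((hs z).intervalIntegrable _ _)).symm
  · rw [← intervalIntegral.integral_interval_sub_left ((hs' x).intervalIntegrable 0 (r x))
      ((hs' x).intervalIntegrable 0 (l x))]
    ring

namespace PeriodicField

variable (V : PeriodicField T)

lemma integral_comp_flow {g : ℝ → ℝ} (hg : Continuous g) (x t₀ t₁ : ℝ) :
    ∫ r in V.flow 0 x t₀..V.flow 0 x t₁, g (V.flow x 0 r) * V.dflow x 0 r =
      ∫ t in t₀..t₁, g t := by
  have h := intervalIntegral.integral_comp_mul_deriv (a := V.flow 0 x t₀) (b := V.flow 0 x t₁)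
    (f := fun r => V.flow x 0 r) (f' := fun r => V.dflow x 0 r) (g := g)
    (fun r _ => V.flow_hasDerivAt_init x 0 r)
    (V.continuous_dflow_comp continuous_const continuous_const continuous_id).continuousOn hg
  simpa using h

variable {V} {β s u : ℝ → ℝ → ℝ}

/-- The integral over a time interval of a mild solution is differentiable in `x`, although the
solution itself need not be: in the variables `(x, r)`, where `r` is the point where the trajectory
meets `x = 0`, only derivatives along trajectories occur. -/
lemma IsMild.hasDerivAt_integral (hβ : Continuous fun q : ℝ × ℝ => β q.1 q.2)
    (hs : Continuous fun q : ℝ × ℝ => s q.1 q.2) (hu : Continuous fun q : ℝ × ℝ => u q.1 q.2)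
    (h : V.IsMild β s u 0) {x : ℝ} (hx : x ∈ Ioo (0 : ℝ) 1) (t₀ t₁ : ℝ) :
    HasDerivAt (fun z => ∫ t in t₀..t₁, u z t)
      ((∫ t in t₀..t₁, (s x t - β x t * u x t + V.F' x t * u x t)) -
        (V.F x t₁ * u x t₁ - V.F x t₀ * u x t₀)) x := by
  have hfl : Continuous fun q : ℝ × ℝ => (q.1, V.flow q.1 0 q.2) :=
    continuous_fst.prodMk (V.continuous_flow_comp continuous_fst continuous_const continuous_snd)
  have hdf : Continuous fun q : ℝ × ℝ => V.dflow q.1 0 q.2 :=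
    V.continuous_dflow_comp continuous_fst continuous_const continuous_snd
  set G : ℝ → ℝ → ℝ := fun x t => s x t - β x t * u x t + V.F' x t * u x t with hG
  have hGc : Continuous fun q : ℝ × ℝ => G q.1 q.2 := (hs.sub (hβ.mul hu)).add (V.cont'.mul hu)
  have hd : ∀ᶠ z in 𝓝 x, ∀ r, HasDerivAt (fun y => u y (V.flow y 0 r) * V.dflow y 0 r)
      (G z (V.flow z 0 r) * V.dflow z 0 r) z := by
    filter_upwards [Ioo_mem_nhds hx.1 hx.2] with z hz r
    refine ((h.hasDerivAt hβ hs r hz).mul (V.cocycle_hasDerivAt V.cont' z 0 r)).congr_deriv ?_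
    simp only [hG, dflow]
    ring
  have hend : ∀ t, HasDerivAt (fun z => V.flow 0 z t) (V.dflow 0 x t * (0 - V.F x t)) x := fun t =>
    V.flow_hasDerivAt_base (s := fun _ => t) continuous_const (hasDerivAt_const x t) 0
  have h1 := hasDerivAt_integral_moving (K := fun z r => u z (V.flow z 0 r) * V.dflow z 0 r)
    (K' := fun z r => G z (V.flow z 0 r) * V.dflow z 0 r) ((hu.comp hfl).mul hdf)
    ((hGc.comp hfl).mul hdf) hd (hend t₀) (hend t₁)
  have huz : ∀ z, Continuous (u z) := fun z => hu.comp (by fun_prop : Continuous fun t => (z, t))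
  have hGz : Continuous (G x) := hGc.comp (by fun_prop : Continuous fun t => (x, t))
  rw [V.integral_comp_flow hGz] at h1
  simp only [V.integral_comp_flow (huz _)] at h1
  refine h1.congr_deriv ?_
  have h2 : ∀ t, V.dflow x 0 (V.flow 0 x t) * V.dflow 0 x t = 1 := fun t => by
    rw [dflow, dflow, V.cocycle_mul V.cont', V.cocycle_self]
  simp only [flow_flow, flow_self]
  linear_combination (-(u x t₁ * V.F x t₁)) * h2 t₁ + (u x t₀ * V.F x t₀) * h2 t₀

end PeriodicField

/-- A continuous function on the strip that has continuous partial derivatives in the interior,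
with continuous extensions to the closed strip, is continuously differentiable up to the
boundary. -/
lemma contDiffOn_of_partials {g gX gT : ℝ → ℝ → ℝ} (hg : Continuous fun q : ℝ × ℝ => g q.1 q.2)
    (cX : Continuous fun q : ℝ × ℝ => gX q.1 q.2) (cT : Continuous fun q : ℝ × ℝ => gT q.1 q.2)
    (hX : ∀ x ∈ Ioo (0 : ℝ) 1, ∀ t, HasDerivAt (fun y => g y t) (gX x t) x)
    (hT' : ∀ x ∈ Ioo (0 : ℝ) 1, ∀ t, HasDerivAt (g x) (gT x t) t) :
    ContDiffOn ℝ 1 (fun q : ℝ × ℝ => g q.1 q.2) (Icc 0 1 ×ˢ univ) := by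
  set L : ℝ × ℝ → (ℝ × ℝ →L[ℝ] ℝ) := fun q =>
    (ContinuousLinearMap.toSpanSingleton ℝ (gX q.1 q.2)).coprod
      (ContinuousLinearMap.toSpanSingleton ℝ (gT q.1 q.2)) with hL
  have hLc : Continuous L := by
    have : L = fun q => gX q.1 q.2 • ContinuousLinearMap.fst ℝ ℝ ℝ +
        gT q.1 q.2 • ContinuousLinearMap.snd ℝ ℝ ℝ := by
      funext q
      refine ContinuousLinearMap.ext fun v => ?_
      simp [hL, mul_comm]
    rw [this]
    exact (cX.smul continuous_const).add (cT.smul continuous_const)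
  have hopen : IsOpen (Ioo (0 : ℝ) 1 ×ˢ (univ : Set ℝ)) := isOpen_Ioo.prod isOpen_univ
  have hcl : closure (Ioo (0 : ℝ) 1 ×ˢ (univ : Set ℝ)) = Icc 0 1 ×ˢ univ := by
    rw [closure_prod_eq, closure_Ioo zero_ne_one, closure_univ]
  have hint : ∀ q ∈ Ioo (0 : ℝ) 1 ×ˢ (univ : Set ℝ),
      HasFDerivAt (fun q : ℝ × ℝ => g q.1 q.2) (L q) q := fun q hq =>
    (hasStrictFDerivAt_of_partials q.2
      (mem_of_superset (Ioo_mem_nhds hq.1.1 hq.1.2) fun x hx => hX x hx)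
      (mem_of_superset (Ioo_mem_nhds hq.1.1 hq.1.2) fun x hx => hT' x hx) cX cT).hasFDerivAt
  have hcld : ∀ q, HasFDerivWithinAt (fun q : ℝ × ℝ => g q.1 q.2) (L q)
      (Icc (0 : ℝ) 1 ×ˢ (univ : Set ℝ)) q := fun q => by
    rw [← hcl]
    refine hasFDerivWithinAt_closure_of_tendsto_fderiv
      (fun y hy => (hint y hy).differentiableAt.differentiableWithinAt)
      ((convex_Ioo _ _).prod convex_univ) hopen (fun _ _ => hg.continuousWithinAt) ?_
    refine ((hLc.tendsto q).mono_left nhdsWithin_le_nhds).congr' ?_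
    filter_upwards [self_mem_nhdsWithin] with y hy using (hint y hy).fderiv.symm
  have hud : UniqueDiffOn ℝ (Icc (0 : ℝ) 1 ×ˢ (univ : Set ℝ)) :=
    (uniqueDiffOn_Icc zero_lt_one).prod uniqueDiffOn_univ
  rw [show (1 : WithTop ℕ∞) = 0 + 1 by norm_num, contDiffOn_succ_iff_fderivWithin hud,
    contDiffOn_zero]
  refine ⟨fun q _ => (hcld q).differentiableWithinAt, by simp, hLc.continuousOn.congr fun q hq => ?_⟩
  exact (hcld q).fderivWithin (hud q hq)

namespace WaveCoeff

variable (q : WaveCoeff T)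

lemma wave_hasDerivAt_x (h : PC T) (u : CT T × CT T) {x : ℝ} (hx : x ∈ Ioo (0 : ℝ) 1) (t : ℝ) :
    HasDerivAt (fun y => q.wave h u y t) (1 / (2 * q.a x t) * (ev u.1 x t - ev u.2 x t)) x := by
  have hc : Continuous fun ξ => 1 / (2 * q.a ξ t) * ev (u.1 - u.2 : CT T) ξ t :=
    (continuous_const.div (continuous_const.mul (q.ha.comp continuous_id continuous_const))
      fun _ => mul_ne_zero two_ne_zero (q.a_ne _ _)).mul
      ((isPer_ev _).comp continuous_id continuous_const)
  have h1 := (intervalIntegral.integral_hasDerivAt_right (hc.intervalIntegrable 0 x)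
    hc.stronglyMeasurable.stronglyMeasurableAtFilter hc.continuousAt).const_add (primFun h t)
  refine h1.congr_of_eventuallyEq ?_
  filter_upwards [Icc_mem_nhds hx.1 hx.2] with y hy
  rw [wave, q.ev_J _ hy]

/-- The increments of `w` in time are the integrals of `(u₁ + u₂) / 2`: this holds at `x = 0`, and
both sides have the same derivative in `x`. -/
lemma wave_sub_eq_integral {h : PC T} {f : CT T} {u : CT T × CT T}
    (hu : u = q.data h + q.source f + q.volterra u) {x : ℝ} (hx : x ∈ Icc (0 : ℝ) 1) (t₀ t₁ : ℝ) :
    q.wave h u x t₁ - q.wave h u x t₀ =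
      ((∫ t in t₀..t₁, ev u.1 x t) + ∫ t in t₀..t₁, ev u.2 x t) / 2 := by
  obtain ⟨⟨hb₁, hm₁⟩, hb₂, hm₂⟩ := (q.system_iff h f u).1 hu
  set D : ℝ → ℝ := fun x => q.wave h u x t₁ - q.wave h u x t₀ -
    ((∫ t in t₀..t₁, ev u.1 x t) + ∫ t in t₀..t₁, ev u.2 x t) / 2 with hD
  have hw := (q.isPer_wave h u)
  have hi : ∀ v : CT T, Continuous fun x => ∫ t in t₀..t₁, ev v x t := fun v =>
    continuous_integral_param (isPer_ev v).cont continuous_const continuous_const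
  have hint : ∀ (v : CT T) (x : ℝ) {m : ℝ → ℝ → ℝ} (_ : IsPer T m), IntervalIntegrable
      (fun t => m x t * ev v x t) volume t₀ t₁ := fun v x m hm =>
    ((hm.mul (isPer_ev v)).comp continuous_const continuous_id).intervalIntegrable _ _
  have hDc : Continuous D :=
    ((hw.comp continuous_id continuous_const).sub (hw.comp continuous_id continuous_const)).sub
      (((hi _).add (hi _)).div_const 2)
  have hD' : ∀ z ∈ Ioo (0 : ℝ) x, HasDerivAt D 0 z := by
    intro z hz
    have hz' : z ∈ Ioo (0 : ℝ) 1 := ⟨hz.1, hz.2.trans_le hx.2⟩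
    have d₁ := hm₁.hasDerivAt_integral q.hβ₁.cont (q.isPer_src₁ h f u).cont (isPer_ev _).cont
      hz' t₀ t₁
    have d₂ := hm₂.hasDerivAt_integral q.hβ₂.cont (q.isPer_src₂ h f u).cont (isPer_ev _).cont
      hz' t₀ t₁
    refine (((q.wave_hasDerivAt_x h u hz' t₁).sub (q.wave_hasDerivAt_x h u hz' t₀)).sub
      ((d₁.add d₂).div_const 2)).congr_deriv ?_
    have hI : (∫ t in t₀..t₁, (q.src₁ h f u z t - q.β₁ z t * ev u.1 z t +
        q.V₁.F' z t * ev u.1 z t)) + ∫ t in t₀..t₁, (q.src₂ h f u z t - q.β₂ z t * ev u.2 z t +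
        q.V₂.F' z t * ev u.2 z t) = 0 := by
      have hc₁ : Continuous fun t => q.src₁ h f u z t - q.β₁ z t * ev u.1 z t +
          q.V₁.F' z t * ev u.1 z t :=
        (((q.isPer_src₁ h f u).sub (q.hβ₁.mul (isPer_ev _))).add
          (IsPer.mul ⟨q.V₁.cont', q.V₁.per'⟩ (isPer_ev _))).comp continuous_const continuous_id
      have hc₂ : Continuous fun t => q.src₂ h f u z t - q.β₂ z t * ev u.2 z t +
          q.V₂.F' z t * ev u.2 z t :=
        (((q.isPer_src₂ h f u).sub (q.hβ₂.mul (isPer_ev _))).add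
          (IsPer.mul ⟨q.V₂.cont', q.V₂.per'⟩ (isPer_ev _))).comp continuous_const continuous_id
      rw [← intervalIntegral.integral_add (hc₁.intervalIntegrable _ _)
        (hc₂.intervalIntegrable _ _)]
      refine (intervalIntegral.integral_congr fun t _ => ?_).trans intervalIntegral.integral_zero
      have := q.a_ne z t
      simp only [src₁, src₂, β₁, β₂, b₁₁, b₁₂, b₂₁, b₂₂, field]
      field_simp
      ring
    rw [sub_add_sub_comm, hI]
    have := q.a_ne z t₀
    have := q.a_ne z t₁
    simp only [field]
    field_simp
    ring
  have h0 : D 0 = 0 := by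
    have e : ∀ t, q.wave h u 0 t = primFun h t := fun t => by
      rw [wave, q.ev_J _ (by simp), intervalIntegral.integral_same, add_zero]
    have i : ∀ v : CT T, IntervalIntegrable (fun t => ev v 0 t) volume t₀ t₁ := fun v =>
      ((isPer_ev v).comp continuous_const continuous_id).intervalIntegrable _ _
    simp only [hD, e]
    rw [primFun_sub, ← intervalIntegral.integral_add (i _) (i _), sub_eq_zero,
      ← intervalIntegral.integral_div]
    refine intervalIntegral.integral_congr fun t _ => ?_
    simp only [hb₁, hb₂, lower₁_apply, lower₂_apply]
    ring
  have h1 := intervalIntegral.integral_eq_sub_of_hasDerivAt_of_le hx.1 hDc.continuousOn hD' (by simp)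
  rw [intervalIntegral.integral_zero, h0, sub_zero] at h1
  exact sub_eq_zero.1 h1.symm

lemma wave_hasDerivAt_t {h : PC T} {f : CT T} {u : CT T × CT T}
    (hu : u = q.data h + q.source f + q.volterra u) {x : ℝ} (hx : x ∈ Icc (0 : ℝ) 1) (t : ℝ) :
    HasDerivAt (q.wave h u x) ((ev u.1 x t + ev u.2 x t) / 2) t := by
  have hc : ∀ v : CT T, Continuous fun t => ev v x t := fun v =>
    (isPer_ev v).comp continuous_const continuous_id
  have hd : ∀ v : CT T, HasDerivAt (fun s => ∫ r in (0 : ℝ)..s, ev v x r) (ev v x t) t := fun v =>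
    intervalIntegral.integral_hasDerivAt_right ((hc v).intervalIntegrable _ _)
      (hc v).stronglyMeasurable.stronglyMeasurableAtFilter (hc v).continuousAt
  refine ((((hd u.1).add (hd u.2)).div_const 2).add_const (q.wave h u x 0)).congr_of_eventuallyEq
    (Eventually.of_forall fun s => ?_)
  exact sub_eq_iff_eq_add.1 (q.wave_sub_eq_integral hu hx 0 s)

lemma contDiffOn_wave {h : PC T} {f : CT T} {u : CT T × CT T}
    (hu : u = q.data h + q.source f + q.volterra u) :
    ContDiffOn ℝ 1 (fun z : ℝ × ℝ => q.wave h u z.1 z.2) (Icc 0 1 ×ˢ univ) :=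
  contDiffOn_of_partials (q.isPer_wave h u).cont
    (((IsPer.const T 1).div q.h_two_a q.two_a_ne).mul ((isPer_ev u.1).sub (isPer_ev u.2))).cont
    (((isPer_ev u.1).add (isPer_ev u.2)).div (IsPer.const T 2) fun _ _ => two_ne_zero).cont
    (fun _ hx t => q.wave_hasDerivAt_x h u hx t)
    fun _ hx t => q.wave_hasDerivAt_t hu (Ioo_subset_Icc_self hx) t

end WaveCoeff

/-! ### Weak solutions and the equation on the circle -/

namespace WaveCoeff

variable (q : WaveCoeff T)

/-- The primitive `I u` of `(u₁ + u₂) / 2` on the line `x = 0`. -/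
def I (u : CT T × CT T) (t : ℝ) : ℝ := ∫ s in (0 : ℝ)..t, (ev u.1 0 s + ev u.2 0 s) / 2

/-- The function `G u = I u + N u`. -/
def G (u : CT T × CT T) (t : ℝ) : ℝ := I u t + (1 / ∫ t in (0 : ℝ)..T, q.a 0 t * q.r₀ t) *
  ∫ t in (0 : ℝ)..T, ((ev u.1 0 t - ev u.2 0 t) / 2 - q.a 0 t * q.r₀ t * I u t)

/-- The integral equations of a weak solution `u` of the first-order system. -/
def IsWeak (f : CT T) (u : CT T × CT T) : Prop := ∀ x ∈ Icc (0 : ℝ) 1, ∀ t : ℝ,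
  (ev u.1 x t = q.V₁.cocycle q.β₁ 0 x t * (ev u.2 0 (q.V₁.flow 0 x t) +
      2 * q.a 0 (q.V₁.flow 0 x t) * q.r₀ (q.V₁.flow 0 x t) * q.G u (q.V₁.flow 0 x t)) +
    ∫ ξ in (0 : ℝ)..x, q.V₁.cocycle q.β₁ ξ x t * (q.V₁.F ξ (q.V₁.flow ξ x t) *
      (ev f ξ (q.V₁.flow ξ x t) - q.b₁₂ ξ (q.V₁.flow ξ x t) * ev u.2 ξ (q.V₁.flow ξ x t) -
        q.a₃ ξ (q.V₁.flow ξ x t) * (q.G u (q.V₁.flow ξ x t) +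
          ev (q.J (u.1 - u.2)) ξ (q.V₁.flow ξ x t))))) ∧
  (ev u.2 x t = q.V₂.cocycle q.β₂ 1 x t * (ev u.1 1 (q.V₂.flow 1 x t) -
      2 * q.a 1 (q.V₂.flow 1 x t) * q.r₁ (q.V₂.flow 1 x t) *
        (q.G u (q.V₂.flow 1 x t) + ev (q.J (u.1 - u.2)) 1 (q.V₂.flow 1 x t))) +
    ∫ ξ in (1 : ℝ)..x, q.V₂.cocycle q.β₂ ξ x t * (q.V₂.F ξ (q.V₂.flow ξ x t) *
      (ev f ξ (q.V₂.flow ξ x t) - q.b₂₁ ξ (q.V₂.flow ξ x t) * ev u.1 ξ (q.V₂.flow ξ x t) -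
        q.a₃ ξ (q.V₂.flow ξ x t) * (q.G u (q.V₂.flow ξ x t) +
          ev (q.J (u.1 - u.2)) ξ (q.V₂.flow ξ x t)))))

variable (hC : (∫ t in (0 : ℝ)..T, q.a 0 t * q.r₀ t) ≠ 0)

include hC

lemma G_eq_primFun {h : PC T} {f : CT T} {u : CT T × CT T}
    (hu : u = q.data h + q.source f + q.volterra u) (t : ℝ) : q.G u t = primFun h t := by
  obtain ⟨⟨hb₁, -⟩, hb₂, -⟩ := (q.system_iff h f u).1 hu
  have hI : ∀ t, I u t = primFun h t - mean h := fun t => by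
    rw [I, ← primFun_zero, primFun_sub]
    refine intervalIntegral.integral_congr fun s _ => ?_
    simp only [hb₁, hb₂, lower₁_apply, lower₂_apply]
    ring
  have hN : ∀ t, (ev u.1 0 t - ev u.2 0 t) / 2 - q.a 0 t * q.r₀ t * I u t =
      q.a 0 t * q.r₀ t * mean h := fun t => by
    rw [hI, hb₁, hb₂, lower₁_apply, lower₂_apply]
    ring
  rw [G]
  simp only [hN]
  rw [intervalIntegral.integral_mul_const, hI]
  field_simp
  ring

/-- The function `G u` of a weak solution is periodic: the boundary condition at `x = 0` shows that
`a r₀ (G(t + T) - G(t))` vanishes, the difference does not depend on `t`, and the mean of `a r₀` is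
not zero. -/
lemma exists_of_boundary (u : CT T × CT T)
    (hb : ∀ t, ev u.1 0 t = ev u.2 0 t + 2 * q.a 0 t * q.r₀ t * q.G u t) :
    ∃ h : PC T, (∀ t, q.G u t = primFun h t) ∧
      (∀ t : ℝ, ev u.1 0 t = h (t : AddCircle T) + q.lower₁ h (t : AddCircle T)) ∧
      ∀ t : ℝ, ev u.2 0 t = h (t : AddCircle T) + q.lower₂ h (t : AddCircle T) := by
  set σ : ℝ → ℝ := fun t => (ev u.1 0 t + ev u.2 0 t) / 2 with hσ
  have hσc : Continuous σ := (((isPer_ev u.1).comp continuous_const continuous_id).add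
    ((isPer_ev u.2).comp continuous_const continuous_id)).div_const 2
  have hσp : ∀ t, σ (t + T) = σ t := fun t => by simp only [hσ, (isPer_ev _).per]
  set N : ℝ := (1 / ∫ t in (0 : ℝ)..T, q.a 0 t * q.r₀ t) *
    ∫ t in (0 : ℝ)..T, ((ev u.1 0 t - ev u.2 0 t) / 2 - q.a 0 t * q.r₀ t * I u t) with hN
  have hG : ∀ t, q.G u t = (∫ s in (0 : ℝ)..t, σ s) + N := fun t => rfl
  have hS : ∫ s in (0 : ℝ)..T, σ s = 0 := by
    have h1 : ∀ t, q.G u (t + T) - q.G u t = ∫ s in (0 : ℝ)..T, σ s := fun t => by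
      rw [hG, hG, add_sub_add_right_eq_sub, intervalIntegral.integral_interval_sub_left
        (hσc.intervalIntegrable _ _) (hσc.intervalIntegrable _ _),
        (show Function.Periodic σ T from hσp).intervalIntegral_add_eq t 0, zero_add]
    by_contra hne
    refine hC ?_
    have h2 : ∀ t, q.a 0 t * q.r₀ t = 0 := fun t => by
      have e1 := hb t
      have e2 := hb (t + T)
      rw [(isPer_ev _).per, (isPer_ev _).per, q.ha.per, q.hr₀T] at e2
      have e3 : q.a 0 t * q.r₀ t * (q.G u (t + T) - q.G u t) = 0 := by linarith
      rw [h1] at e3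
      exact (mul_eq_zero.1 e3).resolve_right hne
    simp only [h2, intervalIntegral.integral_zero]
  set h : PC T := mkPC (g := fun t => σ t + N) (hσc.add continuous_const)
    (fun t => by rw [hσp]) with hh
  have hhv : ∀ t : ℝ, h (t : AddCircle T) = σ t + N := fun t => rfl
  have hmean : mean h = N := by
    simp only [mean, hhv]
    rw [intervalIntegral.integral_add (hσc.intervalIntegrable _ _) (by simp), hS,
      intervalIntegral.integral_const]
    have := hT.out.ne'
    simp [this]
  have hprim : ∀ t, q.G u t = primFun h t := fun t => by
    rw [hG, primFun, hmean]
    simp only [hhv, add_sub_cancel_right]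
  refine ⟨h, hprim, fun t => ?_, fun t => ?_⟩
  · rw [lower₁_apply, ← hprim, hmean, hhv]
    have := hb t
    simp only [hσ]
    linarith
  · rw [lower₂_apply, ← hprim, hmean, hhv]
    have := hb t
    simp only [hσ]
    linarith

/-- Weak solutions of the system correspond to solutions of the Cauchy problem in `x` from `x = 0`
that satisfy the boundary condition at `x = 1`. -/
lemma isWeak_iff (f : CT T) (u : CT T × CT T) : q.IsWeak f u ↔
    ∃ h, u = q.data h + q.source f + q.volterra u ∧
      q.residual u = (2 : ℝ) • (q.ar₁ * prim T h) := by
  have h0 : (0 : ℝ) ∈ Icc (0 : ℝ) 1 := by simp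
  have h1 : (1 : ℝ) ∈ Icc (0 : ℝ) 1 := by simp
  constructor
  · intro hw
    obtain ⟨h, hG, hb₁, hb₂⟩ := q.exists_of_boundary hC u fun t => by
      have := (hw 0 h0 t).1
      simpa using this
    have hend : ∀ t, ev u.2 1 t = ev u.1 1 t - 2 * q.a 1 t * q.r₁ t *
        (q.G u t + ev (q.J (u.1 - u.2)) 1 t) := fun t => by
      have := (hw 1 h1 t).2
      simpa using this
    refine ⟨h, (q.system_iff h f u).2 ⟨⟨hb₁, fun x hx t => ?_⟩, hb₂, ?_⟩, PC.ext fun t => ?_⟩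
    · rw [(hw x hx t).1]
      have hb : ∀ t, ev u.1 0 t = ev u.2 0 t + 2 * q.a 0 t * q.r₀ t * q.G u t := fun t => by
        have := (hw 0 h0 t).1
        simpa using this
      rw [← hb]
      simp only [src₁, wave, hG]
    · refine PeriodicField.IsMild.change_base (x₀ := 1) q.hβ₂.cont (q.isPer_src₂ h f u).cont
        (fun x hx t => ?_) h0
      rw [(hw x hx t).2, ← hend]
      simp only [src₂, wave, hG]
    · change _ = 2 * (q.a 1 t * q.r₁ t * primFun h t)
      rw [residual_apply, hend, hG]
      ring
  · rintro ⟨h, hu, hr⟩ x hx t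
    have hG := q.G_eq_primFun hC hu
    obtain ⟨⟨hb₁, hm₁⟩, hb₂, hm₂⟩ := (q.system_iff h f u).1 hu
    refine ⟨?_, ?_⟩
    · rw [hm₁ x hx t, hb₁, hb₂, lower₁_apply, lower₂_apply, hG]
      simp only [src₁, wave, hG]
      ring
    · have hend : ∀ t, ev u.2 1 t = ev u.1 1 t - 2 * q.a 1 t * q.r₁ t *
          (q.G u t + ev (q.J (u.1 - u.2)) 1 t) := fun t => by
        have e : q.residual u (t : AddCircle T) = 2 * (q.a 1 t * q.r₁ t * primFun h t) := by
          rw [hr]; rfl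
        rw [residual_apply] at e
        rw [hG]
        linarith
      rw [hm₂.change_base q.hβ₂.cont (q.isPer_src₂ h f u).cont h1 x hx t, hend]
      simp only [src₂, wave, hG]

omit hC in
/-- The solution of the first-order system with data `h` and right-hand side `f`. -/
def sol (h : PC T) (f : CT T) : CT T × CT T := q.resolvent (q.data h + q.source f)

omit hC in
lemma sol_eq (h : PC T) (f : CT T) :
    q.sol h f = q.data h + q.source f + q.volterra (q.sol h f) :=
  (q.eq_resolvent_iff _ _).2 rfl

/-- The functions `w = G u + J(u₁ - u₂)` of weak solutions, in terms of the equation on the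
circle. -/
lemma exists_isWeak_iff (f : CT T) (w : unitInterval × ℝ → ℝ) :
    (∃ u, q.IsWeak f u ∧ ∀ (x : unitInterval) (t : ℝ),
      w (x, t) = q.G u t + ev (q.J (u.1 - u.2)) x t) ↔
    ∃ h, q.circleOp h + q.circleSource f = 0 ∧
      w = fun z : unitInterval × ℝ => q.wave h (q.sol h f) z.1 z.2 := by
  have key : ∀ h, q.residual (q.sol h f) = (2 : ℝ) • (q.ar₁ * prim T h) ↔
      q.circleOp h + q.circleSource f = 0 := fun h => by
    have : q.circleOp h + q.circleSource f =
        q.residual (q.sol h f) - (2 : ℝ) • (q.ar₁ * prim T h) := by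
      rw [sol, map_add, map_add]
      simp only [circleOp, circleSource, _root_.sub_apply, ContinuousLinearMap.comp_apply,
        _root_.smul_apply, ContinuousLinearMap.mul_apply']
      abel
    rw [this, sub_eq_zero]
  constructor
  · rintro ⟨u, hu, hw⟩
    obtain ⟨h, hs, hr⟩ := (q.isWeak_iff hC f u).1 hu
    obtain rfl : u = q.sol h f := (q.eq_resolvent_iff _ _).1 hs
    refine ⟨h, (key h).1 hr, funext fun z => ?_⟩
    rw [← Prod.mk.eta (p := z), hw, q.G_eq_primFun hC hs]
    rfl
  · rintro ⟨h, hh, rfl⟩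
    exact ⟨q.sol h f, (q.isWeak_iff hC f _).2 ⟨h, q.sol_eq h f, (key h).2 hh⟩, fun x t => by
      rw [q.G_eq_primFun hC (q.sol_eq h f)]; rfl⟩

omit hC

/-- The unknown `h` is determined by `w(0, ·)`. -/
lemma wave_injective {h₁ h₂ : PC T} {u₁ u₂ : CT T × CT T}
    (h : ∀ (x : unitInterval) (t : ℝ), q.wave h₁ u₁ x t = q.wave h₂ u₂ x t) : h₁ = h₂ := by
  have h0 : ∀ t, primFun h₁ t = primFun h₂ t := fun t => by
    have := h 0 t
    have h0 : (((0 : unitInterval) : ℝ)) ∈ Icc (0 : ℝ) 1 := by simp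
    rw [wave, wave, q.ev_J _ h0, q.ev_J _ h0] at this
    simpa using this
  have h1 : mean h₁ = mean h₂ := by rw [← primFun_zero, h0, primFun_zero]
  refine PC.ext fun t => ?_
  have h2 := (primFun_hasDerivAt h₁ t).unique ((primFun_hasDerivAt h₂ t).congr_of_eventuallyEq
    (Eventually.of_forall h0))
  rw [h1] at h2
  exact sub_left_injective h2

/-- Solutions of the homogeneous problem as functions on the strip. -/
def waveMap : PC T →ₗ[ℝ] (unitInterval × ℝ → ℝ) where
  toFun h := fun z => q.wave h (q.sol h 0) z.1 z.2
  map_add' h₁ h₂ := by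
    funext z
    have e : q.sol (h₁ + h₂) 0 = q.sol h₁ 0 + q.sol h₂ 0 := by
      simp only [sol, map_add, map_zero, add_zero]
    have e' : primFun (h₁ + h₂) z.2 = primFun h₁ z.2 + primFun h₂ z.2 := by
      simp only [← prim_apply, map_add, ContinuousMap.add_apply]
    simp only [wave, e, e', Prod.fst_add, Prod.snd_add, add_sub_add_comm, map_add, ev_add,
      Pi.add_apply]
    ring
  map_smul' c h := by
    funext z
    have e : q.sol (c • h) 0 = c • q.sol h 0 := by
      simp only [sol, map_smul, map_zero, add_zero]
    have e' : primFun (c • h) z.2 = c * primFun h z.2 := by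
      simp only [← prim_apply, map_smul, ContinuousMap.smul_apply, smul_eq_mul]
    simp only [wave, e, e', Prod.smul_fst, Prod.smul_snd, ← smul_sub, map_smul, ev_smul,
      Pi.smul_apply, smul_eq_mul, RingHom.id_apply]
    ring

lemma waveMap_injective : Function.Injective q.waveMap := fun _ _ h =>
  q.wave_injective fun x t => congrFun h (x, t)

end WaveCoeff

end RobinWave

namespace RobinWave

/-! ### The Fredholm alternative -/

section Fredholm

variable {X Y : Type*} [NormedAddCommGroup X] [NormedSpace ℝ X] [NormedAddCommGroup Y]
  [NormedSpace ℝ Y]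

/-- If `Λ` has closed range of finite codimension, then a bounded operator with dense range maps
onto the cokernel of `Λ`. -/
lemma mkQ_comp_surjective_of_denseRange (Λ : Y →L[ℝ] Y) (S : X →L[ℝ] Y)
    (hcl : IsClosed (Λ.range : Set Y)) [FiniteDimensional ℝ (Y ⧸ Λ.range)] (hS : DenseRange S) :
    Function.Surjective (Λ.range.mkQ ∘ₗ S.toLinearMap) := by
  have : IsClosed (Λ.range : Set Y) := hcl
  set W : Submodule ℝ (Y ⧸ Λ.range) := LinearMap.range (Λ.range.mkQ ∘ₗ S.toLinearMap) with hW
  have hWc : IsClosed (W : Set (Y ⧸ Λ.range)) := W.closed_of_finiteDimensional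
  have hpre : IsClosed (Λ.range.mkQ ⁻¹' (W : Set (Y ⧸ Λ.range))) :=
    hWc.preimage continuous_quot_mk
  intro z
  obtain ⟨y, rfl⟩ := Λ.range.mkQ_surjective z
  have : y ∈ closure (Set.range S) := hS y
  exact closure_minimal (t := Λ.range.mkQ ⁻¹' (W : Set (Y ⧸ Λ.range)))
    (by rintro _ ⟨x, rfl⟩; exact ⟨x, rfl⟩) hpre this

/-- Solvability of `Λ h + S f = 0`, as a condition on `f`. -/
lemma solvable_codim (Λ : Y →L[ℝ] Y) (S : X →L[ℝ] Y) [FiniteDimensional ℝ Λ.ker]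
    (hcl : IsClosed (Λ.range : Set Y)) (e : Λ.ker ≃ₗ[ℝ] (Y ⧸ Λ.range)) (hS : DenseRange S) :
    (∀ f, f ∈ Λ.range.comap S.toLinearMap ↔ ∃ h, Λ h + S f = 0) ∧
      IsClosed (Λ.range.comap S.toLinearMap : Set X) ∧
      FiniteDimensional ℝ (X ⧸ Λ.range.comap S.toLinearMap) ∧
      Module.finrank ℝ (X ⧸ Λ.range.comap S.toLinearMap) = Module.finrank ℝ Λ.ker := by
  have : FiniteDimensional ℝ (Y ⧸ Λ.range) := e.finiteDimensional
  have hk : LinearMap.ker (Λ.range.mkQ ∘ₗ S.toLinearMap) = Λ.range.comap S.toLinearMap := by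
    rw [LinearMap.ker_comp, Submodule.ker_mkQ]
  have e' : (X ⧸ Λ.range.comap S.toLinearMap) ≃ₗ[ℝ] (Y ⧸ Λ.range) :=
    (Submodule.quotEquivOfEq _ _ hk.symm).trans
      ((Λ.range.mkQ ∘ₗ S.toLinearMap).quotKerEquivOfSurjective
        (mkQ_comp_surjective_of_denseRange Λ S hcl hS))
  refine ⟨fun f => ⟨?_, ?_⟩, hcl.preimage S.continuous, e'.symm.finiteDimensional,
    (e'.trans e.symm).finrank_eq⟩
  · rintro ⟨h, hh⟩
    refine ⟨-h, ?_⟩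
    rw [map_neg, neg_add_eq_zero]
    exact hh
  · rintro ⟨h, hh⟩
    refine ⟨-h, ?_⟩
    change Λ (-h) = S f
    rw [map_neg, neg_eq_iff_add_eq_zero, hh]

end Fredholm

variable {T : ℝ} [hT : Fact (0 < T)]

namespace WaveCoeff

variable (q : WaveCoeff T)

/-- The conclusions for the functions `w` described by the equation on the circle. -/
theorem fredholm_alternative (hu : IsUnit q.leadingOp) :
    ∃ K : Submodule ℝ (unitInterval × ℝ → ℝ),
      (∀ w, w ∈ K ↔ ∃ h, q.circleOp h + q.circleSource 0 = 0 ∧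
        w = fun z : unitInterval × ℝ => q.wave h (q.sol h 0) z.1 z.2) ∧
      FiniteDimensional ℝ K ∧
      (∃ R : Submodule ℝ (CT T),
        (∀ f, f ∈ R ↔ ∃ (w : unitInterval × ℝ → ℝ), ∃ h, q.circleOp h + q.circleSource f = 0 ∧
          w = fun z : unitInterval × ℝ => q.wave h (q.sol h f) z.1 z.2) ∧
        IsClosed (R : Set (CT T)) ∧ FiniteDimensional ℝ (CT T ⧸ R) ∧
        Module.finrank ℝ (CT T ⧸ R) = Module.finrank ℝ K) ∧
      Xor (0 < Module.finrank ℝ K)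
        (∀ f : CT T, ∃! w : unitInterval × ℝ → ℝ, ∃ h, q.circleOp h + q.circleSource f = 0 ∧
          w = fun z : unitInterval × ℝ => q.wave h (q.sol h f) z.1 z.2) := by
  have hfr := fredholm_index_zero hu q.isCompactOperator_circleOp_sub
  rw [add_sub_cancel] at hfr
  obtain ⟨hfd, hcl, ⟨e⟩⟩ := hfr
  obtain ⟨hR, hRc, hRf, hRd⟩ := solvable_codim q.circleOp q.circleSource hcl e
    q.denseRange_circleSource
  have eK := Submodule.equivMapOfInjective q.waveMap q.waveMap_injective q.circleOp.ker
  have hKd := eK.finrank_eq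
  have hmem : ∀ w, w ∈ q.circleOp.ker.map q.waveMap ↔
      ∃ h, q.circleOp h + q.circleSource 0 = 0 ∧
        w = fun z : unitInterval × ℝ => q.wave h (q.sol h 0) z.1 z.2 := fun w => by
    rw [Submodule.mem_map, map_zero]
    simp only [add_zero]
    exact exists_congr fun h => and_congr Iff.rfl eq_comm
  have hRw : ∀ f, f ∈ q.circleOp.range.comap q.circleSource.toLinearMap ↔
      ∃ (w : unitInterval × ℝ → ℝ), ∃ h, q.circleOp h + q.circleSource f = 0 ∧
          w = fun z : unitInterval × ℝ => q.wave h (q.sol h f) z.1 z.2 := fun f => by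
    rw [hR f]
    exact ⟨fun ⟨h, hh⟩ => ⟨_, h, hh, rfl⟩, fun ⟨_, h, hh, _⟩ => ⟨h, hh⟩⟩
  refine ⟨q.circleOp.ker.map q.waveMap, hmem, eK.finiteDimensional,
    ⟨_, hRw, hRc, hRf, hRd.trans hKd⟩, ?_⟩
  rw [← hKd]
  have hex : Module.finrank ℝ q.circleOp.ker = 0 →
      ∀ f : CT T, ∃! w : unitInterval × ℝ → ℝ, ∃ h, q.circleOp h + q.circleSource f = 0 ∧
          w = fun z : unitInterval × ℝ => q.wave h (q.sol h f) z.1 z.2 := by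
    intro h0 f
    have hker : q.circleOp.ker = ⊥ := Submodule.finrank_eq_zero.1 h0
    have hf : f ∈ q.circleOp.range.comap q.circleSource.toLinearMap := by
      have : Subsingleton (CT T ⧸ q.circleOp.range.comap q.circleSource.toLinearMap) :=
        Module.finrank_zero_iff.1 (hRd.trans h0)
      rw [Submodule.Quotient.subsingleton_iff.1 this]
      trivial
    obtain ⟨h, hh⟩ := (hR f).1 hf
    refine ⟨_, ⟨h, hh, rfl⟩, ?_⟩
    rintro _ ⟨h', hh', rfl⟩
    have : h' = h := LinearMap.ker_eq_bot.1 hker (add_right_cancel (hh'.trans hh.symm))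
    rw [this]
  by_cases h0 : Module.finrank ℝ q.circleOp.ker = 0
  · exact Or.inr ⟨hex h0, by rw [h0]; exact lt_irrefl 0⟩
  · refine Or.inl ⟨Nat.pos_of_ne_zero h0, fun hall => h0 ?_⟩
    obtain ⟨w, -, huniq⟩ := hall 0
    rw [Submodule.finrank_eq_zero, eq_bot_iff]
    intro h hh
    have e1 := huniq _ ((hmem _).1 (Submodule.mem_map_of_mem hh))
    have e2 := huniq _ ((hmem _).1 (Submodule.mem_map_of_mem (zero_mem _)))
    exact q.waveMap_injective (e1.trans e2.symm)

end WaveCoeff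

end RobinWave

namespace RobinWave

/-! ### The coefficients of the Robin problem -/

/-- The retraction of the line onto `[0, 1]`. -/
def clamp (x : ℝ) : ℝ := projIcc (0 : ℝ) 1 zero_le_one x

lemma clamp_mem (x : ℝ) : clamp x ∈ Icc (0 : ℝ) 1 := (projIcc (0 : ℝ) 1 zero_le_one x).2

lemma clamp_of_mem {x : ℝ} (hx : x ∈ Icc (0 : ℝ) 1) : clamp x = x := by
  rw [clamp, projIcc_of_mem _ hx]

lemma continuous_clamp : Continuous clamp := continuous_subtype_val.comp continuous_projIcc

lemma isPer_clamp {T : ℝ} {g : ℝ → ℝ → ℝ}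
    (hc : ContinuousOn (fun q : ℝ × ℝ => g q.1 q.2) (Icc 0 1 ×ˢ univ))
    (hp : ∀ x ∈ Icc (0 : ℝ) 1, ∀ t, g x (t + T) = g x t) : IsPer T fun x t => g (clamp x) t :=
  ⟨hc.comp_continuous ((continuous_clamp.comp continuous_fst).prodMk continuous_snd)
    fun q => ⟨clamp_mem q.1, mem_univ _⟩, fun x t => hp _ (clamp_mem x) t⟩

section Derivatives

variable {T : ℝ} {g : ℝ → ℝ → ℝ} (hg : IsCTl T 2 g)

include hg

lemma IsCTl.hasFDerivWithinAt {x : ℝ} (hx : x ∈ Icc (0 : ℝ) 1) (t : ℝ) :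
    HasFDerivWithinAt (fun q : ℝ × ℝ => g q.1 q.2)
      (fderivWithin ℝ (fun q : ℝ × ℝ => g q.1 q.2) (Icc 0 1 ×ˢ univ) (x, t))
      (Icc 0 1 ×ˢ univ) (x, t) :=
  (hg.1.differentiableOn (by norm_num) (x, t) ⟨hx, mem_univ _⟩).hasFDerivWithinAt

lemma IsCTl.hasDerivWithinAt_x {x : ℝ} (hx : x ∈ Icc (0 : ℝ) 1) (t : ℝ) :
    HasDerivWithinAt (fun y => g y t)
      (fderivWithin ℝ (fun q : ℝ × ℝ => g q.1 q.2) (Icc 0 1 ×ˢ univ) (x, t) (1, 0)) (Icc 0 1) x :=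
  (hg.hasFDerivWithinAt hx t).comp_hasDerivWithinAt x (f := fun y => (y, t))
    ((hasDerivWithinAt_id x _).prodMk (hasDerivWithinAt_const x _ t))
    fun _ hy => ⟨hy, mem_univ _⟩

lemma IsCTl.hasDerivAt_t {x : ℝ} (hx : x ∈ Icc (0 : ℝ) 1) (t : ℝ) :
    HasDerivAt (g x)
      (fderivWithin ℝ (fun q : ℝ × ℝ => g q.1 q.2) (Icc 0 1 ×ˢ univ) (x, t) (0, 1)) t :=
  (hg.hasFDerivWithinAt hx t).comp_hasDerivAt t (f := fun s => (x, s))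
    ((hasDerivAt_const t x).prodMk (hasDerivAt_id t)) (Eventually.of_forall fun _ => ⟨hx, mem_univ _⟩)

lemma IsCTl.dx_eq {x : ℝ} (hx : x ∈ Icc (0 : ℝ) 1) (t : ℝ) : dx g x t =
    fderivWithin ℝ (fun q : ℝ × ℝ => g q.1 q.2) (Icc 0 1 ×ˢ univ) (x, t) (1, 0) :=
  (hg.hasDerivWithinAt_x hx t).derivWithin (uniqueDiffOn_Icc zero_lt_one x hx)

lemma IsCTl.dt_eq {x : ℝ} (hx : x ∈ Icc (0 : ℝ) 1) (t : ℝ) : dt g x t =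
    fderivWithin ℝ (fun q : ℝ × ℝ => g q.1 q.2) (Icc 0 1 ×ˢ univ) (x, t) (0, 1) :=
  (hg.hasDerivAt_t hx t).deriv

lemma IsCTl.continuousOn_fderivWithin : ContinuousOn
    (fderivWithin ℝ (fun q : ℝ × ℝ => g q.1 q.2) (Icc 0 1 ×ˢ univ)) (Icc 0 1 ×ˢ univ) :=
  hg.1.continuousOn_fderivWithin ((uniqueDiffOn_Icc zero_lt_one).prod uniqueDiffOn_univ)
    (by norm_num)

lemma IsCTl.isPer_dx : IsPer T fun x t => dx g (clamp x) t := by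
  refine isPer_clamp ?_ fun x hx t => ?_
  · exact (hg.continuousOn_fderivWithin.clm_apply continuousOn_const).congr
      fun q hq => hg.dx_eq hq.1 q.2
  · exact derivWithin_congr (fun y hy => hg.2 y hy t) (hg.2 x hx t)

lemma IsCTl.isPer_dt : IsPer T fun x t => dt g (clamp x) t := by
  refine isPer_clamp ?_ fun x hx t => deriv_add_period (hg.2 x hx) t
  exact (hg.continuousOn_fderivWithin.clm_apply continuousOn_const).congr
      fun q hq => hg.dt_eq hq.1 q.2

end Derivatives

/-- The assumptions on the data of the Robin problem, except for the non-resonance condition. -/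
structure Data.IsRegular (p : Data) : Prop where
  pos : ∀ x ∈ Icc (0 : ℝ) 1, ∀ t : ℝ, 0 < p.a x t
  ha : IsCTl p.T 2 p.a
  ha₁ : IsCTl p.T 1 p.a₁
  ha₂ : IsCTl p.T 1 p.a₂
  ha₃ : IsCTl p.T 0 p.a₃
  hr₀ : ContDiff ℝ 1 p.r₀ ∧ Function.Periodic p.r₀ p.T
  hr₁ : ContDiff ℝ 1 p.r₁ ∧ Function.Periodic p.r₁ p.T

namespace Data

variable {p : Data} (hp : p.IsRegular)

/-- The coefficients of the Robin problem, extended to all `x` by their boundary values. -/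
def IsRegular.coeff : WaveCoeff p.T where
  a x t := p.a (clamp x) t
  aX x t := dx p.a (clamp x) t
  aT x t := dt p.a (clamp x) t
  a₁ x t := p.a₁ (clamp x) t
  a₂ x t := p.a₂ (clamp x) t
  a₃ x t := p.a₃ (clamp x) t
  r₀ := p.r₀
  r₁ := p.r₁
  ha := isPer_clamp hp.ha.1.continuousOn hp.ha.2
  haX := hp.ha.isPer_dx
  haT := hp.ha.isPer_dt
  ha₁ := isPer_clamp hp.ha₁.1.continuousOn hp.ha₁.2
  ha₂ := isPer_clamp hp.ha₂.1.continuousOn hp.ha₂.2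
  ha₃ := isPer_clamp hp.ha₃.1.continuousOn hp.ha₃.2
  hr₀ := hp.hr₀.1.continuous
  hr₁ := hp.hr₁.1.continuous
  hr₀T := hp.hr₀.2
  hr₁T := hp.hr₁.2
  pos x t := hp.pos _ (clamp_mem x) t
  a_clamp x t := by rw [show ((projIcc (0 : ℝ) 1 zero_le_one x : Icc (0 : ℝ) 1) : ℝ) = clamp x
    from rfl, clamp_of_mem (clamp_mem x)]
  aT_clamp x t := by rw [show ((projIcc (0 : ℝ) 1 zero_le_one x : Icc (0 : ℝ) 1) : ℝ) = clamp x
    from rfl, clamp_of_mem (clamp_mem x)]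
  hasDeriv x t := by
    rw [hp.ha.dt_eq (clamp_mem x)]
    exact hp.ha.hasDerivAt_t (clamp_mem x) t
  hasDerivX x hx t := by
    have hx' := Ioo_subset_Icc_self hx
    rw [clamp_of_mem hx', hp.ha.dx_eq hx']
    refine ((hp.ha.hasDerivWithinAt_x hx' t).hasDerivAt
      (Icc_mem_nhds hx.1 hx.2)).congr_of_eventuallyEq ?_
    filter_upwards [Icc_mem_nhds hx.1 hx.2] with y hy
    rw [clamp_of_mem hy]

lemma IsRegular.coeff_a {x : ℝ} (hx : x ∈ Icc (0 : ℝ) 1) (t : ℝ) : hp.coeff.a x t = p.a x t := by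
  simp only [coeff, clamp_of_mem hx]

lemma IsRegular.coeff_a₃ {x : ℝ} (hx : x ∈ Icc (0 : ℝ) 1) (t : ℝ) :
    hp.coeff.a₃ x t = p.a₃ x t := by
  simp only [coeff, clamp_of_mem hx]

lemma IsRegular.coeff_b₁₁ {x : ℝ} (hx : x ∈ Icc (0 : ℝ) 1) (t : ℝ) :
    hp.coeff.b₁₁ x t = p.b₁₁ x t := by
  simp only [WaveCoeff.b₁₁, Data.b₁₁, coeff, clamp_of_mem hx]

lemma IsRegular.coeff_b₁₂ {x : ℝ} (hx : x ∈ Icc (0 : ℝ) 1) (t : ℝ) :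
    hp.coeff.b₁₂ x t = p.b₁₂ x t := by
  simp only [WaveCoeff.b₁₂, Data.b₁₂, coeff, clamp_of_mem hx]

lemma IsRegular.coeff_b₂₁ {x : ℝ} (hx : x ∈ Icc (0 : ℝ) 1) (t : ℝ) :
    hp.coeff.b₂₁ x t = p.b₂₁ x t := by
  simp only [WaveCoeff.b₂₁, Data.b₂₁, coeff, clamp_of_mem hx]

lemma IsRegular.coeff_b₂₂ {x : ℝ} (hx : x ∈ Icc (0 : ℝ) 1) (t : ℝ) :
    hp.coeff.b₂₂ x t = p.b₂₂ x t := by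
  simp only [WaveCoeff.b₂₂, Data.b₂₂, coeff, clamp_of_mem hx]

variable [hT : Fact (0 < p.T)]

/-- A characteristic on `[0, 1]` is a trajectory of the extended field: it is carried to a constant
by the flow to a fixed line. -/
lemma IsRegular.eq_flow_of_isCharacteristic {σ x t : ℝ} (hx : x ∈ Icc (0 : ℝ) 1) {y : ℝ → ℝ}
    (hy : IsCharacteristic p.a σ x t y) {ξ : ℝ} (hξ : ξ ∈ Icc (0 : ℝ) 1) :
    y ξ = (hp.coeff.field σ).flow ξ x t := by
  set V := hp.coeff.field σ with hV
  have hyc : Continuous fun z => y (clamp z) :=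
    ContinuousOn.comp_continuous (fun z hz => (hy.2 z hz).continuousWithinAt) continuous_clamp
      clamp_mem
  set D : ℝ → ℝ := fun z => V.flow x z (y (clamp z)) with hD
  have hDc : Continuous D := V.continuous_flow_comp continuous_const continuous_id hyc
  have hD' : ∀ z ∈ Ioo (0 : ℝ) 1, HasDerivAt D 0 z := fun z hz => by
    have hz' := Ioo_subset_Icc_self hz
    have h1 : HasDerivAt (fun z => y (clamp z)) (σ / p.a z (y z)) z := by
      refine ((hy.2 z hz').hasDerivAt (Icc_mem_nhds hz.1 hz.2)).congr_of_eventuallyEq ?_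
      filter_upwards [Icc_mem_nhds hz.1 hz.2] with w hw
      rw [clamp_of_mem hw]
    refine (V.flow_hasDerivAt_base (s := fun z => y (clamp z)) hyc h1 x).congr_deriv ?_
    have h2 : V.F z (y (clamp z)) = σ / p.a z (y z) := by
      rw [clamp_of_mem hz', ← hp.coeff_a hz']; rfl
    rw [h2, sub_self, mul_zero]
  have hconst : ∀ z ∈ Icc (0 : ℝ) 1, D z = D 0 := fun z hz => by
    have h1 := intervalIntegral.integral_eq_sub_of_hasDerivAt_of_le hz.1 hDc.continuousOn
      (fun w hw => hD' w ⟨hw.1, hw.2.trans_le hz.2⟩) (by simp)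
    rw [intervalIntegral.integral_zero] at h1
    linarith
  have h1 : V.flow x ξ (y ξ) = t := by
    have h2 := (hconst ξ hξ).trans (hconst x hx).symm
    simp only [hD, clamp_of_mem hξ, clamp_of_mem hx, V.flow_self, hy.1] at h2
    exact h2
  rw [← h1, V.flow_flow, V.flow_self]

lemma IsRegular.charCurve_eq_flow (σ : ℝ) {ξ x : ℝ} (hξ : ξ ∈ Icc (0 : ℝ) 1)
    (hx : x ∈ Icc (0 : ℝ) 1) (t : ℝ) :
    charCurve p.a σ ξ x t = (hp.coeff.field σ).flow ξ x t := by
  have hex : ∃ y, IsCharacteristic p.a σ x t y :=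
    ⟨fun ξ => (hp.coeff.field σ).flow ξ x t, (hp.coeff.field σ).flow_self x t, fun ξ hξ =>
      ((hp.coeff.field σ).flow_hasDerivAt ξ x t).hasDerivWithinAt.congr_deriv (by
        rw [← hp.coeff_a hξ]; rfl)⟩
  exact hp.eq_flow_of_isCharacteristic hx (Classical.epsilon_spec hex) hξ

lemma IsRegular.τ₁_eq {ξ x : ℝ} (hξ : ξ ∈ Icc (0 : ℝ) 1) (hx : x ∈ Icc (0 : ℝ) 1) (t : ℝ) :
    p.τ₁ ξ x t = hp.coeff.V₁.flow ξ x t := hp.charCurve_eq_flow (-1) hξ hx t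

lemma IsRegular.τ₂_eq {ξ x : ℝ} (hξ : ξ ∈ Icc (0 : ℝ) 1) (hx : x ∈ Icc (0 : ℝ) 1) (t : ℝ) :
    p.τ₂ ξ x t = hp.coeff.V₂.flow ξ x t := hp.charCurve_eq_flow 1 hξ hx t

lemma IsRegular.c₁_eq {ξ x : ℝ} (hξ : ξ ∈ Icc (0 : ℝ) 1) (hx : x ∈ Icc (0 : ℝ) 1) (t : ℝ) :
    p.c₁ ξ x t = hp.coeff.V₁.cocycle hp.coeff.β₁ ξ x t := by
  rw [c₁, PeriodicField.cocycle]
  congr 1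
  refine intervalIntegral.integral_congr fun η hη => ?_
  have hη' := (uIcc_subset_Icc hx hξ) hη
  simp only [WaveCoeff.β₁, hp.τ₁_eq hη' hx, hp.coeff_b₁₁ hη', hp.coeff_a hη']

lemma IsRegular.c₂_eq {ξ x : ℝ} (hξ : ξ ∈ Icc (0 : ℝ) 1) (hx : x ∈ Icc (0 : ℝ) 1) (t : ℝ) :
    p.c₂ ξ x t = hp.coeff.V₂.cocycle hp.coeff.β₂ ξ x t := by
  rw [c₂, PeriodicField.cocycle]
  congr 1
  refine intervalIntegral.integral_congr fun η hη => ?_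
  have hη' := (uIcc_subset_Icc hx hξ) hη
  simp only [WaveCoeff.β₂, hp.τ₂_eq hη' hx, hp.coeff_b₂₂ hη', hp.coeff_a hη']

lemma IsRegular.d₁_eq {ξ x : ℝ} (hξ : ξ ∈ Icc (0 : ℝ) 1) (hx : x ∈ Icc (0 : ℝ) 1) (t : ℝ) :
    p.d₁ ξ x t = hp.coeff.V₁.cocycle hp.coeff.β₁ ξ x t *
      hp.coeff.V₁.F ξ (hp.coeff.V₁.flow ξ x t) := by
  rw [d₁, hp.c₁_eq hξ hx, hp.τ₁_eq hξ hx, ← hp.coeff_a hξ]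
  simp only [WaveCoeff.field]
  ring

lemma IsRegular.d₂_eq {ξ x : ℝ} (hξ : ξ ∈ Icc (0 : ℝ) 1) (hx : x ∈ Icc (0 : ℝ) 1) (t : ℝ) :
    p.d₂ ξ x t = hp.coeff.V₂.cocycle hp.coeff.β₂ ξ x t *
      hp.coeff.V₂.F ξ (hp.coeff.V₂.flow ξ x t) := by
  rw [d₂, hp.c₂_eq hξ hx, hp.τ₂_eq hξ hx, ← hp.coeff_a hξ]
  simp only [WaveCoeff.field]
  ring

lemma IsRegular.Gop_eq (u : p.Pair) (t : ℝ) : Gop u t = hp.coeff.G u t := by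
  have h0 : (0 : ℝ) ∈ Icc (0 : ℝ) 1 := by simp
  simp only [Gop, Nop, WaveCoeff.G, Data.const, hp.coeff_a h0]
  rfl

lemma IsRegular.Jop_eq (u : p.Pair) {x : ℝ} (hx : x ∈ Icc (0 : ℝ) 1) (t : ℝ) :
    Jop u x t = ev (hp.coeff.J (u.1 - u.2)) x t := by
  rw [WaveCoeff.ev_J _ _ hx, Jop]
  refine intervalIntegral.integral_congr fun ξ hξ => ?_
  have hξ' := (uIcc_subset_Icc (by simp) hx) hξ
  simp only [hp.coeff_a hξ', ev_sub]
  ring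

lemma IsRegular.Fop_eq (u : p.Pair) {x : ℝ} (hx : x ∈ Icc (0 : ℝ) 1) (t : ℝ) :
    Fop u x t = hp.coeff.G u t + ev (hp.coeff.J (u.1 - u.2)) x t := by
  rw [Fop, hp.Gop_eq, hp.Jop_eq u hx]

lemma IsRegular.continuous_G (u : p.Pair) : Continuous (hp.coeff.G u) := by
  have hc : Continuous fun s => (ev u.1 0 s + ev u.2 0 s) / 2 :=
    (((isPer_ev u.1).comp continuous_const continuous_id).add
      ((isPer_ev u.2).comp continuous_const continuous_id)).div_const 2
  exact (continuous_integral_param (α := ℝ) (f := fun _ s => (ev u.1 0 s + ev u.2 0 s) / 2)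
    (hc.comp continuous_snd) continuous_const continuous_id).add continuous_const

/-- Comparison of the integral terms of the integral equations. -/
lemma integral_terms_eq (V : PeriodicField p.T) {β b a₃ g : ℝ → ℝ → ℝ} (hβ : IsPer p.T β)
    (hb : IsPer p.T b) (ha₃ : IsPer p.T a₃) (hg : Continuous fun q : ℝ × ℝ => g q.1 q.2)
    (f v : CT p.T) {A B : ℝ → ℝ} {x₀ x : ℝ} (t : ℝ)
    (hA : ∀ ξ ∈ uIcc x₀ x, A ξ = V.cocycle β ξ x t * V.F ξ (V.flow ξ x t) *
      b ξ (V.flow ξ x t) * ev v ξ (V.flow ξ x t))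
    (hB : ∀ ξ ∈ uIcc x₀ x, B ξ = V.cocycle β ξ x t * V.F ξ (V.flow ξ x t) *
      (ev f ξ (V.flow ξ x t) - a₃ ξ (V.flow ξ x t) * g ξ (V.flow ξ x t))) :
    -(∫ ξ in x₀..x, A ξ) + ∫ ξ in x₀..x, B ξ =
      ∫ ξ in x₀..x, V.cocycle β ξ x t * (V.F ξ (V.flow ξ x t) * (ev f ξ (V.flow ξ x t) -
        b ξ (V.flow ξ x t) * ev v ξ (V.flow ξ x t) -
          a₃ ξ (V.flow ξ x t) * g ξ (V.flow ξ x t))) := by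
  have hc : Continuous fun ξ => V.cocycle β ξ x t * V.F ξ (V.flow ξ x t) :=
    (V.continuous_cocycle_comp hβ.cont continuous_id continuous_const continuous_const).mul
      (V.continuous_along V.cont x t)
  have c₁ : Continuous fun ξ => V.cocycle β ξ x t * V.F ξ (V.flow ξ x t) *
      b ξ (V.flow ξ x t) * ev v ξ (V.flow ξ x t) :=
    (hc.mul (V.continuous_along hb.cont x t)).mul (V.continuous_along (isPer_ev v).cont x t)
  have c₂ : Continuous fun ξ => V.cocycle β ξ x t * V.F ξ (V.flow ξ x t) *
      (ev f ξ (V.flow ξ x t) - a₃ ξ (V.flow ξ x t) * g ξ (V.flow ξ x t)) :=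
    hc.mul ((V.continuous_along (isPer_ev f).cont x t).sub
      ((V.continuous_along ha₃.cont x t).mul (V.continuous_along hg x t)))
  rw [intervalIntegral.integral_congr hA, intervalIntegral.integral_congr hB, neg_add_eq_sub,
    ← intervalIntegral.integral_sub (c₂.intervalIntegrable _ _) (c₁.intervalIntegrable _ _)]
  refine intervalIntegral.integral_congr fun ξ _ => ?_
  ring

lemma IsRegular.isWeakSystemSolution_iff (f : CT p.T) (u : p.Pair) :
    p.IsWeakSystemSolution f u ↔ hp.coeff.IsWeak f u := by
  have h0 : (0 : ℝ) ∈ Icc (0 : ℝ) 1 := by simp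
  have h1 : (1 : ℝ) ∈ Icc (0 : ℝ) 1 := by simp
  have hg : Continuous fun z : ℝ × ℝ => hp.coeff.G u z.2 + ev (hp.coeff.J (u.1 - u.2)) z.1 z.2 :=
    ((hp.continuous_G u).comp continuous_snd).add (isPer_ev _).cont
  refine forall₂_congr fun x hx => forall_congr' fun t => ?_
  have e₁ := integral_terms_eq (g := fun x t => hp.coeff.G u t + ev (hp.coeff.J (u.1 - u.2)) x t)
    hp.coeff.V₁ hp.coeff.hβ₁ hp.coeff.hb₁₂ hp.coeff.ha₃ hg f u.2
    (A := fun ξ => p.d₁ ξ x t * p.b₁₂ ξ (p.τ₁ ξ x t) * ev u.2 ξ (p.τ₁ ξ x t))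
    (B := fun ξ => p.d₁ ξ x t *
      (ev f ξ (p.τ₁ ξ x t) - p.a₃ ξ (p.τ₁ ξ x t) * Fop u ξ (p.τ₁ ξ x t))) (x₀ := 0) (x := x) t
    (fun ξ hξ => by
      have hξ' := uIcc_subset_Icc h0 hx hξ
      rw [hp.d₁_eq hξ' hx, hp.τ₁_eq hξ' hx, hp.coeff_b₁₂ hξ'])
    (fun ξ hξ => by
      have hξ' := uIcc_subset_Icc h0 hx hξ
      rw [hp.d₁_eq hξ' hx, hp.τ₁_eq hξ' hx, hp.coeff_a₃ hξ', hp.Fop_eq u hξ'])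
  have e₂ := integral_terms_eq (g := fun x t => hp.coeff.G u t + ev (hp.coeff.J (u.1 - u.2)) x t)
    hp.coeff.V₂ hp.coeff.hβ₂ hp.coeff.hb₂₁ hp.coeff.ha₃ hg f u.1
    (A := fun ξ => p.d₂ ξ x t * p.b₂₁ ξ (p.τ₂ ξ x t) * ev u.1 ξ (p.τ₂ ξ x t))
    (B := fun ξ => p.d₂ ξ x t *
      (ev f ξ (p.τ₂ ξ x t) - p.a₃ ξ (p.τ₂ ξ x t) * Fop u ξ (p.τ₂ ξ x t))) (x₀ := 1) (x := x) t
    (fun ξ hξ => by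
      have hξ' := uIcc_subset_Icc h1 hx hξ
      rw [hp.d₂_eq hξ' hx, hp.τ₂_eq hξ' hx, hp.coeff_b₂₁ hξ'])
    (fun ξ hξ => by
      have hξ' := uIcc_subset_Icc h1 hx hξ
      rw [hp.d₂_eq hξ' hx, hp.τ₂_eq hξ' hx, hp.coeff_a₃ hξ', hp.Fop_eq u hξ'])
  rw [← e₁, ← e₂, ← add_assoc, ← add_assoc, ← sub_eq_add_neg, ← sub_eq_add_neg, hp.c₁_eq h0 hx, hp.c₂_eq h1 hx,
    hp.τ₁_eq h0 hx, hp.τ₂_eq h1 hx, hp.Gop_eq, hp.Fop_eq u h1, hp.coeff_a h0, hp.coeff_a h1]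
  rfl

lemma IsRegular.isWeakSolution_iff (f : CT p.T) (w : unitInterval × ℝ → ℝ) :
    p.IsWeakSolution f w ↔ ∃ u, hp.coeff.IsWeak f u ∧ ∀ (x : unitInterval) (t : ℝ),
      w (x, t) = hp.coeff.G u t + ev (hp.coeff.J (u.1 - u.2)) x t := by
  refine exists_congr fun u => and_congr (hp.isWeakSystemSolution_iff f u)
    (forall₂_congr fun x t => ?_)
  rw [← hp.Gop_eq, ← hp.Jop_eq u x.2, Gop, add_right_comm]

/-! ### The non-resonance conditions -/

lemma IsRegular.continuous_along_β₁ (x t : ℝ) :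
    Continuous fun η => hp.coeff.b₁₁ η (hp.coeff.V₁.flow η x t) /
      hp.coeff.a η (hp.coeff.V₁.flow η x t) :=
  hp.coeff.V₁.continuous_along (β := fun x t => hp.coeff.b₁₁ x t / hp.coeff.a x t)
    (hp.coeff.hb₁₁.div hp.coeff.ha hp.coeff.a_ne).cont x t

lemma IsRegular.continuous_along_β₂ (x t : ℝ) :
    Continuous fun η => hp.coeff.b₂₂ η (hp.coeff.V₂.flow η x t) /
      hp.coeff.a η (hp.coeff.V₂.flow η x t) :=
  hp.coeff.V₂.continuous_along hp.coeff.hβ₂.cont x t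

lemma IsRegular.cocycle_mul_cocycle (s t : ℝ) :
    hp.coeff.V₁.cocycle hp.coeff.β₁ 0 1 s * hp.coeff.V₂.cocycle hp.coeff.β₂ 1 0 t =
      Real.exp (∫ η in (0 : ℝ)..1, (p.b₁₁ η (p.τ₁ η 1 s) / p.a η (p.τ₁ η 1 s) +
        p.b₂₂ η (p.τ₂ η 0 t) / p.a η (p.τ₂ η 0 t))) := by
  have h0 : (0 : ℝ) ∈ Icc (0 : ℝ) 1 := by simp
  have h1 : (1 : ℝ) ∈ Icc (0 : ℝ) 1 := by simp
  rw [PeriodicField.cocycle, PeriodicField.cocycle, ← Real.exp_add]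
  congr 1
  rw [intervalIntegral.integral_symm, ← intervalIntegral.integral_neg]
  simp only [WaveCoeff.β₁, WaveCoeff.β₂, neg_neg]
  rw [← intervalIntegral.integral_add ((hp.continuous_along_β₁ 1 s).intervalIntegrable _ _)
    ((hp.continuous_along_β₂ 0 t).intervalIntegrable _ _)]
  refine intervalIntegral.integral_congr fun η hη => ?_
  have hη' := uIcc_subset_Icc h0 h1 hη
  simp only [hp.τ₁_eq hη' h1, hp.τ₂_eq hη' h0, hp.coeff_b₁₁ hη', hp.coeff_b₂₂ hη', hp.coeff_a hη']

lemma IsRegular.isUnit_leadingOp (h : p.NonResonant ∨ p.NonResonant') :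
    IsUnit hp.coeff.leadingOp := by
  have h0 : (0 : ℝ) ∈ Icc (0 : ℝ) 1 := by simp
  have h1 : (1 : ℝ) ∈ Icc (0 : ℝ) 1 := by simp
  refine hp.coeff.isUnit_leadingOp (h.imp (fun h t => ?_) fun h t => ?_)
  · rw [hp.cocycle_mul_cocycle, ← hp.τ₁_eq h0 h1, Ne, Real.exp_eq_one_iff]
    exact h t
  · rw [mul_comm, hp.cocycle_mul_cocycle, ← hp.τ₂_eq h1 h0, Ne, Real.exp_eq_one_iff]
    simpa only [add_comm] using h t

end Data

end RobinWave

end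

theorem theorem1p1 (p : RobinWave.Data) (hT : 0 < p.T)
    (ha_pos : ∀ x ∈ Set.Icc (0 : ℝ) 1, ∀ t : ℝ, 0 < p.a x t)
    (har : (∫ t in (0 : ℝ)..p.T, p.a 0 t * p.r₀ t) ≠ 0)
    (ha : RobinWave.IsCTl p.T 2 p.a)
    (ha₁ : RobinWave.IsCTl p.T 1 p.a₁)
    (ha₂ : RobinWave.IsCTl p.T 1 p.a₂)
    (ha₃ : RobinWave.IsCTl p.T 0 p.a₃)
    (hr₀ : ContDiff ℝ 1 p.r₀ ∧ Function.Periodic p.r₀ p.T)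
    (hr₁ : ContDiff ℝ 1 p.r₁ ∧ Function.Periodic p.r₁ p.T)
    (hnr : p.NonResonant ∨ p.NonResonant') :
    -- weak solutions are continuously differentiable and periodic
    (∀ (f : RobinWave.CT p.T) (w : unitInterval × ℝ → ℝ), p.IsWeakSolution f w →
      RobinWave.IsCTl p.T 1 (RobinWave.ev w)) ∧
    -- the weak solutions with zero right-hand side form a finite-dimensional vector space `K`
    ∃ K : Submodule ℝ (unitInterval × ℝ → ℝ),
      (∀ w, w ∈ K ↔ p.IsWeakSolution 0 w) ∧
      FiniteDimensional ℝ K ∧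
      -- the solvable right-hand sides form a closed subspace `R` of codimension `dim K`
      (∃ R : Submodule ℝ (RobinWave.CT p.T),
        (∀ f, f ∈ R ↔ ∃ w, p.IsWeakSolution f w) ∧
        IsClosed (R : Set (RobinWave.CT p.T)) ∧
        FiniteDimensional ℝ (RobinWave.CT p.T ⧸ R) ∧
        Module.finrank ℝ (RobinWave.CT p.T ⧸ R) = Module.finrank ℝ K) ∧
      Xor (0 < Module.finrank ℝ K)
        (∀ f : RobinWave.CT p.T, ∃! w, p.IsWeakSolution f w) := by
  have : Fact (0 < p.T) := ⟨hT⟩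
  have hp : p.IsRegular := ⟨ha_pos, ha, ha₁, ha₂, ha₃, hr₀, hr₁⟩
  have hC : (∫ t in (0 : ℝ)..p.T, hp.coeff.a 0 t * hp.coeff.r₀ t) ≠ 0 := by
    simp only [hp.coeff_a (x := 0) (by simp)]
    exact har
  have hiff : ∀ f w, p.IsWeakSolution f w ↔ ∃ h, hp.coeff.circleOp h + hp.coeff.circleSource f = 0 ∧
      w = fun z : unitInterval × ℝ => hp.coeff.wave h (hp.coeff.sol h f) z.1 z.2 := fun f w =>
    (hp.isWeakSolution_iff f w).trans (hp.coeff.exists_isWeak_iff hC f w)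
  simp only [hiff]
  refine ⟨?_, hp.coeff.fredholm_alternative (hp.isUnit_leadingOp hnr)⟩
  rintro f _ ⟨h, -, rfl⟩
  have hev : ∀ x ∈ Set.Icc (0 : ℝ) 1, ∀ t, RobinWave.ev (fun z : unitInterval × ℝ =>
      hp.coeff.wave h (hp.coeff.sol h f) z.1 z.2) x t = hp.coeff.wave h (hp.coeff.sol h f) x t :=
    fun x hx t => by rw [RobinWave.ev, Set.projIcc_of_mem _ hx]
  refine ⟨(hp.coeff.contDiffOn_wave (hp.coeff.sol_eq h f)).congr fun z hz => hev z.1 hz.1 z.2,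
    fun x hx t => ?_⟩
  rw [hev x hx, hev x hx, (hp.coeff.isPer_wave h _).per]
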